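/- We work over $\mathbb{C}$. A \emph{contraction} $\pi:X\to Z$ is a projective morphism of normal quasi-projective varieties with $\pi_*\mathcal{O}_X=\mathcal{O}_Z$. A \emph{pair} $(X/Z\ni z,B)$ consists of a contraction $\pi:X\to Z$, a (not necessarily closed) point $z\in Z$ with $\dim z<\dim X$ (where $\dim z=\dim\overline{\{z\}}$), and an $\mathbb{R}$-divisor $B$ on $X$ with coefficients in $[0,1]$ such that $K_X+B$ is $\mathbb{R}$-Cartier. For a prime divisor $E$ over $X$ (a prime divisor on a normal variety $Y$ with a proper birational morphism $f:Y\to X$) let $a(E,X,B)=1-\operatorname{mult}_E B_Y$ be its log discrepancy, where $K_Y+B_Y=f^*(K_X+B)$. Let $\operatorname{mld}(X/Z\ni z,B)$ be the infimum of $a(E,X,B)$ over all prime divisors $E$ over $X$ with $\pi(\operatorname{center}_X E)=\overline{\{z\}}$. The pair is \emph{$\epsilon$-lc over $z$} if $\operatorname{mld}(X/Z\ni z,B)\ge\epsilon$, and \emph{lc over $z$} if this holds for $\epsilon=0$. A pair $(X/Z\ni z,B)$ is \emph{$(\epsilon,\mathbb{R})$-complementary} if there is a pair $(X/Z\ni z,B^+)$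 such that $B^+\ge B$, $(X/Z\ni z,B^+)$ is lc and $\epsilon$-lc over $z$, and $K_X+B^+\sim_{\mathbb{R}}0$ over some neighborhood of $z$. For a positive integer $n$, it is \emph{$(\epsilon,n)$-complementary} if there is a pair $(X/Z\ni z,B^+)$ that is $\epsilon$-lc over $z$ and such that, over some neighborhood of $z$, $(X,B^+)$ is lc, $n(K_X+B^+)\sim 0$, and $nB^+\ge n\lfloor B\rfloor+\lfloor (n+1)\{B\}\rfloor$. \textbf{Theorem.} Let $\epsilon$ be a non-negative real number and $p$ a positive integer. Then there exists a positive integer $N$ depending only on $\epsilon$ and $p$ such that, for every pair $(X/Z\ni z,B)$ with $\dim X=1$ that is $(\epsilon,\mathbb{R})$-complementary, $(X/Z\ni z,B)$ is $(\epsilon,n)$-complementary for some positive integer $n$ with $n\le N$ and $p\mid n$. -/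

import Mathlib

open AlgebraicGeometry CategoryTheory

namespace EpsComplement

noncomputable section

/-- A variety over `ℂ`: an integral separated scheme of finite type over `Spec ℂ`. -/
structure Variety where
  toScheme : Scheme.{0}
  str : toScheme ⟶ Spec (CommRingCat.of ℂ)
  isIntegral : IsIntegral toScheme
  isSeparated : IsSeparated str
  locallyOfFiniteType : LocallyOfFiniteType str
  quasiCompact : QuasiCompact str

attribute [instance] Variety.isIntegral

instance (X : Variety) : IsLocallyNoetherian X.toScheme :=
  haveI := X.locallyOfFiniteType
  LocallyOfFiniteType.isLocallyNoetherian X.str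

attribute [local instance] MvPolynomial.gradedAlgebra

/-- Projective `n`-space over `ℂ`, as the `Proj` of `ℂ[x₀, …, xₙ]`. -/
abbrev projSpace (n : ℕ) : Scheme.{0} :=
  Proj (MvPolynomial.homogeneousSubmodule (Fin (n + 1)) ℂ)

/-- The structure morphism of `projSpace n`. -/
def projSpaceStr (n : ℕ) : projSpace n ⟶ Spec (CommRingCat.of ℂ) :=
  Proj.toSpecZero (MvPolynomial.homogeneousSubmodule (Fin (n + 1)) ℂ) ≫
    Spec.map (CommRingCat.ofHom
      (algebraMap ℂ (MvPolynomial.homogeneousSubmodule (Fin (n + 1)) ℂ 0)))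

namespace Variety

/-- All local rings are integrally closed (in their fraction fields). -/
def IsNormal (X : Variety) : Prop :=
  ∀ x : X.toScheme, IsIntegrallyClosed (X.toScheme.presheaf.stalk x)

/-- `X` is a locally closed subscheme of some projective space over `ℂ`. -/
def IsQuasiProjective (X : Variety) : Prop :=
  ∃ (n : ℕ) (i : X.toScheme ⟶ projSpace n), IsImmersion i ∧ i ≫ projSpaceStr n = X.str

/-- The field of rational functions `ℂ(X)`. -/
abbrev K (X : Variety) : Type := X.toScheme.functionField

/-- The embedding of the constants in `ℂ(X)`. -/
def constHom (X : Variety) : CommRingCat.of ℂ ⟶ X.toScheme.functionField :=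
  (Scheme.ΓSpecIso (CommRingCat.of ℂ)).inv ≫ X.str.appTop ≫
    X.toScheme.presheaf.germ ⊤ (genericPoint X.toScheme) (TopologicalSpace.Opens.mem_top _)

instance (X : Variety) : Algebra ℂ X.K := X.constHom.hom.toAlgebra

/-- A prime divisor, given by its generic point: a point of codimension one. -/
abbrev PrimeDivisor (X : Variety) : Type := {x : X.toScheme // Order.coheight x = 1}

/-- Weil `ℝ`-divisors: finite formal sums of prime divisors with real coefficients. -/
abbrev RDivisor (X : Variety) : Type := X.PrimeDivisor →₀ ℝ

end Variety

/-- `π : X ⟶ Z` is projective: it factors as a closed immersion into some `ℙⁿ × Z` followed by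
the projection to `Z`. -/
def IsProjective {X Z : Variety} (π : X.toScheme ⟶ Z.toScheme) : Prop :=
  ∃ (n : ℕ) (i : X.toScheme ⟶ Limits.pullback Z.str (projSpaceStr n)),
    IsClosedImmersion i ∧ i ≫ Limits.pullback.fst Z.str (projSpaceStr n) = π

/-- A contraction: a projective morphism `π` (over `ℂ`) of normal quasi-projective varieties with
`π_* 𝒪_X = 𝒪_Z`. -/
structure IsContraction {X Z : Variety} (π : X.toScheme ⟶ Z.toScheme) : Prop where
  map_str : π ≫ Z.str = X.str
  normal_source : X.IsNormal
  normal_target : Z.IsNormal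
  quasiProjective_source : X.IsQuasiProjective
  quasiProjective_target : Z.IsQuasiProjective
  projective : IsProjective π
  pushforward : ∀ U : Z.toScheme.Opens, IsIso (π.app U)

/-! ### Divisors of functions and of rational differential forms -/

section Divisors

variable {X : Variety}

/-- An element `∑ rᵢ · φᵢ` of `FreeModule_ℝ (ℂ(X)ˣ)` has the `ℝ`-divisor `∑ rᵢ div(φᵢ)`; this is
its coefficient at the prime divisor `P`. -/
def rdiv (g : X.Kˣ →₀ ℝ) (P : X.PrimeDivisor) : ℝ :=
  g.sum fun φ r => r * (X.toScheme.ord (φ : X.K) P.1 : ℝ)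

/-- The order of vanishing at a point `P` of a rational differential form `ω ≠ 0` on a normal
curve: choose a rational function `t` with `ord_P t = 1`, write `ω = g dt`, and take `ord_P g`.
This does not depend on `t`. -/
def formOrd (ω : Ω[X.K⁄ℂ]) (P : X.PrimeDivisor) : ℤ :=
  Classical.epsilon fun m : ℤ => ∃ t g : X.K,
    X.toScheme.ord t P.1 = 1 ∧ ω = g • KaehlerDifferential.D ℂ X.K t ∧ X.toScheme.ord g P.1 = m

/-- The coefficients of the divisor `K_X + B` on a normal curve, where the canonical divisor `K_X`
is the divisor of the nonzero rational differential form `ω`. -/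
def logCanonical (ω : Ω[X.K⁄ℂ]) (B : X.RDivisor) (P : X.PrimeDivisor) : ℝ :=
  (formOrd ω P : ℝ) + B P

/-- On the open set `U`, the divisor `D` is the `ℝ`-divisor of `g`. -/
def IsEquationOn (g : X.Kˣ →₀ ℝ) (D : X.PrimeDivisor → ℝ) (U : X.toScheme.Opens) : Prop :=
  ∀ P : X.PrimeDivisor, P.1 ∈ U → D P = rdiv g P

/-- `D` is `ℝ`-Cartier: locally an `ℝ`-linear combination of principal divisors. -/
def IsRCartier (D : X.PrimeDivisor → ℝ) : Prop :=
  ∀ x : X.toScheme, ∃ U : X.toScheme.Opens, x ∈ U ∧ ∃ g : X.Kˣ →₀ ℝ, IsEquationOn g D U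

end Divisors

/-! ### Pull-back of functions and forms along a dominant morphism -/

section Pullback

variable {X Y : Variety} (f : Y.toScheme ⟶ X.toScheme)

lemma map_genericPoint [IsDominant f] :
    f (genericPoint Y.toScheme) = genericPoint X.toScheme := by
  have h := (genericPoint_spec Y.toScheme).image f.continuous
  rw [Set.image_univ, f.denseRange.closure_range] at h
  exact h.eq (genericPoint_spec X.toScheme)

/-- Pull-back of rational functions along a dominant morphism. -/
def pullbackHom [IsDominant f] : X.toScheme.functionField ⟶ Y.toScheme.functionField :=
  X.toScheme.presheaf.stalkSpecializes (specializes_of_eq (map_genericPoint f)) ≫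
    f.stalkMap (genericPoint Y.toScheme)

lemma constHom_pullbackHom [IsDominant f] (hf : f ≫ X.str = Y.str) :
    X.constHom ≫ pullbackHom f = Y.constHom := by
  simp only [Variety.constHom, pullbackHom, Category.assoc]
  rw [← hf, TopCat.Presheaf.germ_stalkSpecializes_assoc, Scheme.Hom.germ_stalkMap]
  simp only [Scheme.Hom.comp_appTop, Category.assoc]
  rfl

/-- Pull-back of rational functions, as a homomorphism of `ℂ`-algebras. -/
def pullbackFun [IsDominant f] (hf : f ≫ X.str = Y.str) : X.K →ₐ[ℂ] Y.K :=
  { (pullbackHom f).hom with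
    commutes' := fun c =>
      congrArg (fun h : CommRingCat.of ℂ ⟶ Y.toScheme.functionField => h.hom c)
        (constHom_pullbackHom f hf) }

end Pullback

/-- The map on differential forms induced by a homomorphism of `ℂ`-algebras,
`a db ↦ σ(a) d(σ b)`. -/
def formMap {K L : Type} [Field K] [Field L] [Algebra ℂ K] [Algebra ℂ L] (σ : K →ₐ[ℂ] L)
    (ω : Ω[K⁄ℂ]) : Ω[L⁄ℂ] :=
  letI : Algebra K L := σ.toRingHom.toAlgebra
  haveI : IsScalarTower ℂ K L := IsScalarTower.of_algebraMap_eq fun c => (σ.commutes c).symm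
  KaehlerDifferential.map ℂ ℂ K L ω

/-! ### Log discrepancies -/

/-- A prime divisor over `X`: a prime divisor `E` on a normal variety `Y` with a proper birational
morphism `f : Y ⟶ X`. -/
structure DivisorOver (X : Variety) where
  Y : Variety
  normal : Y.IsNormal
  f : Y.toScheme ⟶ X.toScheme
  map_str : f ≫ X.str = Y.str
  proper : IsProper f
  dominant : IsDominant f
  birational : Function.Bijective (pullbackFun f map_str)
  E : Y.PrimeDivisor

attribute [instance] DivisorOver.dominant

namespace DivisorOver

variable {X : Variety} (E : DivisorOver X)

/-- The generic point of the center of `E` on `X`. -/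
def center : X.toScheme := E.f E.E.1

/-- `E` has multiplicity `m` in the pull-back of the `ℝ`-Cartier divisor `D`, computed from a local
equation of `D` near the center of `E`. -/
def IsMultPullback (D : X.PrimeDivisor → ℝ) (m : ℝ) : Prop :=
  ∃ (U : X.toScheme.Opens) (g : X.Kˣ →₀ ℝ), E.center ∈ U ∧ IsEquationOn g D U ∧
    m = g.sum fun φ r => r * (E.Y.toScheme.ord (pullbackFun E.f E.map_str (φ : X.K)) E.E.1 : ℝ)

/-- `a = a(E, X, B)`, the log discrepancy. Writing `K_Y + B_Y = f^*(K_X + B)` with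
`K_X = div ω` and `K_Y = div (f^* ω)`, it is `1 - mult_E B_Y`. -/
def IsLogDiscrepancy (B : X.RDivisor) (a : ℝ) : Prop :=
  ∃ (ω : Ω[X.K⁄ℂ]) (m : ℝ), ω ≠ 0 ∧ E.IsMultPullback (logCanonical ω B) m ∧
    a = 1 - (m - (formOrd (formMap (pullbackFun E.f E.map_str) ω) E.E : ℝ))

end DivisorOver

section Pairs

variable {X Z : Variety} (π : X.toScheme ⟶ Z.toScheme) (z : Z.toScheme)

/-- `e(z)`: the prime divisors over `X` whose center maps onto the closure of `z`, that is, the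
generic point of the center maps to `z`. -/
def divisorsOver : Set (DivisorOver X) := {E | π E.center = z}

/-- The minimal log discrepancy `mld(X/Z ∋ z, B)`. -/
def mld (B : X.RDivisor) : EReal :=
  sInf {a : EReal | ∃ E ∈ divisorsOver π z, ∃ r : ℝ, E.IsLogDiscrepancy B r ∧ a = (r : EReal)}

/-- `(X/Z ∋ z, B)` is `ε`-lc over `z`. -/
def IsEpsLC (ε : ℝ) (B : X.RDivisor) : Prop := (ε : EReal) ≤ mld π z B

/-- `(X/Z ∋ z, B)` is a pair (`X` being a curve). -/
structure IsPair (B : X.RDivisor) : Prop where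
  contraction : IsContraction π
  nonneg : ∀ P, 0 ≤ B P
  le_one : ∀ P, B P ≤ 1
  rCartier : ∀ ω : Ω[X.K⁄ℂ], ω ≠ 0 → IsRCartier (logCanonical ω B)
  dim_lt : topologicalKrullDim (closure {z} : Set Z.toScheme) < topologicalKrullDim X.toScheme

/-- `(X/Z ∋ z, B')` is an `(ε, ℝ)`-complement of `(X/Z ∋ z, B)`. -/
structure IsRComplement (ε : ℝ) (B B' : X.RDivisor) : Prop where
  pair : IsPair π z B'
  le : B ≤ B'
  lc : IsEpsLC π z 0 B'
  rLinEquiv : ∃ V : Z.toScheme.Opens, z ∈ V ∧ ∃ (ω : Ω[X.K⁄ℂ]) (g : X.Kˣ →₀ ℝ), ω ≠ 0 ∧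
    IsEquationOn g (logCanonical ω B') (π ⁻¹ᵁ V)
  epsLC : IsEpsLC π z ε B'

/-- `(X/Z ∋ z, B')` is an `(ε, n)`-complement of `(X/Z ∋ z, B)`. -/
structure IsNComplement (ε : ℝ) (n : ℕ) (B B' : X.RDivisor) : Prop where
  pair : IsPair π z B'
  nhd : ∃ V : Z.toScheme.Opens, z ∈ V ∧
    (∀ E : DivisorOver X, π E.center ∈ V → ∀ a : ℝ, E.IsLogDiscrepancy B' a → 0 ≤ a) ∧
    (∃ (ω : Ω[X.K⁄ℂ]) (φ : X.K), ω ≠ 0 ∧ φ ≠ 0 ∧ ∀ P : X.PrimeDivisor, P.1 ∈ π ⁻¹ᵁ V →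
      (n : ℝ) * logCanonical ω B' P = (X.toScheme.ord φ P.1 : ℝ)) ∧
    (∀ P : X.PrimeDivisor, P.1 ∈ π ⁻¹ᵁ V →
      (n : ℝ) * (⌊B P⌋ : ℝ) + (⌊((n : ℝ) + 1) * Int.fract (B P)⌋ : ℝ) ≤ (n : ℝ) * B' P)
  epsLC : IsEpsLC π z ε B'

/-- `(X/Z ∋ z, B)` is `(ε, ℝ)`-complementary. -/
def IsRComplementary (ε : ℝ) (B : X.RDivisor) : Prop :=
  ∃ B' : X.RDivisor, IsRComplement π z ε B B'

/-- `(X/Z ∋ z, B)` is `(ε, n)`-complementary. -/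
def IsNComplementary (ε : ℝ) (n : ℕ) (B : X.RDivisor) : Prop :=
  ∃ B' : X.RDivisor, IsNComplement π z ε n B B'

end Pairs

end

end EpsComplement

/-! On a curve every divisor over `X` is a point of `X`, so log discrepancies are `1 - B P` and the
lc conditions only bound coefficients: over `z` they are at most `c = 1 - ε`.

If `z` is not generic, the contraction is an isomorphism near `z`, all divisors are principal near
the single point over `z`, and `n` only has to keep the rounded coefficient below `n * c`. If `z` is
generic, `Z` is a point and `X` is complete. Then `K_X + B⁺ ∼_ℝ 0` has degree zero. If there is a
nonzero regular form, it has no zeros and `B⁺ = 0`, so `n = p` works. Otherwise `X` is rational,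
`B⁺` has degree `2`, and degree zero divisors are principal. It remains to find a bounded `n` for
which the rounded coefficients are at most `n * c` and add up to at most `2 * n`; missing degree is
put on new points with coefficient `1 / n`.

Such an `n` comes from `exists_bound`: merging small coefficients leaves four of them, Dirichlet
approximation gives an `n` that works near a given point of a compact set, and compactness bounds
`n`.

The dichotomy `exists_regular_form_or_rational` is proved in the function field. The functions
regular where `t` is have a `ℂ[t]`-basis orthogonal for growth at the poles of `t`
(`exists_reduced`). If some basis element has growth at least `2`, its trace dual times `dt` is a
regular form. Otherwise the polar divisor of `t`, of degree `d`, has `d + 1` independent sections,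
and removing points leaves a function with one simple pole. Points and places are matched by the
valuative criteria (`place_injective`, `place_surjective`). -/

set_option linter.unusedSectionVars false
set_option linter.style.haveILetI false

namespace EpsComplement
noncomputable section

/-! ### Arithmetic of complements -/

/-- The integer `n⌊b⌋ + ⌊(n+1){b}⌋` for a coefficient `b ∈ [0, 1]`. -/
def roundUp (n : ℕ) (b : ℝ) : ℤ := if b = 1 then n else ⌊((n : ℝ) + 1) * b⌋

lemma floor_formula {n : ℕ} {b : ℝ} (h0 : 0 ≤ b) (h1 : b ≤ 1) :
    (n : ℝ) * (⌊b⌋ : ℝ) + (⌊((n : ℝ) + 1) * Int.fract b⌋ : ℝ) = (roundUp n b : ℝ) := by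
  rcases h1.lt_or_eq with h | rfl
  · have hf : ⌊b⌋ = 0 := Int.floor_eq_zero_iff.2 ⟨h0, h⟩
    have hfr : Int.fract b = b := Int.fract_eq_self.2 ⟨h0, h⟩
    rw [roundUp, if_neg h.ne, hf, hfr]; simp
  · simp [roundUp]

lemma roundUp_nonneg {n : ℕ} {b : ℝ} (h0 : 0 ≤ b) : 0 ≤ roundUp n b := by
  unfold roundUp
  split_ifs
  · positivity
  · exact Int.floor_nonneg.2 (by positivity)

lemma roundUp_le_of_lt {n : ℕ} {b : ℝ} {k : ℤ} (h1 : b ≤ 1) (h : ((n : ℝ) + 1) * b < k + 1) :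
    roundUp n b ≤ k := by
  unfold roundUp
  split_ifs with hb
  · subst hb
    have : ((n : ℤ) : ℝ) < (k : ℝ) := by push_cast; linarith
    exact_mod_cast this.le
  · exact Int.lt_add_one_iff.1 (Int.floor_lt.2 (by push_cast; exact h))

lemma roundUp_le_self {n : ℕ} {b : ℝ} (h1 : b ≤ 1) : roundUp n b ≤ n := by
  rcases h1.lt_or_eq with h | rfl
  · apply roundUp_le_of_lt h1
    have : (0 : ℝ) < n + 1 := by positivity
    push_cast
    nlinarith
  · simp [roundUp]

lemma roundUp_mono {n : ℕ} {a b : ℝ} (hab : a ≤ b) (h1 : b ≤ 1) : roundUp n a ≤ roundUp n b := by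
  rcases h1.lt_or_eq with h | rfl
  · rw [roundUp, roundUp, if_neg h.ne, if_neg (hab.trans_lt h).ne]
    exact Int.floor_le_floor (by gcongr)
  · exact (roundUp_le_self hab).trans (by simp [roundUp])

/-- Merging two coefficients can only raise the rounded total. The strict inequality matters: for `a
= b = 1/2` and `n = 1` the left side is `2`, while `roundUp 1 1 = 1`. -/
lemma roundUp_add_le {n : ℕ} {a b : ℝ} (ha : 0 ≤ a) (hb : 0 ≤ b) (h : a + b < 1) :
    roundUp n a + roundUp n b ≤ roundUp n (a + b) := by
  rw [roundUp, roundUp, roundUp, if_neg h.ne, if_neg (by linarith), if_neg (by linarith), mul_add]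
  exact Int.le_floor_add _ _

/-- Pairs with sum below `1` are merged until at most four numbers remain, so one `c` serves all
`n`. Five numbers of sum at most `2` contain such a pair: if `a + b` and `c + d` are at least `1`,
both equal `1` and `e = 0`, and then `a + e` and `b + e` cannot both reach `1`. -/
lemma exists_merge (m : Multiset ℝ) (hm : ∀ x ∈ m, 0 ≤ x ∧ x ≤ 1) (hs : m.sum ≤ 2) :
    ∃ c : Fin 4 → ℝ, (∀ i, 0 ≤ c i ∧ c i ≤ 1) ∧ ∑ i, c i = m.sum ∧
      ∀ n, (m.map (roundUp n)).sum ≤ ∑ i, roundUp n (c i) := by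
  induction hk : m.card using Nat.strong_induction_on generalizing m with
  | _ k ih =>
  have merge : ∀ a b : ℝ, ∀ r : Multiset ℝ, m = a ::ₘ b ::ₘ r → a + b < 1 →
      ∃ c : Fin 4 → ℝ, (∀ i, 0 ≤ c i ∧ c i ≤ 1) ∧ ∑ i, c i = m.sum ∧
      ∀ n, (m.map (roundUp n)).sum ≤ ∑ i, roundUp n (c i) := by
    rintro a b r rfl hab
    have ha := hm a (by simp)
    have hb := hm b (by simp)
    obtain ⟨c, h1, h2, h3⟩ := ih ((a + b) ::ₘ r).card (by rw [← hk]; simp) ((a + b) ::ₘ r)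
      (by
        intro x hx
        rcases Multiset.mem_cons.1 hx with rfl | hx
        · exact ⟨by linarith, hab.le⟩
        · exact hm x (by simp [hx])) (by simpa [add_assoc] using hs) rfl
    refine ⟨c, h1, by simpa [add_assoc] using h2, fun n => (le_trans ?_ (h3 n))⟩
    have := roundUp_add_le (n := n) ha.1 hb.1 hab
    simp only [Multiset.map_cons, Multiset.sum_cons]
    linarith
  by_cases h5 : 5 ≤ m.card
  · have split : ∀ s : Multiset ℝ, 0 < s.card → ∃ a t, s = a ::ₘ t := fun s hs => by
      obtain ⟨a, ha⟩ := Multiset.card_pos_iff_exists_mem.1 hs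
      exact ⟨a, Multiset.exists_cons_of_mem ha⟩
    obtain ⟨a, m, rfl⟩ := split m (by omega)
    obtain ⟨b, m, rfl⟩ := split m (by rw [Multiset.card_cons] at h5; omega)
    obtain ⟨c, m, rfl⟩ := split m (by simp only [Multiset.card_cons] at h5; omega)
    obtain ⟨d, m, rfl⟩ := split m (by simp only [Multiset.card_cons] at h5; omega)
    obtain ⟨e, r, rfl⟩ := split m (by simp only [Multiset.card_cons] at h5; omega)
    have hr : 0 ≤ r.sum := Multiset.sum_nonneg fun x hx => (hm x (by simp [hx])).1
    have he := hm e (by simp)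
    simp only [Multiset.sum_cons] at hs
    by_cases hab : a + b < 1
    · exact merge a b _ rfl hab
    by_cases hcd : c + d < 1
    · exact merge c d (a ::ₘ b ::ₘ e ::ₘ r)
        (by simp only [← Multiset.singleton_add]; abel) hcd
    by_cases hae : a + e < 1
    · exact merge a e (b ::ₘ c ::ₘ d ::ₘ r)
        (by simp only [← Multiset.singleton_add]; abel) hae
    · exact merge b e (a ::ₘ c ::ₘ d ::ₘ r)
        (by simp only [← Multiset.singleton_add]; abel) (by linarith)
  · push Not at h5
    obtain ⟨l, rfl⟩ := Quot.exists_rep m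
    have hl : l.length < 5 := by simpa using h5
    have key : ∀ x : ℝ, x ∈ l → 0 ≤ x ∧ x ≤ 1 := fun x hx => hm x (by simpa using hx)
    have z (n : ℕ) : roundUp n 0 = 0 := by simp [roundUp]
    match l, hl, key with
    | [], _, _ => exact ⟨0, by simp, by simp, by simp [z]⟩
    | [a], _, h =>
      exact ⟨![a, 0, 0, 0], by simpa [Fin.forall_fin_succ] using h,
        by simp [Fin.sum_univ_succ], by simp [z, Fin.sum_univ_succ]⟩
    | [a, b], _, h =>
      exact ⟨![a, b, 0, 0], by simpa [Fin.forall_fin_succ] using h,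
        by simp [Fin.sum_univ_succ], by simp [z, Fin.sum_univ_succ]⟩
    | [a, b, c], _, h =>
      exact ⟨![a, b, c, 0], by simpa [Fin.forall_fin_succ] using h,
        by simp [Fin.sum_univ_succ], by simp [z, Fin.sum_univ_succ]⟩
    | [a, b, c, d], _, h =>
      exact ⟨![a, b, c, d], by simpa [Fin.forall_fin_succ] using h,
        by simp [Fin.sum_univ_succ], by simp [Fin.sum_univ_succ]⟩

/-- Simultaneous approximation. -/
lemma exists_simultaneous {ι : Type*} [Finite ι] (v : ι → ℝ) {η : ℝ} (hη : 0 < η) {L : ℕ}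
    (hL : 0 < L) : ∃ n : ℕ, 0 < n ∧ L ∣ n ∧ ∀ i, ∃ k : ℤ, |n * v i - k| < η := by
  obtain ⟨Q, hQ⟩ := exists_nat_gt (1 / η)
  have hQ0 : (0 : ℝ) < Q := (by positivity : (0 : ℝ) < 1 / η).trans hQ
  have hlt : ∀ (m : ℕ) i, ⌊Q * Int.fract (m * L * v i)⌋₊ < Q := fun m i => by
    rw [Nat.floor_lt (by positivity)]
    have := Int.fract_lt_one (m * L * v i)
    nlinarith
  -- Pigeonhole: two multiples of `L` put every fractional part in the same box of width `1 / Q <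
  -- η`; their difference is the wanted `n`.
  let f : ℕ → ι → Fin Q := fun m i => ⟨⌊Q * Int.fract (m * L * v i)⌋₊, hlt m i⟩
  obtain ⟨m, m', hne, heq⟩ := Finite.exists_ne_map_eq_of_infinite f
  wlog hmm : m < m' generalizing m m'
  · exact this m' m hne.symm heq.symm (lt_of_le_of_ne (not_lt.1 hmm) hne.symm)
  refine ⟨(m' - m) * L, Nat.mul_pos (by omega) hL, Dvd.intro_left _ rfl, fun i =>
    ⟨⌊m' * L * v i⌋ - ⌊m * L * v i⌋, ?_⟩⟩
  have h1 : ⌊Q * Int.fract (m * L * v i)⌋₊ = ⌊Q * Int.fract (m' * L * v i)⌋₊ := by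
    have := congrFun heq i
    simpa [f] using this
  have a1 := Nat.floor_le (a := Q * Int.fract (m * L * v i)) (by positivity)
  have a2 := Nat.lt_floor_add_one (Q * Int.fract (m * L * v i))
  have a3 := Nat.floor_le (a := Q * Int.fract (m' * L * v i)) (by positivity)
  have a4 := Nat.lt_floor_add_one (Q * Int.fract (m' * L * v i))
  rw [h1] at a1 a2
  have e1 := Int.floor_add_fract (m * L * v i)
  have e2 := Int.floor_add_fract (m' * L * v i)
  have key : ((m' - m : ℕ) * L : ℕ) * v i - ((⌊m' * L * v i⌋ - ⌊m * L * v i⌋ : ℤ) : ℝ) =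
      Int.fract (m' * L * v i) - Int.fract (m * L * v i) := by
    push_cast [Nat.cast_sub hmm.le]
    linarith
  rw [key]
  have hQη : 1 < Q * η := by rwa [div_lt_iff₀ hη] at hQ
  rw [abs_lt]
  constructor <;> nlinarith

/-- Simultaneous approximation, from above in the first coordinate. -/
lemma exists_simultaneous_of_le {ι : Type*} [Finite ι] (c : ℝ) (v : ι → ℝ) {η : ℝ} (hη : 0 < η)
    {L : ℕ} (hL : 0 < L) :
    ∃ n : ℕ, 0 < n ∧ L ∣ n ∧ (∃ k : ℤ, 0 ≤ n * c - k ∧ n * c - k < η) ∧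
      ∀ i, ∃ k : ℤ, |n * v i - k| < η := by
  let w : Option ι → ℝ := fun o => o.elim c v
  obtain ⟨n₁, h0, hd, h⟩ := exists_simultaneous w (half_pos hη) hL
  obtain ⟨k₁, hk₁⟩ := h none
  simp only [w, Option.elim] at hk₁
  rw [abs_lt] at hk₁
  by_cases hs : 0 ≤ n₁ * c - k₁
  · refine ⟨n₁, h0, hd, ⟨k₁, hs, by linarith⟩, fun i => ?_⟩
    obtain ⟨k, hk⟩ := h (some i)
    exact ⟨k, hk.trans (by linarith)⟩
  push Not at hs
  -- `n₁ * c` falls short of `k₁`. Subtracting `n₁` from a second solution whose error is smaller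
  -- than this shortfall reverses the sign; divisibility by `2 * n₁` keeps the difference positive.
  obtain ⟨n₂, h0', hd', h'⟩ := exists_simultaneous w
    (η := min (-(n₁ * c - k₁)) (η / 2)) (lt_min (by linarith) (by linarith)) (L := 2 * n₁) (by omega)
  have hle : 2 * n₁ ≤ n₂ := Nat.le_of_dvd h0' hd'
  have hcast : ((n₂ - n₁ : ℕ) : ℝ) = n₂ - n₁ := by push_cast [Nat.cast_sub (by omega : n₁ ≤ n₂)]; rfl
  refine ⟨n₂ - n₁, by omega, Nat.dvd_sub (hd.trans ((Dvd.intro_left 2 rfl).trans hd')) hd, ?_, ?_⟩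
  · obtain ⟨k₂, hk₂⟩ := h' none
    simp only [w, Option.elim, lt_min_iff, abs_lt] at hk₂
    refine ⟨k₂ - k₁, ?_, ?_⟩ <;> rw [hcast] <;> push_cast <;> linarith
  · intro i
    obtain ⟨k, hk⟩ := h (some i)
    obtain ⟨k', hk'⟩ := h' (some i)
    simp only [w, Option.elim, lt_min_iff, abs_lt] at hk hk'
    refine ⟨k' - k, ?_⟩
    rw [hcast, abs_lt]
    push_cast
    constructor <;> linarith

/-- `n` is adapted to the bound `c` for the coefficients. -/
def IsAdapted (c : ℝ) (n : ℕ) : Prop :=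
  1 ≤ n * c ∧ ∀ x, 0 ≤ x → x ≤ c → (roundUp n x : ℝ) ≤ n * c

/-- If `n * b i` is within `η ≤ 1 - b i` of the integer `k i`, then `(n + 1) * b i < k i + 1`, so
`roundUp n (b i) ≤ k i`, and the strict inequality persists near `b`. Four errors below `1/4` force
the `k i` to add up to `2 * n`. In the same way an integer `k₀` just below `n * c` gives `roundUp n
x ≤ k₀ ≤ n * c` for `x ≤ c`. -/
lemma exists_adapted_nhds {c : ℝ} (hc : 0 < c) (hc1 : c ≤ 1) {p : ℕ} (hp : 0 < p) (b : Fin 4 → ℝ)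
    (hb : ∀ i, 0 ≤ b i ∧ b i ≤ 1) (hs : ∑ i, b i = 2) :
    ∃ n : ℕ, 0 < n ∧ p ∣ n ∧ IsAdapted c n ∧
      ∃ U : Set (Fin 4 → ℝ), IsOpen U ∧ b ∈ U ∧ ∀ b' ∈ U, (∀ i, b' i ≤ 1) →
        ∑ i, roundUp n (b' i) ≤ 2 * n := by
  obtain ⟨η, hη, hη4, hηb, hηc⟩ : ∃ η : ℝ, 0 < η ∧ 4 * η ≤ 1 ∧ (∀ i, b i < 1 → η ≤ 1 - b i) ∧
      (c < 1 → η ≤ 1 - c) := by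
    have h1 : ∀ x : ℝ, ∃ δ > 0, ∀ η ≤ δ, x < 1 → η ≤ 1 - x := fun x => by
      by_cases hx : x < 1
      · exact ⟨1 - x, by linarith, fun η h _ => h⟩
      · exact ⟨1, one_pos, fun _ _ h => absurd h hx⟩
    choose δ hδ hδ' using h1
    have hne : (Finset.univ : Finset (Fin 4)).Nonempty := Finset.univ_nonempty
    refine ⟨min (min (1 / 4) (δ c)) (Finset.univ.inf' hne fun i => δ (b i)), ?_, ?_, ?_, ?_⟩
    · refine lt_min (lt_min (by norm_num) (hδ _)) ((Finset.lt_inf'_iff _).2 fun i _ => hδ _)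
    · have := (min_le_left (min (1 / 4) (δ c)) (Finset.univ.inf' hne fun i => δ (b i))).trans
        (min_le_left _ _)
      linarith
    · intro i
      exact hδ' _ _ ((min_le_right _ _).trans (Finset.inf'_le _ (Finset.mem_univ i)))
    · exact hδ' _ _ ((min_le_left _ _).trans (min_le_right _ _))
  obtain ⟨m, hm⟩ := exists_nat_gt (1 / c)
  have hm0 : 0 < m := by
    have : (0 : ℝ) < m := (by positivity : 0 < 1 / c).trans hm
    exact_mod_cast this
  -- Divisibility by `m > 1 / c` makes `n * c ≥ 1`.
  obtain ⟨n, hn, hd, ⟨k₀, hk₀, hk₀'⟩, hk⟩ := exists_simultaneous_of_le c b hη (Nat.mul_pos hp hm0)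
  choose k hk using hk
  have hmn : (m : ℝ) ≤ n := by exact_mod_cast Nat.le_of_dvd hn ((Dvd.intro_left p rfl).trans hd)
  have hmc : 1 < m * c := by rwa [div_lt_iff₀ hc] at hm
  refine ⟨n, hn, (Dvd.intro _ rfl).trans hd, ⟨by nlinarith, fun x hx hxc => ?_⟩, ?_⟩
  · rcases hc1.lt_or_eq with h | rfl
    · have h2 : roundUp n x ≤ k₀ := by
        apply roundUp_le_of_lt (by linarith)
        have := hηc h
        have : ((n : ℝ) + 1) * x ≤ (n + 1) * c := by gcongr
        linarith
      have : (roundUp n x : ℝ) ≤ k₀ := by exact_mod_cast h2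
      linarith
    · have := roundUp_le_self (n := n) hxc
      have : (roundUp n x : ℝ) ≤ n := by exact_mod_cast this
      linarith
  · have hsum : ∑ i, k i = 2 * (n : ℤ) := by
      have h1 : |∑ i, ((n : ℝ) * b i - k i)| < 1 := by
        refine (Finset.abs_sum_le_sum_abs _ _).trans_lt ((Finset.sum_lt_sum_of_nonempty
          Finset.univ_nonempty fun i _ => hk i).trans_le ?_)
        simpa using hη4
      rw [Finset.sum_sub_distrib, ← Finset.mul_sum, hs] at h1
      have h2 : |((n * 2 - ∑ i, k i : ℤ) : ℝ)| < 1 := by push_cast; exact h1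
      rw [← Int.cast_abs] at h2
      have h3 : |(n * 2 - ∑ i, k i : ℤ)| < 1 := by exact_mod_cast h2
      have := Int.abs_lt_one_iff.1 h3
      linarith
    -- Coordinates with `b i = 1` need no constraint: there `k i = n`, which bounds every `roundUp
    -- n`.
    refine ⟨{b' | ∀ i, b i < 1 → ((n : ℝ) + 1) * b' i < k i + 1}, ?_, ?_, ?_⟩
    · simp only [Set.ofPred_forall]
      refine isOpen_iInter_of_finite fun i => isOpen_iInter_of_finite fun _ => ?_
      exact isOpen_lt (by fun_prop) (by fun_prop)
    · intro i hi
      have h1 := (abs_lt.1 (hk i)).2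
      have h2 := hηb i hi
      linarith
    · intro b' hb' h1
      rw [← hsum]
      refine Finset.sum_le_sum fun i _ => ?_
      rcases (hb i).2.lt_or_eq with h | h
      · exact roundUp_le_of_lt (h1 i) (hb' i h)
      · have hki : k i = n := by
          have h2 := hk i
          rw [h, mul_one] at h2
          have h3 : |((n - k i : ℤ) : ℝ)| < 1 := by push_cast; linarith
          rw [← Int.cast_abs] at h3
          have h4 : |(n - k i : ℤ)| < 1 := by exact_mod_cast h3
          have := Int.abs_lt_one_iff.1 h4
          linarith
        rw [hki]
        exact roundUp_le_self (h1 i)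

/-- Boundedness of complements of degree two divisors on the line. -/
theorem exists_bound {c : ℝ} (hc : 0 < c) (hc1 : c ≤ 1) {p : ℕ} (hp : 0 < p) :
    ∃ N : ℕ, ∀ m : Multiset ℝ, (∀ x ∈ m, 0 ≤ x ∧ x ≤ 1) → m.sum = 2 →
      ∃ n : ℕ, 0 < n ∧ n ≤ N ∧ p ∣ n ∧ IsAdapted c n ∧ (m.map (roundUp n)).sum ≤ 2 * n := by
  let C : Set (Fin 4 → ℝ) := Set.Icc 0 1 ∩ {b | ∑ i, b i = 2}
  have hC : IsCompact C := isCompact_Icc.inter_right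
    (isClosed_eq (by fun_prop) (by fun_prop))
  have hmem : ∀ b ∈ C, ∀ i, 0 ≤ b i ∧ b i ≤ 1 := fun b hb i => ⟨hb.1.1 i, hb.1.2 i⟩
  choose! n hn hd hA U hU hbU hle using fun (b : Fin 4 → ℝ) (hb : b ∈ C) =>
    exists_adapted_nhds hc hc1 hp b (hmem b hb) hb.2
  -- Each `n b` works on the whole of `U b`, and finitely many of these sets cover the compact `C`.
  obtain ⟨s, hs⟩ := hC.elim_finite_subcover (fun b : C => U b.1) (fun b => hU b.1 b.2)
    fun b hb => Set.mem_iUnion.2 ⟨⟨b, hb⟩, hbU b hb⟩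
  refine ⟨s.sup fun b => n b.1, fun m hm hsum => ?_⟩
  obtain ⟨b, hb, hbs, hbr⟩ := exists_merge m hm hsum.le
  have hbC : b ∈ C := ⟨⟨fun i => (hb i).1, fun i => (hb i).2⟩, hbs.trans hsum⟩
  obtain ⟨a, ha, hba⟩ := Set.mem_iUnion₂.1 (hs hbC)
  exact ⟨n a.1, hn _ a.2, Finset.le_sup (f := fun b : C => n b.1) ha, hd _ a.2, hA _ a.2,
    (hbr _).trans (hle _ a.2 b hba fun i => (hb i).2)⟩

end
end EpsComplement

namespace EpsComplement
noncomputable section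

/-! ### Places of a function field -/

open Polynomial

/-- A place of `K/ℂ`: a normalized discrete valuation, trivial on the constants. The order of `0` is
`0` by convention. -/
@[ext] structure Place (K : Type*) [Field K] [Algebra ℂ K] where
  ord : K → ℤ
  ord_zero : ord 0 = 0
  ord_mul : ∀ {x y}, x ≠ 0 → y ≠ 0 → ord (x * y) = ord x + ord y
  ord_add : ∀ {x y}, x + y ≠ 0 → min (ord x) (ord y) ≤ ord (x + y)
  ord_const : ∀ c : ℂ, ord (algebraMap ℂ K c) = 0
  exists_uniformizer : ∃ τ, ord τ = 1

namespace Place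

variable {K : Type*} [Field K] [Algebra ℂ K] (v : Place K)

lemma ord_one : v.ord 1 = 0 := by simpa using v.ord_const 1

lemma ord_neg (x : K) : v.ord (-x) = v.ord x := by
  by_cases hx : x = 0
  · simp [hx]
  have h : v.ord (-1) = 0 := by simpa using v.ord_const (-1)
  rw [← neg_one_mul, v.ord_mul (by simp) hx, h, zero_add]

lemma ord_inv (x : K) : v.ord x⁻¹ = -v.ord x := by
  by_cases hx : x = 0
  · simp [hx, v.ord_zero]
  have := v.ord_mul hx (inv_ne_zero hx)
  rw [mul_inv_cancel₀ hx, v.ord_one] at this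
  linarith

lemma ord_div {x y : K} (hx : x ≠ 0) (hy : y ≠ 0) : v.ord (x / y) = v.ord x - v.ord y := by
  rw [div_eq_mul_inv, v.ord_mul hx (inv_ne_zero hy), ord_inv]; ring

lemma ord_pow (x : K) (n : ℕ) : v.ord (x ^ n) = n * v.ord x := by
  by_cases hx : x = 0
  · subst hx
    cases n <;> simp [v.ord_zero, v.ord_one]
  induction n with
  | zero => simp [v.ord_one]
  | succ n ih => rw [pow_succ, v.ord_mul (pow_ne_zero _ hx) hx, ih]; push_cast; ring

lemma ord_zpow (x : K) (n : ℤ) : v.ord (x ^ n) = n * v.ord x := by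
  cases n with
  | ofNat n => simp [ord_pow]
  | negSucc n => rw [zpow_negSucc, ord_inv, ord_pow]; push_cast [Int.negSucc_eq]; ring

/-- `x` is regular at `v`. -/
def Int (x : K) : Prop := 0 ≤ v.ord x

lemma int_zero : v.Int 0 := v.ord_zero.ge

lemma int_one : v.Int 1 := v.ord_one.ge

lemma int_const (c : ℂ) : v.Int (algebraMap ℂ K c) := (v.ord_const c).ge

variable {v}

lemma Int.mul {x y : K} (hx : v.Int x) (hy : v.Int y) : v.Int (x * y) := by
  by_cases h : x = 0
  · simpa [h] using v.int_zero
  by_cases h' : y = 0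
  · simpa [h'] using v.int_zero
  unfold Int at *
  rw [v.ord_mul h h']
  linarith

lemma Int.add {x y : K} (hx : v.Int x) (hy : v.Int y) : v.Int (x + y) := by
  by_cases h : x + y = 0
  · rw [h]; exact v.int_zero
  exact (le_min hx hy).trans (v.ord_add h)

lemma Int.neg {x : K} (hx : v.Int x) : v.Int (-x) := by
  unfold Int; rwa [v.ord_neg]

lemma Int.sub {x y : K} (hx : v.Int x) (hy : v.Int y) : v.Int (x - y) := by
  rw [sub_eq_add_neg]; exact hx.add hy.neg

variable (v)

/-- The ring of functions regular at `v`. -/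
def ring : Subalgebra ℂ K where
  carrier := {x | v.Int x}
  mul_mem' := Int.mul
  add_mem' := Int.add
  algebraMap_mem' := v.int_const

lemma mem_ring {x : K} : x ∈ v.ring ↔ v.Int x := Iff.rfl

variable {v}

lemma Int.pow {x : K} (hx : v.Int x) (n : ℕ) : v.Int (x ^ n) := v.ring.pow_mem hx n

lemma Int.sum {ι : Type*} {s : Finset ι} {f : ι → K} (h : ∀ i ∈ s, v.Int (f i)) :
    v.Int (∑ i ∈ s, f i) := v.ring.sum_mem h

lemma Int.aeval {x : K} (hx : v.Int x) (q : ℂ[X]) : v.Int (aeval x q) :=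
  aeval_mem_adjoin_singleton (R := ℂ) x (p := q) |> fun h =>
    Algebra.adjoin_le (S := v.ring) (by simpa [mem_ring] using hx) h

lemma ord_eq_of_int_of_int_inv {x : K} (h : v.Int x) (h' : v.Int x⁻¹) : v.ord x = 0 := by
  unfold Int at *
  rw [ord_inv] at h'
  linarith

lemma int_div_iff {x y : K} (hx : x ≠ 0) (hy : y ≠ 0) : v.Int (x / y) ↔ v.ord y ≤ v.ord x := by
  unfold Int
  rw [v.ord_div hx hy]
  constructor <;> intro h <;> linarith

/-- Positivity survives adding elements of positive order. -/
lemma ord_pos_add {x y : K} (hx : x = 0 ∨ 0 < v.ord x) (hy : y = 0 ∨ 0 < v.ord y) :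
    x + y = 0 ∨ 0 < v.ord (x + y) := by
  rcases hx with rfl | hx
  · simpa using hy
  rcases hy with rfl | hy
  · simpa using Or.inr hx
  by_cases h : x + y = 0
  · exact Or.inl h
  · exact Or.inr ((lt_min hx hy).trans_le (v.ord_add h))

lemma ord_add_eq_left {x y : K} (hx : x ≠ 0) (h : y = 0 ∨ v.ord x < v.ord y) :
    v.ord (x + y) = v.ord x := by
  rcases h with rfl | h
  · simp
  have hne : x + y ≠ 0 := by
    intro h0
    rw [eq_neg_of_add_eq_zero_left h0, v.ord_neg] at h
    exact lt_irrefl _ h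
  apply le_antisymm
  · have := v.ord_add (x := x + y) (y := -y) (by simpa using hx)
    rw [add_neg_cancel_right, v.ord_neg] at this
    rcases min_le_iff.1 this with h1 | h1 <;> omega
  · exact (le_min le_rfl h.le).trans (v.ord_add hne)

lemma ne_zero_of_ord {x : K} (h : v.ord x ≠ 0) : x ≠ 0 := by
  rintro rfl; exact h v.ord_zero

/-- A place is determined by its ring. -/
lemma ext_of_int {v w : Place K} (h : ∀ x, v.Int x → w.Int x) : v = w := by
  have hz : ∀ x, v.ord x = 0 → w.ord x = 0 := fun x hx =>
    ord_eq_of_int_of_int_inv (h _ hx.ge) (h _ (by unfold Int; rw [v.ord_inv, hx]; rfl))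
  obtain ⟨τ, hτ⟩ := v.exists_uniformizer
  have hτ0 : τ ≠ 0 := ne_zero_of_ord (v := v) (by omega)
  -- Dividing `x` by `τ ^ v.ord x` gives a unit for `v`, hence for `w`, so `w.ord` is a multiple of
  -- `v.ord`; the normalization of `w` makes the factor `1`.
  have key : ∀ x, w.ord x = v.ord x * w.ord τ := fun x => by
    by_cases hx : x = 0
    · simp [hx, v.ord_zero, w.ord_zero]
    have h1 : v.ord (x / τ ^ v.ord x) = 0 := by
      rw [v.ord_div hx (zpow_ne_zero _ hτ0), ord_zpow, hτ]; ring
    have h2 := hz _ h1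
    rw [w.ord_div hx (zpow_ne_zero _ hτ0), ord_zpow] at h2
    linarith
  have hpos : 0 ≤ w.ord τ := h τ (by unfold Int; omega)
  obtain ⟨σ, hσ⟩ := w.exists_uniformizer
  have h3 : w.ord τ = 1 := by
    have h4 := key σ
    rw [hσ] at h4
    exact Int.eq_one_of_dvd_one hpos ⟨v.ord σ, by linarith⟩
  ext x
  rw [key x, h3, mul_one]

/-- If `K` is algebraic over `ℂ(x)`, then the residue field of a place is `ℂ`. -/
lemma exists_ord_sub_pos {x : K} (hx : v.Int x)
    (halg : ∀ y : K, ∃ q : ℂ[X][X], q ≠ 0 ∧ q.eval₂ (aeval x).toRingHom y = 0)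
    (htr : Transcendental ℂ x) : ∃ c : ℂ, 0 < v.ord (x - algebraMap ℂ K c) := by
  by_contra! hcon
  have hxc : ∀ c, x - algebraMap ℂ K c ≠ 0 := fun c h =>
    htr (by rw [sub_eq_zero.1 h]; exact isAlgebraic_algebraMap c)
  have h0 : ∀ c, v.ord (x - algebraMap ℂ K c) = 0 := fun c =>
    le_antisymm (hcon c) (hx.sub (v.int_const c))
  -- Over `ℂ` a nonzero polynomial in `x` is a constant times factors `x - c`, all of order `0` by
  -- assumption.
  have hq : ∀ n : ℕ, ∀ q : ℂ[X], q.natDegree = n → v.ord (aeval x q) = 0 := by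
    intro n
    induction n with
    | zero =>
      intro q hq
      rw [natDegree_eq_zero.1 hq |>.choose_spec.symm, aeval_C]
      exact v.ord_const _
    | succ n ih =>
      intro q hq
      obtain ⟨r, hr⟩ := IsAlgClosed.exists_root q (by
        intro h; have := natDegree_eq_zero_iff_degree_le_zero.2 h.le; omega)
      obtain ⟨q', rfl⟩ := dvd_iff_isRoot.2 hr
      have hq'0 : q' ≠ 0 := by rintro rfl; simp at hq
      rw [natDegree_mul (X_sub_C_ne_zero r) hq'0, natDegree_X_sub_C] at hq
      rw [map_mul, v.ord_mul (by simpa using hxc r)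
        (fun h => htr ⟨q', hq'0, h⟩), ih q' (by omega)]
      simpa using h0 r
  obtain ⟨τ, hτ⟩ := v.exists_uniformizer
  have hτ0 : τ ≠ 0 := ne_zero_of_ord (v := v) (by omega)
  obtain ⟨q, hq0, hqτ⟩ := halg τ
  clear halg
  induction hd : q.natDegree using Nat.strong_induction_on generalizing q with
  | _ d ih =>
  -- In a relation of `τ` over `ℂ[x]` with nonzero constant term, that term has order `0` but is `τ`
  -- times a regular function. A zero constant term is removed by dividing by `τ`.
  by_cases hc : q.coeff 0 = 0
  · obtain ⟨q', rfl⟩ := X_dvd_iff.2 hc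
    have hq' : q' ≠ 0 := by rintro rfl; simp at hq0
    rw [eval₂_mul, eval₂_X] at hqτ
    refine ih q'.natDegree ?_ q' hq' ((mul_eq_zero.1 hqτ).resolve_left hτ0) rfl
    rw [← hd, natDegree_mul X_ne_zero hq', natDegree_X]
    omega
  · rw [← divX_mul_X_add q, eval₂_add, eval₂_mul, eval₂_X, eval₂_C] at hqτ
    have h1 : v.Int (q.divX.eval₂ (aeval x).toRingHom τ) := by
      rw [eval₂_eq_sum_range]
      exact Int.sum fun i _ => (hx.aeval _).mul (Int.pow (by unfold Int; omega) _)
    have h2 : (aeval x) (q.coeff 0) = -(q.divX.eval₂ (aeval x).toRingHom τ * τ) :=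
      eq_neg_of_add_eq_zero_right hqτ
    have hne : (aeval x) (q.coeff 0) ≠ 0 := fun h => htr ⟨_, hc, h⟩
    have h3 := hq _ (q.coeff 0) rfl
    rw [h2, v.ord_neg, v.ord_mul _ hτ0, hτ] at h3
    · unfold Int at h1; omega
    · intro h
      rw [h, zero_mul, neg_zero] at h2
      exact hne h2

end Place

end
end EpsComplement

namespace EpsComplement
noncomputable section

/-! ### Places and primes of a Dedekind domain -/

open Polynomial IsDedekindDomain

namespace Place

variable {K : Type*} [Field K] [Algebra ℂ K]

section Dedekind

variable {S : Type*} [CommRing S] [IsDedekindDomain S] [Algebra S K] [IsFractionRing S K]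
  [Algebra ℂ S] [IsScalarTower ℂ S K]

/-- The place of `K` defined by a nonzero prime of a Dedekind domain with fraction field `K`. -/
def ofPrime (𝔭 : HeightOneSpectrum S) : Place K where
  ord x := -WithZero.log (𝔭.valuation K x)
  ord_zero := by simp
  ord_mul {x y} hx hy := by
    rw [map_mul, WithZero.log_mul (by simpa using hx) (by simpa using hy)]; ring
  ord_add {x y} h := by
    by_cases hx : x = 0
    · simp [hx]
    by_cases hy : y = 0
    · simp [hy]
    have h1 := (𝔭.valuation K).map_add x y
    rcases le_max_iff.1 h1 with h1 | h1
    · refine (min_le_left _ _).trans (neg_le_neg ?_)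
      exact (WithZero.log_le_log (by simpa using h) (by simpa using hx)).2 h1
    · refine (min_le_right _ _).trans (neg_le_neg ?_)
      exact (WithZero.log_le_log (by simpa using h) (by simpa using hy)).2 h1
  ord_const c := by
    by_cases hc : c = 0
    · simp [hc]
    rw [IsScalarTower.algebraMap_apply ℂ S K, (HeightOneSpectrum.valuation_eq_one_iff_notMem 𝔭).2]
    · simp
    · intro h
      exact 𝔭.isPrime.ne_top (Ideal.eq_top_of_isUnit_mem _ h ((IsUnit.mk0 c hc).map (algebraMap ℂ S)))
  exists_uniformizer := by
    obtain ⟨π, hπ⟩ := 𝔭.valuation_exists_uniformizer K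
    exact ⟨π, by rw [hπ]; simp⟩

lemma int_ofPrime_iff {𝔭 : HeightOneSpectrum S} {x : K} :
    (ofPrime (K := K) 𝔭).Int x ↔ 𝔭.valuation K x ≤ 1 := by
  by_cases hx : x = 0
  · simp [hx, int_zero]
  have : 𝔭.valuation K x ≠ 0 := by simpa using hx
  rw [← WithZero.exp_zero, ← WithZero.log_le_iff_le_exp this]
  simp [Int, ofPrime]

lemma int_ofPrime (𝔭 : HeightOneSpectrum S) (s : S) :
    (ofPrime (K := K) 𝔭).Int (algebraMap S K s) :=
  int_ofPrime_iff.2 (𝔭.valuation_le_one s)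

/-- The elements of positive order form a prime of `S` (with `0` added by hand, as `ord 0 = 0`),
nonzero because a uniformizer is a quotient of elements of `S`. A function regular at this prime has
a denominator of order `0`, so it is regular at `v`, and `ext_of_int` applies. -/
lemma exists_eq_ofPrime (v : Place K) (h : ∀ s : S, v.Int (algebraMap S K s)) :
    ∃ 𝔭 : HeightOneSpectrum S, v = ofPrime 𝔭 ∧
      ∀ s : S, s ∈ 𝔭.asIdeal ↔ s = 0 ∨ 0 < v.ord (algebraMap S K s) := by
  have inj : Function.Injective (algebraMap S K) := IsFractionRing.injective S K
  have hz : ∀ s : S, s = 0 ↔ algebraMap S K s = 0 := fun s => by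
    rw [map_eq_zero_iff _ inj]
  let P : Ideal S :=
    { carrier := {s | s = 0 ∨ 0 < v.ord (algebraMap S K s)}
      zero_mem' := Or.inl rfl
      add_mem' := by
        intro a b ha hb
        simp only [Set.mem_ofPred_eq, hz, map_add] at *
        exact ord_pos_add ha hb
      smul_mem' := by
        intro c a ha
        simp only [Set.mem_ofPred_eq, smul_eq_mul] at *
        by_cases hc : c = 0
        · simp [hc]
        rcases ha with rfl | ha
        · simp
        right
        rw [map_mul, v.ord_mul (by simpa using hc) (ne_zero_of_ord (v := v) ha.ne')]
        have := h c
        unfold Int at this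
        omega }
  have hP : ∀ s : S, s ∈ P ↔ s = 0 ∨ 0 < v.ord (algebraMap S K s) := fun s => Iff.rfl
  have hprime : P.IsPrime := by
    refine ⟨fun htop => ?_, fun {a b} hab => ?_⟩
    · have := (hP 1).1 (htop ▸ Submodule.mem_top)
      rw [map_one, v.ord_one] at this
      simp at this
    · rw [hP, hP] at *
      by_cases ha : a = 0
      · exact Or.inl (Or.inl ha)
      by_cases hb : b = 0
      · exact Or.inr (Or.inl hb)
      rcases hab with hab | hab
      · exact absurd hab (mul_ne_zero ha hb)
      rw [map_mul, v.ord_mul (by simpa using ha) (by simpa using hb)] at hab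
      by_contra! hcon
      omega
  have hbot : P ≠ ⊥ := by
    intro hbot
    have h0 : ∀ s : S, v.ord (algebraMap S K s) = 0 := fun s => by
      by_cases hs : s = 0
      · simp [hs, v.ord_zero]
      have h1 : s ∉ P := by rwa [hbot, Ideal.mem_bot]
      rw [hP] at h1
      push Not at h1
      exact le_antisymm h1.2 (h s)
    obtain ⟨τ, hτ⟩ := v.exists_uniformizer
    obtain ⟨a, b, hb, rfl⟩ := IsFractionRing.div_surjective (A := S) τ
    have hne : algebraMap S K a / algebraMap S K b ≠ 0 := ne_zero_of_ord (v := v) (by omega)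
    rw [v.ord_div (by rintro h; simp [h] at hne) (by rintro h; simp [h] at hne), h0, h0] at hτ
    omega
  refine ⟨⟨P, hprime, hbot⟩, Eq.symm (ext_of_int fun x hx => ?_), fun s => hP s⟩
  obtain ⟨n, d, hnd⟩ := HeightOneSpectrum.exists_primeCompl_mul_eq_of_integer _ x
    (int_ofPrime_iff.1 hx)
  have hd : (d : S) ∉ P := d.2
  rw [hP] at hd
  push Not at hd
  have hd0 : algebraMap S K d ≠ 0 := by simpa using hd.1
  have hdv : v.ord (algebraMap S K d) = 0 := le_antisymm hd.2 (h d)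
  by_cases hx0 : x = 0
  · simpa [hx0] using v.int_zero
  have := h n
  rw [← hnd] at this
  unfold Int at this ⊢
  rwa [v.ord_mul hx0 hd0, hdv, add_zero] at this

end Dedekind

end Place

end
end EpsComplement

namespace EpsComplement
noncomputable section

/-! ### Places and the integral closure of a polynomial ring -/

open Polynomial IsDedekindDomain

namespace Place

variable {K : Type*} [Field K] [Algebra ℂ K]

/-- The valuation ring of a place. -/
def valuationSubring (v : Place K) : ValuationSubring K :=
  .ofSubring v.ring.toSubring fun x => by
    change 0 ≤ v.ord x ∨ 0 ≤ v.ord x⁻¹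
    rw [ord_inv]
    omega

lemma mem_valuationSubring {v : Place K} {x : K} : x ∈ v.valuationSubring ↔ v.Int x := Iff.rfl

lemma Int.of_isIntegral {v : Place K} {R : Type*} [CommRing R] [Algebra R K]
    (h : ∀ r : R, v.Int (algebraMap R K r)) {x : K} (hx : IsIntegral R x) : v.Int x := by
  let f : R →+* v.valuationSubring := (algebraMap R K).codRestrict v.valuationSubring h
  letI := f.toAlgebra
  haveI : IsScalarTower R v.valuationSubring K := .of_algebraMap_eq fun _ => rfl
  obtain ⟨y, hy⟩ := IsIntegrallyClosed.isIntegral_iff.1 (hx.tower_top (A := v.valuationSubring))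
  rw [← hy]
  exact y.2

lemma aeval_eq_const_add {x : K} (q : ℂ[X]) :
    aeval x q = algebraMap ℂ K (q.coeff 0) + x * aeval x q.divX := by
  conv_lhs => rw [← divX_mul_X_add q]
  simp only [map_add, map_mul, aeval_X, aeval_C]
  ring

lemma ord_aeval {v : Place K} {x : K} (hx : 0 < v.ord x) {q : ℂ[X]} (hq : q.coeff 0 ≠ 0) :
    v.ord (aeval x q) = 0 := by
  rw [aeval_eq_const_add, ord_add_eq_left (by simpa using hq), v.ord_const]
  by_cases h : x * aeval x q.divX = 0
  · exact Or.inl h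
  right
  have h1 : v.Int (aeval x q.divX) := Int.aeval hx.le _
  rw [mul_eq_zero, not_or] at h
  unfold Int at h1
  rw [v.ord_const, v.ord_mul h.1 h.2]
  omega

/-- The elements that are regular wherever `t` is. -/
def IntAway (t x : K) : Prop := ∀ v : Place K, v.Int t → v.Int x

section Closure

variable [Algebra ℂ[X] K] [IsScalarTower ℂ ℂ[X] K]

lemma aeval_eq_algebraMap (q : ℂ[X]) : aeval (algebraMap ℂ[X] K X) q = algebraMap ℂ[X] K q := by
  rw [aeval_algebraMap_apply, aeval_X_left_apply]

local notation "t" => algebraMap ℂ[X] K X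

variable {S : Type*} [CommRing S] [IsDedekindDomain S] [Algebra S K] [IsFractionRing S K]
  [Algebra ℂ S] [IsScalarTower ℂ S K] [Algebra ℂ[X] S] [IsScalarTower ℂ[X] S K]
  [IsScalarTower ℂ ℂ[X] S] [IsIntegralClosure S ℂ[X] K]

variable (S) in
lemma int_algebraMap {v : Place K} (h : v.Int t) (s : S) : v.Int (algebraMap S K s) := by
  refine Int.of_isIntegral (R := ℂ[X]) (fun q => ?_)
    (IsIntegralClosure.isIntegral_iff (A := S).2 ⟨s, rfl⟩)
  rw [← aeval_eq_algebraMap]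
  exact h.aeval q

lemma int_ofPrime_X (𝔭 : HeightOneSpectrum S) : (ofPrime (K := K) 𝔭).Int t := by
  rw [IsScalarTower.algebraMap_apply ℂ[X] S K]
  exact int_ofPrime 𝔭 _

-- A Dedekind domain is the intersection of its localizations at the nonzero primes, and each such
-- prime of the integral closure `S` of `ℂ[t]` is a place where `t` is regular.
variable (S) in
lemma intAway_iff (x : K) : IntAway t x ↔ x ∈ (algebraMap S K).range := by
  constructor
  · intro h
    exact HeightOneSpectrum.mem_integers_of_valuation_le_one K x fun 𝔭 =>
      int_ofPrime_iff.1 (h _ (int_ofPrime_X 𝔭))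
  · rintro ⟨s, rfl⟩ v hv
    exact int_algebraMap S hv s

lemma ord_ofPrime_pos_iff (𝔭 : HeightOneSpectrum S) (s : S) :
    s ∈ 𝔭.asIdeal ↔ s = 0 ∨ 0 < (ofPrime (K := K) 𝔭).ord (algebraMap S K s) := by
  by_cases hs : s = 0
  · simp [hs]
  rw [← 𝔭.valuation_lt_one_iff_mem (K := K), ← WithZero.exp_zero, ← WithZero.log_lt_iff_lt_exp
    (by simpa using hs)]
  simp [hs, ofPrime]

lemma le_ord_ofPrime_iff (𝔭 : HeightOneSpectrum S) {s : S} (hs : s ≠ 0) (n : ℕ) :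
    s ∈ 𝔭.asIdeal ^ n ↔ n ≤ (ofPrime (K := K) 𝔭).ord (algebraMap S K s) := by
  rw [← 𝔭.intValuation_le_pow_iff_mem, ← 𝔭.valuation_of_algebraMap (K := K),
    ← WithZero.log_le_iff_le_exp (by simpa using hs)]
  exact le_neg.symm

variable (K S) in
lemma exists_prime_X_mem (hinj : Function.Injective (algebraMap ℂ[X] K)) :
    ∃ 𝔭 : HeightOneSpectrum S, algebraMap ℂ[X] S X ∈ 𝔭.asIdeal ∧
      0 < (ofPrime (K := K) 𝔭).ord t := by
  haveI : Algebra.IsIntegral ℂ[X] S := IsIntegralClosure.isIntegral_algebra ℂ[X] K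
  have hinjS : Function.Injective (algebraMap ℂ[X] S) := by
    rw [IsScalarTower.algebraMap_eq ℂ[X] S K] at hinj
    exact Function.Injective.of_comp hinj
  haveI : (Ideal.span {(X : ℂ[X])}).IsPrime := (Ideal.span_singleton_prime X_ne_zero).2 prime_X
  obtain ⟨Q, -, hQ, hQX⟩ := Ideal.exists_ideal_over_prime_of_isIntegral
    (Ideal.span {(X : ℂ[X])}) (⊥ : Ideal S) (by
      rw [← RingHom.ker_eq_comap_bot, (RingHom.injective_iff_ker_eq_bot _).1 hinjS]
      exact bot_le)
  have hX : algebraMap ℂ[X] S X ∈ Q := by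
    rw [← Ideal.mem_comap, hQX]; exact Ideal.mem_span_singleton_self X
  have hX0 : algebraMap ℂ[X] S X ≠ 0 := (map_ne_zero_iff _ hinjS).2 X_ne_zero
  refine ⟨⟨Q, hQ, fun h => hX0 (by simpa [h] using hX)⟩, hX, ?_⟩
  rw [IsScalarTower.algebraMap_apply ℂ[X] S K]
  exact ((ord_ofPrime_pos_iff _ _).1 hX).resolve_left hX0

variable (K S) in
lemma finite_primes_X_mem (hinj : Function.Injective (algebraMap ℂ[X] K)) :
    {𝔭 : HeightOneSpectrum S | algebraMap ℂ[X] S X ∈ 𝔭.asIdeal}.Finite := by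
  have hX0 : algebraMap ℂ[X] S X ≠ 0 := by
    intro h
    have : t = 0 := by rw [IsScalarTower.algebraMap_apply ℂ[X] S K, h, map_zero]
    exact X_ne_zero ((map_eq_zero_iff _ hinj).1 this)
  refine (Ideal.finite_factors (I := Ideal.span {algebraMap ℂ[X] S X}) (by simpa using hX0)).subset
    fun 𝔭 h𝔭 => ?_
  rwa [Set.mem_ofPred_eq, Ideal.dvd_span_singleton]

variable (S) in
lemma exists_eq_ofPrime_of_pos {v : Place K} (hv : 0 < v.ord t) :
    ∃ 𝔭 : HeightOneSpectrum S, v = ofPrime 𝔭 ∧ algebraMap ℂ[X] S X ∈ 𝔭.asIdeal := by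
  obtain ⟨𝔭, rfl, h⟩ := exists_eq_ofPrime v (int_algebraMap S (le_of_lt hv))
  refine ⟨𝔭, rfl, ?_⟩
  rw [h]
  right
  rwa [← IsScalarTower.algebraMap_apply ℂ[X] S K]

variable (S) in
lemma setOf_ord_pos_subset :
    {v : Place K | 0 < v.ord t} ⊆
      ofPrime '' {𝔭 : HeightOneSpectrum S | algebraMap ℂ[X] S X ∈ 𝔭.asIdeal} := fun v hv => by
  obtain ⟨𝔭, rfl, h⟩ := exists_eq_ofPrime_of_pos S hv
  exact ⟨𝔭, h, rfl⟩

-- Chinese remainder theorem for the primes of `S` at the zeros of `t`. The exponents `N * v.ord t`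
-- turn the congruences into divisibility by `t ^ N`.
variable (S) in
lemma exists_approx_aux (hinj : Function.Injective (algebraMap ℂ[X] K)) {v₀ : Place K}
    (hv₀ : 0 < v₀.ord t) (N : ℕ) :
    ∃ s : S, v₀.Int ((algebraMap S K s - 1) / t ^ N) ∧
      ∀ v : Place K, v ≠ v₀ → 0 < v.ord t → v.Int (algebraMap S K s / t ^ N) := by
  classical
  have ht0 : t ≠ 0 := (map_ne_zero_iff _ hinj).2 X_ne_zero
  let T := (((finite_primes_X_mem K S hinj).image _).subset (setOf_ord_pos_subset (K := K) S)).toFinset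
  have hT : ∀ v, v ∈ T ↔ 0 < v.ord t := fun v => by simp [T]
  haveI : Nonempty (HeightOneSpectrum S) := ⟨(exists_eq_ofPrime_of_pos S hv₀).choose⟩
  choose! 𝔭 h𝔭 h𝔭' using fun (v : Place K) (hv : 0 < v.ord t) =>
    exists_eq_ofPrime v (int_algebraMap S (le_of_lt hv))
  obtain ⟨y, hy⟩ := IsDedekindDomain.exists_forall_sub_mem_ideal (R := S) (s := T)
    (fun v => (𝔭 v).asIdeal) (fun v => (N * v.ord t).toNat)
    (fun v _ => Ideal.prime_of_isPrime (𝔭 v).ne_bot (𝔭 v).isPrime)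
    (fun v hv w hw hne heq => hne (by
      rw [h𝔭 v ((hT v).1 hv), h𝔭 w ((hT w).1 hw), HeightOneSpectrum.ext heq]))
    (fun v => if v.1 = v₀ then 1 else 0)
  have key : ∀ v : Place K, 0 < v.ord t → ∀ s : S, s ∈ (𝔭 v).asIdeal ^ (N * v.ord t).toNat →
      v.Int (algebraMap S K s / t ^ N) := by
    intro v hv s hs
    by_cases hs0 : s = 0
    · simpa [hs0] using v.int_zero
    rw [le_ord_ofPrime_iff (K := K) _ hs0, ← h𝔭 v hv] at hs
    rw [int_div_iff (by simpa using hs0) (pow_ne_zero _ ht0), ord_pow]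
    exact (Int.self_le_toNat _).trans hs
  refine ⟨y, ?_, fun v hne hv => ?_⟩
  · have := key v₀ hv₀ _ (hy v₀ ((hT _).2 hv₀))
    simpa using this
  · have := key v hv _ (hy v ((hT _).2 hv))
    simpa [hne] using this

variable [Module.Finite ℂ[X] S] [Module.Free ℂ[X] S]

/-- An element which is idempotent and nonzero at `t = 0` has trace nonzero at `t = 0`. -/
lemma trace_coeff_zero_ne_zero {s r : S} (h : s * s - s = algebraMap ℂ[X] S X * r)
    (hs : ¬ algebraMap ℂ[X] S X ∣ s) : (Algebra.trace ℂ[X] S s).coeff 0 ≠ 0 := by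
  classical
  intro h0
  let b := Module.Free.chooseBasis ℂ[X] S
  -- Modulo `X`, multiplication by `s` is an idempotent complex matrix, whose trace is its rank. If
  -- the trace is `0`, so is the matrix, and all coordinates of `s` are divisible by `X`.
  let M : S → Matrix _ _ ℂ := fun s => (Algebra.leftMulMatrix b s).map (constantCoeff (R := ℂ))
  have hM : ∀ a c : S, M (a * c) = M a * M c := fun a c => by
    simp only [M, map_mul, Matrix.map_mul]
  have hMX : ∀ a, M (algebraMap ℂ[X] S X * a) = 0 := fun a => by
    ext i j
    simp [M, ← Algebra.smul_def]
  have hMs : ∀ a c : S, M (a - c) = M a - M c := fun a c => by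
    simp only [M, map_sub]
    ext i j
    simp
  have hid : IsIdempotentElem (Matrix.toLin' (M s)) := by
    have : M s * M s = M s := by
      rw [← sub_eq_zero, ← hM, ← hMs, h, hMX]
    rw [IsIdempotentElem, Module.End.mul_eq_comp, ← Matrix.toLin'_mul, this]
  have htr : LinearMap.trace ℂ _ (Matrix.toLin' (M s)) = 0 := by
    rw [Matrix.trace_toLin'_eq]
    rw [Algebra.trace_eq_matrix_trace b, ← constantCoeff_apply] at h0
    simpa [Matrix.trace, M] using h0
  have hMs0 : M s = 0 := by
    have := (LinearMap.IsIdempotentElem.trace_eq_zero_iff hid).1 htr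
    simpa using this
  have hd : ∀ i, X ∣ b.repr (s * 1) i := by
    intro i
    have h1 : b.repr (s * 1) i = ∑ j, Algebra.leftMulMatrix b s i j * b.repr 1 j := by
      rw [← Algebra.leftMulMatrix_mulVec_repr]
      rfl
    rw [h1]
    refine Finset.dvd_sum fun j _ => Dvd.dvd.mul_right ?_ _
    rw [X_dvd_iff]
    have := congrFun (congrFun hMs0 i) j
    simpa [M] using this
  choose c hc using hd
  apply hs
  refine ⟨∑ i, c i • b i, ?_⟩
  rw [← mul_one s, ← b.sum_repr (s * 1), ← Algebra.smul_def, Finset.smul_sum]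
  exact Finset.sum_congr rfl fun i _ => by rw [hc i, mul_smul]

end Closure

end Place

end
end EpsComplement

/-! ### Residue fields and the degree of the zeros of a function. -/

namespace EpsComplement
noncomputable section

open Polynomial IsDedekindDomain

/-- Function fields of curves over `ℂ`. -/
class IsCurveField (K : Type*) [Field K] [Algebra ℂ K] : Prop where
  essFiniteType : Algebra.EssFiniteType ℂ K
  trdeg : Algebra.trdeg ℂ K = 1

section

variable {K : Type*} [Field K] [Algebra ℂ K]

open scoped IntermediateField IntermediateField.algebraAdjoinAdjoin

lemma isTranscendenceBasis_of_transcendental [IsCurveField K] {t : K} (ht : Transcendental ℂ t) :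
    IsTranscendenceBasis ℂ (fun _ : Unit => t) :=
  (algebraicIndependent_unique_type_iff.2 ht).isTranscendenceBasis_of_lift_trdeg_le_of_finite
    (by simp [IsCurveField.trdeg (K := K)])

lemma isAlgebraic_adjoin [IsCurveField K] {t : K} (ht : Transcendental ℂ t) :
    Algebra.IsAlgebraic (Algebra.adjoin ℂ {t}) K := by
  have h := (isTranscendenceBasis_of_transcendental ht).isAlgebraic
  rwa [Set.range_const] at h

lemma finiteDimensional_adjoin [IsCurveField K] {t : K} (ht : Transcendental ℂ t) :
    FiniteDimensional ℂ⟮t⟯ K := by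
  haveI := IsCurveField.essFiniteType (K := K)
  haveI : Algebra.IsAlgebraic ℂ⟮t⟯ K := by
    have h := (isTranscendenceBasis_of_transcendental ht).isAlgebraic_field
    rwa [Set.range_const] at h
  haveI : Algebra.EssFiniteType ℂ⟮t⟯ K := Algebra.EssFiniteType.of_comp ℂ ℂ⟮t⟯ K
  exact Algebra.finite_of_essFiniteType_of_isAlgebraic

lemma exists_eq_const_of_isAlgebraic {x : K} (hx : IsAlgebraic ℂ x) :
    ∃ c, x = algebraMap ℂ K c := by
  have h := hx.isIntegral
  have h2 := IsAlgClosed.degree_eq_one_of_irreducible ℂ (minpoly.irreducible h)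
  obtain ⟨c, hc⟩ := (minpoly.mem_range_of_degree_eq_one ℂ x h2)
  exact ⟨c, hc.symm⟩

/-- The residue field of a place is `ℂ`. -/
lemma Place.exists_residue [IsCurveField K] (v : Place K) {x : K} (hx : v.Int x) :
    ∃ c : ℂ, x - algebraMap ℂ K c = 0 ∨ 0 < v.ord (x - algebraMap ℂ K c) := by
  by_cases hal : IsAlgebraic ℂ x
  · obtain ⟨c, hc⟩ := exists_eq_const_of_isAlgebraic hal
    exact ⟨c, Or.inl (sub_eq_zero.2 hc)⟩
  have halg := isAlgebraic_adjoin hal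
  obtain ⟨c, hc⟩ := Place.exists_ord_sub_pos hx (fun y => by
    obtain ⟨q, hq, hqy⟩ := halg.isAlgebraic y
    have hsurj : Function.Surjective ((aeval (R := ℂ) x).codRestrict (Algebra.adjoin ℂ {x})
        (fun p => aeval_mem_adjoin_singleton (R := ℂ) x)) := by
      rintro ⟨z, hz⟩
      rw [Algebra.adjoin_singleton_eq_range_aeval] at hz
      obtain ⟨p, hp⟩ := hz
      exact ⟨p, Subtype.ext hp⟩
    obtain ⟨q', rfl⟩ := Polynomial.map_surjective _ hsurj q
    refine ⟨q', by rintro rfl; simp at hq, ?_⟩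
    have : (algebraMap (Algebra.adjoin ℂ {x}) K).comp ((aeval (R := ℂ) x).codRestrict
        (Algebra.adjoin ℂ {x}) (fun p => aeval_mem_adjoin_singleton (R := ℂ) x)).toRingHom
        = (aeval x).toRingHom := rfl
    rw [← this, ← eval₂_map]
    exact hqy) hal
  exact ⟨c, Or.inr hc⟩

end

namespace Place

variable {K : Type*} [Field K] [Algebra ℂ K] [Algebra ℂ[X] K] [IsScalarTower ℂ ℂ[X] K]

local notation "t" => algebraMap ℂ[X] K X

variable {S : Type*} [CommRing S] [IsDedekindDomain S] [Algebra S K] [IsFractionRing S K]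
  [Algebra ℂ S] [IsScalarTower ℂ S K] [Algebra ℂ[X] S] [IsScalarTower ℂ[X] S K]
  [IsScalarTower ℂ ℂ[X] S] [IsIntegralClosure S ℂ[X] K]

lemma ofPrime_injective : Function.Injective (ofPrime (K := K) (S := S)) := by
  intro 𝔭 𝔮 h
  ext s
  rw [ord_ofPrime_pos_iff (K := K), h, ← ord_ofPrime_pos_iff]

variable [Module.Finite ℂ[X] S] [Module.Free ℂ[X] S]

-- The fundamental identity `∑ e f = n` at the prime `(X)`. The inertia degrees are `1` because the
-- residue fields are `ℂ` (`exists_residue`), and the ramification indices are the orders of `t`.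
variable (S) in
lemma sum_ord_aux [IsCurveField K] (hinj : Function.Injective (algebraMap ℂ[X] K))
    (T : Finset (Place K)) (hT : ∀ v, v ∈ T ↔ 0 < v.ord t) :
    ∑ v ∈ T, v.ord t = Module.finrank ℂ[X] S := by
  classical
  let p : Ideal ℂ[X] := Ideal.span {X}
  haveI hp : p.IsMaximal := PrincipalIdealRing.isMaximal_of_irreducible irreducible_X
  have hinjS : Function.Injective (algebraMap ℂ[X] S) := by
    rw [IsScalarTower.algebraMap_eq ℂ[X] S K] at hinj
    exact Function.Injective.of_comp hinj
  have hX0 : algebraMap ℂ[X] S X ≠ 0 := (map_ne_zero_iff _ hinjS).2 X_ne_zero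
  have hmap : p.map (algebraMap ℂ[X] S) = Ideal.span {algebraMap ℂ[X] S X} := by
    rw [Ideal.map_span, Set.image_singleton]
  have hmap0 : p.map (algebraMap ℂ[X] S) ≠ ⊥ := by simp [hmap]
  have hmem : ∀ q ∈ p.primesOver S, algebraMap ℂ[X] S X ∈ q := by
    rintro q ⟨-, hq⟩
    rw [← Ideal.mem_comap, ← Ideal.under_def, ← hq.over]
    exact Ideal.mem_span_singleton_self X
  have hbot : ∀ q ∈ p.primesOver S, q ≠ ⊥ := by
    rintro q hq rfl
    exact hX0 (hmem _ hq)
  let φ : p.primesOver S → HeightOneSpectrum S := fun q => ⟨q.1, q.2.1, hbot _ q.2⟩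
  have hφ : Function.Injective φ := fun q q' h => Subtype.ext (congrArg HeightOneSpectrum.asIdeal h)
  have hover : ∀ 𝔭 : HeightOneSpectrum S, algebraMap ℂ[X] S X ∈ 𝔭.asIdeal →
      𝔭.asIdeal ∈ p.primesOver S := fun 𝔭 h𝔭 => ⟨𝔭.isPrime, ⟨hp.eq_of_le
        (Ideal.comap_ne_top _ 𝔭.isPrime.ne_top)
        ((Ideal.span_singleton_le_iff_mem _).2 h𝔭)⟩⟩
  have hfin := finite_primes_X_mem K S hinj
  haveI : Finite (p.primesOver S) := by
    have : (p.primesOver S) ⊆ HeightOneSpectrum.asIdeal ''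
        {𝔭 : HeightOneSpectrum S | algebraMap ℂ[X] S X ∈ 𝔭.asIdeal} := fun q hq =>
      ⟨φ ⟨q, hq⟩, hmem q hq, rfl⟩
    exact (hfin.image _).subset this
  letI := Fintype.ofFinite (p.primesOver S)
  rw [← Ideal.sum_ramification_inertia_eq_finrank p S]
  push_cast
  symm
  refine Finset.sum_bij (fun q _ => ofPrime (K := K) (φ q)) ?_ ?_ ?_ ?_
  · intro q _
    rw [hT, IsScalarTower.algebraMap_apply ℂ[X] S K]
    exact ((ord_ofPrime_pos_iff (K := K) (φ q) _).1 (hmem _ q.2)).resolve_left hX0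
  · intro q _ q' _ h
    exact hφ (ofPrime_injective h)
  · intro v hv
    obtain ⟨𝔭, rfl, h⟩ := exists_eq_ofPrime_of_pos S ((hT v).1 hv)
    exact ⟨⟨𝔭.asIdeal, hover 𝔭 h⟩, Finset.mem_univ _, rfl⟩
  · intro q _
    haveI := q.2.1
    haveI := q.2.2
    haveI : q.1.IsMaximal := q.2.1.isMaximal (hbot _ q.2)
    have hin : q.1.inertiaDeg ℂ[X] = 1 := by
      rw [Ideal.inertiaDeg_eq_of_isMaximal p q.1]
      letI := Ideal.Quotient.field p
      have hb : Function.Bijective (algebraMap (ℂ[X] ⧸ p) (S ⧸ q.1)) := by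
        refine ⟨(algebraMap (ℂ[X] ⧸ p) (S ⧸ q.1)).injective, fun s => ?_⟩
        obtain ⟨s, rfl⟩ := Ideal.Quotient.mk_surjective s
        obtain ⟨c, hc⟩ := (ofPrime (K := K) (φ q)).exists_residue (int_ofPrime (φ q) s)
        refine ⟨Ideal.Quotient.mk _ (C c), ?_⟩
        rw [Ideal.Quotient.algebraMap_mk_of_liesOver, eq_comm, Ideal.Quotient.eq]
        have h1 : algebraMap ℂ[X] S (C c) = algebraMap ℂ S c :=
          (IsScalarTower.algebraMap_apply ℂ ℂ[X] S c).symm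
        rw [h1]
        refine (ord_ofPrime_pos_iff (K := K) (φ q) _).2 ?_
        rw [map_sub, ← IsScalarTower.algebraMap_apply ℂ S K]
        refine hc.imp (fun h => ?_) id
        rw [IsScalarTower.algebraMap_apply ℂ S K, ← map_sub] at h
        exact (map_eq_zero_iff _ (IsFractionRing.injective S K)).1 h
      rw [← (LinearEquiv.ofBijective (Algebra.linearMap (ℂ[X] ⧸ p) (S ⧸ q.1)) hb).finrank_eq,
        Module.finrank_self]
    rw [hin, Nat.cast_one, mul_one, Ideal.IsDedekindDomain.ramificationIdx_eq_multiplicity p q.1 hmap0, hmap,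
      IsScalarTower.algebraMap_apply ℂ[X] S K]
    simp only [ofPrime, HeightOneSpectrum.valuation_of_algebraMap,
      HeightOneSpectrum.intValuation_eq_exp_neg_multiplicity _ hX0, WithZero.log_exp, neg_neg]
    rfl

end Place

end
end EpsComplement

/-! ### The covering of the line given by a nonconstant function. -/

namespace EpsComplement
noncomputable section

open Polynomial IsDedekindDomain
open scoped IntermediateField

/-- The geometry of the covering of the line defined by a nonconstant function `t`, where
`F = ℂ(t)`. -/
structure IsCovering {K : Type*} [Field K] [Algebra ℂ K] (t : K) (F : IntermediateField ℂ K) :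
    Prop where
  exists_zero : ∃ v : Place K, 0 < v.ord t
  finite_zeros : {v : Place K | 0 < v.ord t}.Finite
  sum_zeros : ∀ T : Finset (Place K), (∀ v, v ∈ T ↔ 0 < v.ord t) →
    ∑ v ∈ T, v.ord t = Module.finrank F K
  -- The nonvanishing of the trace at `t = 0` lets `y` detect poles at `v₀` of functions known only
  -- through traces.
  approx : ∀ v₀ : Place K, 0 < v₀.ord t → ∀ N : ℕ, 0 < N → ∃ y : K, Place.IntAway t y ∧
    v₀.Int ((y - 1) / t ^ N) ∧
    (∀ v : Place K, v ≠ v₀ → 0 < v.ord t → v.Int (y / t ^ N)) ∧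
    ∃ q : ℂ[X], q.coeff 0 ≠ 0 ∧ (Algebra.trace F K y : K) = aeval t q
  exists_denom : ∀ x : K, ∃ q : ℂ[X], q ≠ 0 ∧ Place.IntAway t (aeval t q * x)
  exists_basis : ∃ e : Fin (Module.finrank F K) → K, LinearIndependent F e ∧
    ∀ x, Place.IntAway t x ↔ ∃ f : Fin (Module.finrank F K) → ℂ[X], x = ∑ i, aeval t (f i) * e i

variable {K : Type*} [Field K] [Algebra ℂ K]

lemma Place.ord_eq_zero_of_int {v : Place K} {t y : K} {N : ℕ} (ht : 0 < v.ord t) (hN : 0 < N)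
    (h : v.Int ((y - 1) / t ^ N)) : v.ord y = 0 := by
  have h1 : y = 1 + (y - 1) := by ring
  rw [h1, Place.ord_add_eq_left one_ne_zero, v.ord_one]
  by_cases hy : y - 1 = 0
  · exact Or.inl hy
  right
  rw [Place.int_div_iff hy (pow_ne_zero _ (Place.ne_zero_of_ord ht.ne')), Place.ord_pow] at h
  rw [v.ord_one]
  exact (by positivity : 0 < (N : ℤ) * v.ord t).trans_le h

/-- Everything is read off the integral closure `S` of `ℂ[t]` in `K`, a Dedekind domain that is free
over `ℂ[t]` of rank `[K : ℂ(t)]`. `F` is kept apart from `ℂ⟮t⟯` so that `t`, `t⁻¹` and `t - c` can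
share one field, one degree and one trace. -/
theorem isCovering [IsCurveField K] {t : K} (ht : Transcendental ℂ t) {F : IntermediateField ℂ K}
    (hF : F = ℂ⟮t⟯) : IsCovering t F := by
  subst hF
  haveI := finiteDimensional_adjoin ht
  letI iK : Algebra ℂ[X] K := (aeval t).toAlgebra
  haveI : IsScalarTower ℂ ℂ[X] K := .of_algebraMap_eq fun c => by
    rw [RingHom.algebraMap_toAlgebra]; simp
  letI iF : Algebra ℂ[X] ℂ⟮t⟯ := (aeval (IntermediateField.AdjoinSimple.gen ℂ t)).toAlgebra
  have hX : algebraMap ℂ[X] K X = t := by rw [RingHom.algebraMap_toAlgebra]; simp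
  haveI : IsScalarTower ℂ[X] ℂ⟮t⟯ K := .of_algebraMap_eq fun q => by
    rw [RingHom.algebraMap_toAlgebra, RingHom.algebraMap_toAlgebra]
    change aeval t q = (algebraMap ℂ⟮t⟯ K) (aeval _ q)
    rw [← aeval_algebraMap_apply, IntermediateField.AdjoinSimple.algebraMap_gen]
  have hinj : Function.Injective (algebraMap ℂ[X] K) := transcendental_iff_injective.1 ht
  have hinjF : Function.Injective (algebraMap ℂ[X] ℂ⟮t⟯) := by
    rw [IsScalarTower.algebraMap_eq ℂ[X] ℂ⟮t⟯ K, RingHom.coe_comp] at hinj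
    exact hinj.of_comp
  haveI : FaithfulSMul ℂ[X] ℂ⟮t⟯ := (faithfulSMul_iff_algebraMap_injective _ _).2 hinjF
  haveI : FaithfulSMul ℂ[X] K := (faithfulSMul_iff_algebraMap_injective _ _).2 hinj
  haveI : IsFractionRing ℂ[X] ℂ⟮t⟯ := .of_field _ _ fun x => by
    obtain ⟨r, s, hrs⟩ := (IntermediateField.mem_adjoin_simple_iff ℂ (x : K)).1 x.2
    refine ⟨r, s, Subtype.ext ?_⟩
    rw [hrs]
    simp [RingHom.algebraMap_toAlgebra]
  haveI : CharZero ℂ⟮t⟯ := charZero_of_injective_algebraMap (algebraMap ℂ ℂ⟮t⟯).injective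
  let S := integralClosure ℂ[X] K
  haveI : IsDedekindDomain S := integralClosure.isDedekindDomain ℂ[X] ℂ⟮t⟯ K
  haveI : IsFractionRing S K := integralClosure.isFractionRing_of_finite_extension ℂ⟮t⟯ K
  haveI : Module.Finite ℂ[X] S := IsIntegralClosure.finite ℂ[X] ℂ⟮t⟯ K S
  haveI : Module.Free ℂ[X] S := IsIntegralClosure.module_free ℂ[X] ℂ⟮t⟯ K S
  have hrank : Module.finrank ℂ[X] S = Module.finrank ℂ⟮t⟯ K :=
    IsIntegralClosure.rank ℂ[X] ℂ⟮t⟯ K S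
  haveI := IsIntegralClosure.isLocalization ℂ[X] ℂ⟮t⟯ K S
  have haev : ∀ q : ℂ[X], aeval t q = algebraMap ℂ[X] K q := fun q => rfl
  have hfin : {v : Place K | 0 < v.ord t}.Finite := by
    have := ((Place.finite_primes_X_mem K S hinj).image _).subset
      (Place.setOf_ord_pos_subset (K := K) S)
    rwa [hX] at this
  refine ⟨?_, hfin, ?_, ?_, ?_, ?_⟩
  · obtain ⟨𝔭, -, h⟩ := Place.exists_prime_X_mem K S hinj
    exact ⟨_, hX ▸ h⟩
  · intro T hT
    rw [← hrank, ← Place.sum_ord_aux S hinj T (by rwa [hX]), hX]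
  · intro v₀ hv₀ N hN
    obtain ⟨s, h1, h2⟩ := Place.exists_approx_aux S hinj (hX.symm ▸ hv₀) N
    rw [hX] at h1 h2
    have ht0 : t ≠ 0 := Place.ne_zero_of_ord hv₀.ne'
    have hs0 := Place.ord_eq_zero_of_int hv₀ hN h1
    refine ⟨algebraMap S K s, ?_, h1, h2, Algebra.trace ℂ[X] S s, ?_, ?_⟩
    · rw [← hX]; exact (Place.intAway_iff S _).2 ⟨s, rfl⟩
    -- `s` is idempotent modulo `t`: at each zero of `t`, either `s` or `s - 1` is divisible by `t`.
    · obtain ⟨r, hr⟩ := (Place.intAway_iff (K := K) S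
        ((algebraMap S K s) * (algebraMap S K s - 1) / t)).1 (by
        rw [hX]
        intro v hv
        have hsi : v.Int (algebraMap S K s) := Place.int_algebraMap S (by rwa [hX]) s
        have hsi' := hsi.sub v.int_one
        by_cases hvt : 0 < v.ord t
        · have hN' : t ^ (N - 1) * t = t ^ N := by rw [← pow_succ]; congr 1; omega
          have hti : v.Int (t ^ (N - 1)) := hv.pow _
          by_cases hvv : v = v₀
          · subst hvv
            have : algebraMap S K s * (algebraMap S K s - 1) / t =
              algebraMap S K s * t ^ (N - 1) * ((algebraMap S K s - 1) / t ^ N) := by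
              rw [← hN']; field_simp
            rw [this]
            exact (hsi.mul hti).mul h1
          · have : algebraMap S K s * (algebraMap S K s - 1) / t =
              (algebraMap S K s / t ^ N) * t ^ (N - 1) * (algebraMap S K s - 1) := by
              rw [← hN']; field_simp
            rw [this]
            exact ((h2 v hvv hvt).mul hti).mul hsi'
        · rw [div_eq_mul_inv]
          refine (hsi.mul hsi').mul ?_
          unfold Place.Int at hv ⊢
          rw [v.ord_inv]
          omega)
      refine Place.trace_coeff_zero_ne_zero (s := s) (r := r) ?_ ?_
      · apply IsFractionRing.injective S K
        rw [map_mul, hr, ← IsScalarTower.algebraMap_apply ℂ[X] S K, hX, map_sub, map_mul]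
        field_simp
      · rintro ⟨c, hc⟩
        have h3 : algebraMap S K s = t * algebraMap S K c := by
          rw [hc, map_mul, ← IsScalarTower.algebraMap_apply ℂ[X] S K, hX]
        by_cases hc0 : algebraMap S K c = 0
        · rw [h3, hc0, mul_zero, zero_sub, neg_div] at h1
          have h4 := h1.neg
          rw [neg_neg, Place.int_div_iff one_ne_zero (pow_ne_zero _ ht0), Place.ord_pow,
            v₀.ord_one] at h4
          nlinarith [(by exact_mod_cast hN : (0 : ℤ) < N)]
        · rw [h3, v₀.ord_mul ht0 hc0] at hs0
          have : v₀.Int (algebraMap S K c) := Place.int_algebraMap S (by rw [hX]; exact hv₀.le) c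
          unfold Place.Int at this
          omega
    · rw [Algebra.trace_localization ℂ[X] (nonZeroDivisors ℂ[X]) s]
      rw [haev, IsScalarTower.algebraMap_apply ℂ[X] ℂ⟮t⟯ K]
      rfl
  · intro x
    obtain ⟨⟨s, ⟨_, q, hq, rfl⟩⟩, hs⟩ := IsLocalization.surj
      (Algebra.algebraMapSubmonoid S (nonZeroDivisors ℂ[X])) x
    refine ⟨q, nonZeroDivisors.ne_zero hq, ?_⟩
    have h1 := Place.intAway_iff (K := K) S (aeval t q * x)
    rw [hX] at h1
    refine h1.2 ⟨s, ?_⟩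
    rw [← hs, mul_comm, haev, IsScalarTower.algebraMap_apply ℂ[X] S K]
  · let b := (Module.finBasisOfFinrankEq ℂ[X] S hrank)
    refine ⟨fun i => algebraMap S K (b i), ?_, fun x => ?_⟩
    · have := b.linearIndependent.map' ((IsScalarTower.toAlgHom ℂ[X] S K).toLinearMap)
        (LinearMap.ker_eq_bot.2 (IsFractionRing.injective S K))
      exact (LinearIndependent.iff_fractionRing ℂ[X] ℂ⟮t⟯).1 this
    · have h1 := Place.intAway_iff (K := K) S x
      rw [hX] at h1
      rw [h1]
      constructor
      · rintro ⟨s, rfl⟩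
        refine ⟨fun i => b.repr s i, ?_⟩
        conv_lhs => rw [← b.sum_repr s]
        rw [map_sum]
        refine Finset.sum_congr rfl fun i _ => ?_
        rw [Algebra.smul_def, map_mul, ← IsScalarTower.algebraMap_apply ℂ[X] S K, haev]
      · rintro ⟨f, rfl⟩
        refine ⟨∑ i, f i • b i, ?_⟩
        rw [map_sum]
        refine Finset.sum_congr rfl fun i _ => ?_
        rw [Algebra.smul_def, map_mul, ← IsScalarTower.algebraMap_apply ℂ[X] S K, haev]

end
end EpsComplement

/-! ### Degree of principal divisors, and orders at poles. -/

namespace EpsComplement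
noncomputable section

open Polynomial IsDedekindDomain
open scoped IntermediateField

variable {K : Type*} [Field K] [Algebra ℂ K]

lemma transcendental_inv {t : K} (ht : Transcendental ℂ t) : Transcendental ℂ t⁻¹ :=
  fun h => ht (by simpa using h.inv)

lemma transcendental_sub_const {t : K} (ht : Transcendental ℂ t) (c : ℂ) :
    Transcendental ℂ (t - algebraMap ℂ K c) :=
  fun h => ht (by simpa using h.add (isAlgebraic_algebraMap c))

lemma adjoin_inv (t : K) : ℂ⟮t⟯ = ℂ⟮t⁻¹⟯ := by
  apply le_antisymm <;> rw [IntermediateField.adjoin_simple_le_iff]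
  · simpa using inv_mem (IntermediateField.mem_adjoin_simple_self ℂ t⁻¹)
  · exact inv_mem (IntermediateField.mem_adjoin_simple_self ℂ t)

lemma adjoin_sub_const (t : K) (c : ℂ) : ℂ⟮t⟯ = ℂ⟮t - algebraMap ℂ K c⟯ := by
  apply le_antisymm <;> rw [IntermediateField.adjoin_simple_le_iff]
  · simpa using add_mem (IntermediateField.mem_adjoin_simple_self ℂ (t - algebraMap ℂ K c))
      (IntermediateField.algebraMap_mem _ c)
  · exact sub_mem (IntermediateField.mem_adjoin_simple_self ℂ t)
      (IntermediateField.algebraMap_mem _ c)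

namespace Place

lemma transcendental_of_ord {v : Place K} {x : K} (h : v.ord x ≠ 0) : Transcendental ℂ x :=
  fun hx => by
    obtain ⟨c, rfl⟩ := exists_eq_const_of_isAlgebraic hx
    exact h (v.ord_const c)

variable [IsCurveField K]

/-- A function without poles is constant. -/
lemma exists_eq_const {x : K} (h : ∀ v : Place K, v.Int x) : ∃ c, x = algebraMap ℂ K c := by
  by_cases hx : IsAlgebraic ℂ x
  · exact exists_eq_const_of_isAlgebraic hx
  obtain ⟨v, hv⟩ := (isCovering (transcendental_inv hx) rfl).exists_zero
  rw [ord_inv] at hv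
  have := h v
  unfold Int at this
  omega

lemma finite_zeros {x : K} : {v : Place K | 0 < v.ord x}.Finite := by
  by_cases hx : IsAlgebraic ℂ x
  · obtain ⟨c, rfl⟩ := exists_eq_const_of_isAlgebraic hx
    simp [ord_const]
  · exact (isCovering hx rfl).finite_zeros

lemma finite_support (x : K) : (Function.support fun v : Place K => v.ord x).Finite := by
  refine ((finite_zeros (x := x)).union (finite_zeros (x := x⁻¹))).subset fun v hv => ?_
  rw [Function.mem_support] at hv
  simp only [Set.mem_union, Set.mem_ofPred_eq, ord_inv]
  omega

/-- Principal divisors have degree zero. -/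
theorem finsum_ord (x : K) : ∑ᶠ v : Place K, v.ord x = 0 := by
  classical
  by_cases hx : IsAlgebraic ℂ x
  · obtain ⟨c, rfl⟩ := exists_eq_const_of_isAlgebraic hx
    simp [ord_const]
  -- The zeros of `x` and those of `x⁻¹` have the same degree `[K : ℂ(x)]`, since `ℂ(x) = ℂ(x⁻¹)`.
  have h1 := (isCovering hx rfl).sum_zeros (finite_zeros (x := x)).toFinset (by simp)
  have h2 := (isCovering (transcendental_inv hx) (adjoin_inv x)).sum_zeros
    (finite_zeros (x := x⁻¹)).toFinset (by simp)
  rw [finsum_eq_sum_of_support_subset (s := (finite_zeros (x := x)).toFinset ∪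
    (finite_zeros (x := x⁻¹)).toFinset), Finset.sum_union, h1]
  · rw [Finset.sum_congr rfl fun v _ => v.ord_inv x, Finset.sum_neg_distrib] at h2
    linarith
  · rw [Finset.disjoint_left]
    intro v
    simp only [Set.Finite.mem_toFinset, Set.mem_ofPred_eq, ord_inv]
    omega
  · intro v hv
    rw [Function.mem_support] at hv
    simp only [Finset.coe_union, Set.Finite.coe_toFinset, Set.mem_union, Set.mem_ofPred_eq, ord_inv]
    omega

/-- At a pole of `t` the leading term dominates; the reversed polynomial reduces this to `ord_aeval`
for `t⁻¹`. -/
lemma ord_aeval_of_neg {v : Place K} {t : K} (ht : v.ord t < 0) {q : ℂ[X]} (hq : q ≠ 0) :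
    v.ord (aeval t q) = q.natDegree * v.ord t := by
  have ht0 : t ≠ 0 := ne_zero_of_ord ht.ne
  have h : aeval t q = t ^ q.natDegree * aeval t⁻¹ q.reverse := by
    letI := invertibleOfNonzero ht0
    have := eval₂_reverse_mul_pow (algebraMap ℂ K) t q
    rw [aeval_def, aeval_def, mul_comm, ← this]
    simp
  have hrev : q.reverse.coeff 0 ≠ 0 := by rw [coeff_zero_reverse]; simpa using hq
  have h0 : v.ord (aeval t⁻¹ q.reverse) = 0 := ord_aeval (by rw [ord_inv]; omega) hrev
  have hne : aeval t⁻¹ q.reverse ≠ 0 := by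
    intro h'
    rw [h', mul_zero] at h
    exact transcendental_of_ord ht.ne ⟨q, hq, h⟩
  rw [h, v.ord_mul (pow_ne_zero _ ht0) hne, h0, ord_pow, add_zero]

end Place

/-! ### Reduced bases -/

section Reduced

/-- `x` grows at most like `t ^ k` at the poles of `t`. -/
def GrowthLE (t : K) (k : ℤ) (x : K) : Prop := ∀ v : Place K, v.ord t < 0 → v.Int (x * t ^ (-k))

variable {t : K}

lemma growthLE_iff {k : ℤ} {x : K} (hx : x ≠ 0) :
    GrowthLE t k x ↔ ∀ v : Place K, v.ord t < 0 → k * v.ord t ≤ v.ord x := by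
  refine forall₂_congr fun v hv => ?_
  unfold Place.Int
  rw [v.ord_mul hx (zpow_ne_zero _ (Place.ne_zero_of_ord hv.ne)), Place.ord_zpow]
  constructor <;> intro h <;> linarith

lemma growthLE_zero (k : ℤ) : GrowthLE t k 0 := fun v _ => by rw [zero_mul]; exact v.int_zero

lemma GrowthLE.sub {k : ℤ} {x y : K} (hx : GrowthLE t k x) (hy : GrowthLE t k y) :
    GrowthLE t k (x - y) := fun v hv => by
  rw [sub_mul]; exact (hx v hv).sub (hy v hv)

lemma GrowthLE.sum {ι : Type*} {s : Finset ι} {k : ℤ} {f : ι → K}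
    (h : ∀ i ∈ s, GrowthLE t k (f i)) : GrowthLE t k (∑ i ∈ s, f i) := fun v hv => by
  rw [Finset.sum_mul]; exact Place.Int.sum fun i hi => h i hi v hv

lemma GrowthLE.mul {k l : ℤ} {x y : K} (hx : GrowthLE t k x) (hy : GrowthLE t l y) :
    GrowthLE t (k + l) (x * y) := fun v hv => by
  have := (hx v hv).mul (hy v hv)
  have e : x * t ^ (-k) * (y * t ^ (-l)) = x * y * t ^ (-(k + l)) := by
    rw [neg_add, zpow_add₀ (Place.ne_zero_of_ord hv.ne)]; ring
  rwa [e] at this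

lemma growthLE_const (c : ℂ) : GrowthLE t 0 (algebraMap ℂ K c) := fun v _ => by
  simpa using v.int_const c

lemma growthLE_pow (n : ℕ) : GrowthLE t n (t ^ n) := fun v hv => by
  rw [zpow_neg, zpow_natCast, mul_inv_cancel₀ (pow_ne_zero _ (Place.ne_zero_of_ord hv.ne))]
  exact v.int_one

lemma GrowthLE.mono {k l : ℤ} {x : K} (hx : GrowthLE t k x) (h : k ≤ l) : GrowthLE t l x := by
  by_cases hx0 : x = 0
  · subst hx0; exact growthLE_zero l
  rw [growthLE_iff hx0] at hx ⊢
  intro v hv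
  have := hx v hv
  nlinarith

lemma GrowthLE.const_mul {k : ℤ} {x : K} (hx : GrowthLE t k x) (c : ℂ) :
    GrowthLE t k (algebraMap ℂ K c * x) := by
  simpa using (growthLE_const c).mul hx

/-- The shift from `< n` to `n - 1` includes the zero polynomial at `n = 0`, with the bound `-1`. -/
lemma growthLE_aeval {q : ℂ[X]} {n : ℕ} (h : q.degree < n) :
    GrowthLE t (n - 1 : ℤ) (aeval t q) := by
  by_cases hq : q = 0
  · subst hq; rw [map_zero]; exact growthLE_zero _
  rw [aeval_eq_sum_range' ((natDegree_lt_iff_degree_lt hq).2 h)]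
  refine GrowthLE.sum fun i hi => ?_
  rw [Algebra.smul_def]
  refine ((growthLE_pow i).const_mul _).mono ?_
  have := Finset.mem_range.1 hi
  omega

variable [IsCurveField K]

lemma exists_growthLE (t x : K) : ∃ k : ℕ, GrowthLE t k x := by
  by_cases hx : x = 0
  · exact ⟨0, hx ▸ growthLE_zero _⟩
  have hf := Place.finite_support x
  obtain ⟨k, hk⟩ : ∃ k : ℕ, ∀ v ∈ hf.toFinset, -v.ord x ≤ k :=
    ⟨∑ v ∈ hf.toFinset, (v.ord x).natAbs, fun v hv => by
      have := Finset.single_le_sum (f := fun v : Place K => (v.ord x).natAbs)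
        (fun _ _ => Nat.zero_le _) hv
      omega⟩
  refine ⟨k, (growthLE_iff hx).2 fun v hv => ?_⟩
  by_cases h0 : v.ord x = 0
  · rw [h0]; exact mul_nonpos_of_nonneg_of_nonpos (by positivity) hv.le
  · have := hk v (by simpa using h0)
    nlinarith [(by positivity : (0 : ℤ) ≤ k)]

/-- A function regular where `t` is and vanishing at the poles of `t` is zero. -/
lemma eq_zero_of_growthLE (ht : Transcendental ℂ t) {x : K} (hx : Place.IntAway t x)
    (h : GrowthLE t (-1) x) : x = 0 := by
  by_contra hx0
  rw [growthLE_iff hx0] at h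
  obtain ⟨c, rfl⟩ := Place.exists_eq_const (x := x) fun v => by
    by_cases hv : v.Int t
    · exact hx v hv
    · unfold Place.Int at hv ⊢
      have := h v (by omega)
      omega
  obtain ⟨v, hv⟩ := (isCovering (transcendental_inv ht) rfl).exists_zero
  rw [Place.ord_inv] at hv
  have := h v (by omega)
  rw [v.ord_const] at this
  omega

open Classical in
/-- The order of growth of `x` at the poles of `t`. -/
def growth (t x : K) : ℕ := Nat.find (exists_growthLE t x)

lemma growthLE_growth (t x : K) : GrowthLE t (growth t x) x := by
  classical
  exact Nat.find_spec (exists_growthLE t x)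

lemma growth_le {k : ℕ} {x : K} (h : GrowthLE t k x) : growth t x ≤ k := by
  classical
  exact Nat.find_min' _ h

/-- `e` generates the module of functions regular where `t` is over `ℂ[t]`. -/
def Generates (t : K) {d : ℕ} (e : Fin d → K) : Prop :=
  (∀ i, Place.IntAway t (e i)) ∧
    ∀ x, Place.IntAway t x → ∃ f : Fin d → ℂ[X], x = ∑ i, aeval t (f i) * e i

lemma intAway_sum {d : ℕ} {e : Fin d → K} (he : ∀ i, Place.IntAway t (e i)) (f : Fin d → ℂ[X]) :
    Place.IntAway t (∑ i, aeval t (f i) * e i) := fun v hv =>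
  Place.Int.sum fun i _ => (hv.aeval _).mul (he i v hv)

lemma Generates.linearIndependent (ht : Transcendental ℂ t) {F : IntermediateField ℂ K}
    (hF : F = ℂ⟮t⟯) {e : Fin (Module.finrank F K) → K} (he : Generates t e) :
    LinearIndependent F e := by
  have haev : ∀ q : ℂ[X], aeval t q ∈ F := fun q => by
    rw [hF]
    exact IntermediateField.algebra_adjoin_le_adjoin ℂ {t} (aeval_mem_adjoin_singleton ℂ t)
  apply linearIndependent_of_top_le_span_of_card_eq_finrank _ (by simp)
  rintro x -
  obtain ⟨q, hq, hqx⟩ := (isCovering ht hF).exists_denom x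
  obtain ⟨f, hf⟩ := he.2 _ hqx
  have hq0 : aeval t q ≠ 0 := fun h => ht ⟨q, hq, h⟩
  have : x = ∑ i, (⟨aeval t (f i) / aeval t q, div_mem (haev _) (haev _)⟩ : F) • e i := by
    rw [eq_comm, ← mul_right_inj' hq0, hf, Finset.mul_sum]
    refine Finset.sum_congr rfl fun i _ => ?_
    rw [Algebra.smul_def, IntermediateField.algebraMap_apply]
    field_simp
  rw [this]
  exact Submodule.sum_mem _ fun i _ => Submodule.smul_mem _ _ (Submodule.subset_span ⟨i, rfl⟩)

/-- An elementary operation, invertible over `ℂ[t]` because the coefficient at `i₀` is a nonzero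
constant. -/
lemma Generates.update {d : ℕ} {e : Fin d → K} (he : Generates t e) {i₀ : Fin d} (c : Fin d → ℂ[X])
    {a : ℂ} (ha : a ≠ 0) (hc : c i₀ = C a) :
    Generates t (Function.update e i₀ (∑ i, aeval t (c i) * e i)) := by
  classical
  set e' := ∑ i, aeval t (c i) * e i with he'
  refine ⟨fun i => ?_, fun x hx => ?_⟩
  · by_cases hi : i = i₀
    · subst hi; rw [Function.update_self]; exact intAway_sum he.1 c
    · rw [Function.update_of_ne hi]; exact he.1 i
  obtain ⟨f, rfl⟩ := he.2 x hx
  refine ⟨fun i => if i = i₀ then C a⁻¹ * f i₀ else f i - C a⁻¹ * c i * f i₀, ?_⟩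
  rw [← Finset.add_sum_erase _ _ (Finset.mem_univ i₀)] at he' ⊢
  conv_rhs => rw [← Finset.add_sum_erase _ _ (Finset.mem_univ i₀)]
  rw [hc, aeval_C] at he'
  have h1 : ∀ i ∈ Finset.univ.erase i₀, aeval t (if i = i₀ then C a⁻¹ * f i₀
      else f i - C a⁻¹ * c i * f i₀) * Function.update e i₀ e' i =
      aeval t (f i) * e i - algebraMap ℂ K a⁻¹ * aeval t (f i₀) * (aeval t (c i) * e i) := by
    intro i hi
    have hi' := Finset.ne_of_mem_erase hi
    rw [if_neg hi', Function.update_of_ne hi']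
    simp only [map_sub, map_mul, aeval_C]
    ring
  beta_reduce
  rw [Finset.sum_congr rfl h1, Finset.sum_sub_distrib, ← Finset.mul_sum, if_pos rfl,
    Function.update_self]
  have h2 : ∑ i ∈ Finset.univ.erase i₀, aeval t (c i) * e i = e' - algebraMap ℂ K a * e i₀ := by
    rw [he']; ring
  rw [h2, map_mul, aeval_C]
  have h3 : algebraMap ℂ K a⁻¹ * algebraMap ℂ K a = 1 := by
    rw [← map_mul, inv_mul_cancel₀ ha, map_one]
  linear_combination (- aeval t (f i₀) * e i₀) * h3

/-- The functions that are regular where `t` is have a basis over `ℂ[t]` that is orthogonal with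
respect to the growth at the poles of `t`. -/
theorem exists_reduced (ht : Transcendental ℂ t) {F : IntermediateField ℂ K} (hF : F = ℂ⟮t⟯) :
    ∃ e : Fin (Module.finrank F K) → K, Generates t e ∧ LinearIndependent F e ∧
      ∀ (f : Fin (Module.finrank F K) → ℂ[X]) (k : ℤ), GrowthLE t k (∑ i, aeval t (f i) * e i) →
        ∀ i, f i ≠ 0 → ((f i).natDegree + growth t (e i) : ℤ) ≤ k := by
  classical
  set d := Module.finrank F K
  -- The basis is chosen with least total growth; a failure of orthogonality would produce a smaller
  -- one.
  have hex : ∃ N : ℕ, ∃ e : Fin d → K, Generates t e ∧ ∑ i, growth t (e i) = N := by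
    obtain ⟨e, -, he⟩ := (isCovering ht hF).exists_basis
    refine ⟨_, e, ⟨fun i => (he _).2 ⟨Pi.single i 1, ?_⟩, fun x hx => (he x).1 hx⟩, rfl⟩
    rw [Finset.sum_eq_single i]
    · simp
    · intro j _ hj; simp [hj]
    · simp
  obtain ⟨e, he, hN⟩ := Nat.find_spec hex
  have hmin : ∀ e' : Fin d → K, Generates t e' →
      ∑ i, growth t (e i) ≤ ∑ i, growth t (e' i) := fun e' he' => by
    rw [hN]; exact Nat.find_min' hex ⟨e', he', rfl⟩
  have hli := he.linearIndependent ht hF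
  refine ⟨e, he, hli, fun f k hk => ?_⟩
  by_contra! hcon
  obtain ⟨j, hj0, hj⟩ := hcon
  let n : Fin d → ℕ := fun i => growth t (e i)
  obtain ⟨i₁, hi₁, hmax⟩ := Finset.exists_max_image (Finset.univ.filter fun i => f i ≠ 0)
    (fun i => (f i).natDegree + n i) ⟨j, by simpa using hj0⟩
  simp only [Finset.mem_filter, Finset.mem_univ, true_and] at hi₁ hmax
  set m := (f i₁).natDegree + n i₁ with hm
  have hkm : k ≤ (m : ℤ) - 1 := by
    have := hmax j hj0
    have : ((f j).natDegree + n j : ℤ) ≤ m := by exact_mod_cast this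
    have hj' : k < (f j).natDegree + n j := hj
    omega
  -- `m` is the growth expected from the separate terms and exceeds the actual one. So the top
  -- coefficients `c i` of the terms reaching growth `m` define a combination in which this growth
  -- cancels.
  let c : Fin d → ℂ := fun i => if n i ≤ m then (f i).coeff (m - n i) else 0
  have hci₁ : c i₁ ≠ 0 := by
    simp only [c, hm]
    rw [if_pos (by omega), Nat.add_sub_cancel]
    simpa using hi₁
  have hy : GrowthLE t (m - 1 : ℤ) (∑ i, algebraMap ℂ K (c i) * t ^ (m - n i) * e i) := by
    have h1 : GrowthLE t (m - 1 : ℤ) (∑ i, (aeval t (f i) * e i -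
        algebraMap ℂ K (c i) * t ^ (m - n i) * e i)) := by
      refine GrowthLE.sum fun i _ => ?_
      by_cases hni : n i ≤ m
      · have hdeg : (f i - C (c i) * X ^ (m - n i)).degree < ((m - n i : ℕ) : WithBot ℕ) := by
          by_cases hfi : f i = 0
          · simp [c, hfi]
          rw [degree_lt_iff_coeff_zero]
          intro l hl
          rw [coeff_sub, coeff_C_mul, coeff_X_pow]
          rcases hl.eq_or_lt with rfl | hl
          · simp [c, hni]
          · have := hmax i hfi
            rw [if_neg hl.ne', mul_zero, sub_zero, coeff_eq_zero_of_natDegree_lt (by omega)]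
        have h2 := (growthLE_aeval (t := t) hdeg).mul (growthLE_growth t (e i))
        have h3 : aeval t (f i - C (c i) * X ^ (m - n i)) * e i =
            aeval t (f i) * e i - algebraMap ℂ K (c i) * t ^ (m - n i) * e i := by
          simp only [map_sub, map_mul, aeval_C, map_pow, aeval_X]
          ring
        rw [← h3]
        refine h2.mono ?_
        change ((m - n i : ℕ) : ℤ) - 1 + n i ≤ m - 1
        omega
      · have hfi : f i = 0 := by
          by_contra hfi
          have := hmax i hfi
          omega
        have hc : c i = 0 := by simp [c, hni]
        rw [hfi, hc]
        simpa using growthLE_zero _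
    rw [Finset.sum_sub_distrib] at h1
    simpa using (hk.mono hkm).sub h1
  obtain ⟨i₀, hi₀, hmax₀⟩ := Finset.exists_max_image (Finset.univ.filter fun i => c i ≠ 0)
    n ⟨i₁, by simpa using hci₁⟩
  simp only [Finset.mem_filter, Finset.mem_univ, true_and] at hi₀ hmax₀
  have hn₀ : n i₀ ≤ m := by
    by_contra h
    exact hi₀ (by simp [c, h])
  -- Since `i₀` has the largest growth among the indices involved, `t ^ (m - n i₀)` can be divided
  -- out. This leaves `e i₀` with a constant coefficient, so the combination may replace it, and it
  -- grows less.
  let q : Fin d → ℂ[X] := fun i => C (c i) * X ^ (n i₀ - n i)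
  have ht0 : t ≠ 0 := by rintro rfl; exact ht isAlgebraic_zero
  have he' : GrowthLE t (n i₀ - 1 : ℤ) (∑ i, aeval t (q i) * e i) := by
    intro v hv
    have h1 := hy v hv
    have h2 : (∑ i, algebraMap ℂ K (c i) * t ^ (m - n i) * e i) =
        t ^ (m - n i₀) * ∑ i, aeval t (q i) * e i := by
      rw [Finset.mul_sum]
      refine Finset.sum_congr rfl fun i _ => ?_
      by_cases hc : c i = 0
      · simp [q, hc]
      · have := hmax₀ i hc
        simp only [q, map_mul, aeval_C, map_pow, aeval_X]
        rw [show m - n i = (m - n i₀) + (n i₀ - n i) by omega, pow_add]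
        ring
    have h3 : (t : K) ^ (-((m : ℤ) - 1)) = (t ^ (m - n i₀))⁻¹ * t ^ (-((n i₀ : ℤ) - 1)) := by
      rw [← zpow_natCast, ← zpow_neg, ← zpow_add₀ ht0]
      congr 1
      omega
    rw [h2, h3] at h1
    convert h1 using 1
    field_simp
  have hq₀ : q i₀ = C (c i₀) := by simp [q]
  -- `growth` takes values in `ℕ`, so minimality does not see a drop below `0`; in that case the
  -- combination vanishes, against linear independence.
  rcases Nat.eq_zero_or_pos (n i₀) with h0 | h0
  · rw [h0] at he'
    have h1 := eq_zero_of_growthLE ht (intAway_sum he.1 q) (by simpa using he')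
    have haev : ∀ q : ℂ[X], aeval t q ∈ F := fun q => by
      rw [hF]
      exact IntermediateField.algebra_adjoin_le_adjoin ℂ {t} (aeval_mem_adjoin_singleton ℂ t)
    have h2 := Fintype.linearIndependent_iff.1 hli (fun i => ⟨aeval t (q i), haev _⟩)
      (by simpa [Algebra.smul_def] using h1) i₀
    rw [Subtype.ext_iff, hq₀] at h2
    simp at h2
    exact hi₀ h2
  · have h1 := hmin _ (he.update q hi₀ hq₀)
    have h2 : growth t (∑ i, aeval t (q i) * e i) < n i₀ := by
      have : growth t (∑ i, aeval t (q i) * e i) ≤ n i₀ - 1 := growth_le (by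
        convert he' using 1; omega)
      omega
    refine absurd h1 (not_le.2 (Finset.sum_lt_sum (fun i _ => ?_) ⟨i₀, Finset.mem_univ _, ?_⟩))
    · by_cases hi : i = i₀
      · subst hi; rw [Function.update_self]; exact h2.le
      · rw [Function.update_of_ne hi]
    · rw [Function.update_self]; exact h2

end Reduced

end
end EpsComplement

/-! ### Trace duality: a regular form or a function with one simple pole. -/

namespace EpsComplement
noncomputable section

open Polynomial IsDedekindDomain
open scoped IntermediateField

variable {K : Type*} [Field K] [Algebra ℂ K] [IsCurveField K]

variable (K) in
lemma exists_transcendental : ∃ t : K, Transcendental ℂ t := by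
  by_contra! h
  have h0 : Algebra.trdeg ℂ K = 0 := by
    haveI : Algebra.IsAlgebraic ℂ K := ⟨fun x => by simpa [Transcendental] using h x⟩
    exact _root_.trdeg_eq_zero
  rw [IsCurveField.trdeg] at h0
  exact one_ne_zero h0

/-- The trace dual of the functions regular at the zeros of `t` has poles bounded by the
different. -/
lemma IsCovering.one_sub_le_ord {t : K} {F : IntermediateField ℂ K} (hc : IsCovering t F)
    (htF : t ∈ F) {v₀ : Place K} (h0 : 0 < v₀.ord t) {f : K} (hf : f ≠ 0)
    (H : ∀ h : K, (∀ v : Place K, 0 < v.ord t → v.Int h) →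
      v₀.Int (Algebra.trace F K (f * h) : K)) : 1 - v₀.ord t ≤ v₀.ord f := by
  by_contra! hcon
  have ht0 : t ≠ 0 := Place.ne_zero_of_ord h0.ne'
  obtain ⟨k, hk⟩ : ∃ k : ℕ, ∀ v : Place K, v.ord f ≤ k := by
    have hs := Place.finite_support f
    refine ⟨∑ v ∈ hs.toFinset, (v.ord f).natAbs, fun v => ?_⟩
    by_cases hv : v ∈ hs.toFinset
    · have := Finset.single_le_sum (f := fun v : Place K => (v.ord f).natAbs)
        (fun _ _ => Nat.zero_le _) hv
      omega
    · have : v.ord f = 0 := by simpa using hv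
      omega
  obtain ⟨y, -, hy0, hy, q, hq, hqy⟩ := hc.approx v₀ h0 (k + 1) k.succ_pos
  have hy0' := Place.ord_eq_zero_of_int h0 k.succ_pos hy0
  -- If the pole of `f` at `v₀` is too large, the test function `y / (t * f)` is regular at all
  -- zeros of `t`; but its product with `f` is `y / t`, whose trace has a pole at `v₀`.
  have hh : ∀ v : Place K, 0 < v.ord t → v.Int (y / (t * f)) := by
    intro v hv
    by_cases hvv : v = v₀
    · subst hvv
      by_cases hy : y = 0
      · rw [hy, zero_div]; exact v.int_zero
      unfold Place.Int
      rw [v.ord_div hy (mul_ne_zero ht0 hf), v.ord_mul ht0 hf]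
      omega
    · have e : y / (t * f) = y / t ^ (k + 1) * (t ^ k / f) := by
        field_simp
        ring
      rw [e]
      refine (hy v hvv hv).mul ?_
      rw [Place.int_div_iff (pow_ne_zero _ ht0) hf, Place.ord_pow]
      have := hk v
      nlinarith [(by positivity : (0 : ℤ) ≤ k)]
  have h1 := H _ hh
  have e : f * (y / (t * f)) = (⟨t, htF⟩⁻¹ : F) • y := by
    rw [Algebra.smul_def, map_inv₀, IntermediateField.algebraMap_apply]
    field_simp
  rw [e, map_smul, smul_eq_mul, MulMemClass.coe_mul, hqy] at h1
  change v₀.Int (t⁻¹ * aeval t q) at h1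
  have hq0 : aeval t q ≠ 0 := fun h =>
    Place.transcendental_of_ord h0.ne' ⟨q, by rintro rfl; simp at hq, h⟩
  unfold Place.Int at h1
  rw [v₀.ord_mul (inv_ne_zero ht0) hq0, Place.ord_aeval h0 hq, Place.ord_inv] at h1
  omega

lemma aeval_mem_of_eq {t : K} {F : IntermediateField ℂ K} (hF : F = ℂ⟮t⟯) (q : ℂ[X]) :
    aeval t q ∈ F := by
  rw [hF]
  exact IntermediateField.algebra_adjoin_le_adjoin ℂ {t} (aeval_mem_adjoin_singleton ℂ t)

/-- If a reduced basis for `t` has an element of growth at least two, the corresponding element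
`f` of the trace dual basis makes the form `f dt` regular everywhere. -/
lemma exists_dual {t : K} (ht : Transcendental ℂ t) {F : IntermediateField ℂ K} (hF : F = ℂ⟮t⟯)
    {e : Fin (Module.finrank F K) → K} (he : Generates t e) (hli : LinearIndependent F e)
    (hred : ∀ (f : Fin (Module.finrank F K) → ℂ[X]) (k : ℤ),
      GrowthLE t k (∑ i, aeval t (f i) * e i) →
        ∀ i, f i ≠ 0 → ((f i).natDegree + growth t (e i) : ℤ) ≤ k)
    {i₀ : Fin (Module.finrank F K)} (hi₀ : 2 ≤ growth t (e i₀)) :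
    ∃ f : K, f ≠ 0 ∧ (∀ v : Place K, ∀ c : ℂ, 0 < v.ord (t - algebraMap ℂ K c) →
      1 - v.ord (t - algebraMap ℂ K c) ≤ v.ord f) ∧
      ∀ v : Place K, v.ord t < 0 → 1 - v.ord t ≤ v.ord f := by
  haveI : FiniteDimensional F K := hF ▸ finiteDimensional_adjoin ht
  have haev := aeval_mem_of_eq (K := K) hF
  have htF : t ∈ F := by simpa using haev X
  have ht0 : t ≠ 0 := by rintro rfl; exact ht isAlgebraic_zero
  let b : Module.Basis (Fin (Module.finrank F K)) F K :=
    basisOfLinearIndependentOfCardEqFinrank' e hli (by simp)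
  have hb : ∀ i, b i = e i := fun i => by simp [b]
  -- With this `f`, the trace of `f * x` is the coefficient of `x` at `e i₀`.
  let f : K := (Algebra.traceForm F K).dualBasis (traceForm_nondegenerate F K) b i₀
  have hTr : ∀ g : Fin (Module.finrank F K) → ℂ[X],
      (Algebra.trace F K (f * ∑ i, aeval t (g i) * e i) : K) = aeval t (g i₀) := by
    intro g
    have e1 : f * ∑ i, aeval t (g i) * e i =
        ∑ i, (⟨aeval t (g i), haev _⟩ : F) • (f * b i) := by
      rw [Finset.mul_sum]
      refine Finset.sum_congr rfl fun i _ => ?_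
      rw [hb, Algebra.smul_def, IntermediateField.algebraMap_apply]
      ring
    have e2 : ∀ i, Algebra.trace F K (f * b i) = if i = i₀ then 1 else 0 := fun i =>
      LinearMap.BilinForm.apply_dualBasis_left (B := Algebra.traceForm F K)
        (hB := traceForm_nondegenerate F K) b i₀ i
    rw [e1, map_sum]
    simp only [map_smul, e2, smul_eq_mul, mul_ite, mul_one, mul_zero]
    simp
  have hTr' : ∀ {q : ℂ[X]} {s h : K} (_ : s ∈ F) (_ : s ≠ 0) {g : Fin (Module.finrank F K) → ℂ[X]}
      (_ : s * h = ∑ i, aeval t (g i) * e i),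
      (Algebra.trace F K (f * h) : K) = aeval t (g i₀) / s := by
    intro q s h hs hs0 g hg
    have e1 : f * h = (⟨s, hs⟩⁻¹ : F) • (f * (s * h)) := by
      rw [Algebra.smul_def, map_inv₀, IntermediateField.algebraMap_apply]
      field_simp
    rw [e1, map_smul, smul_eq_mul, MulMemClass.coe_mul, hg, hTr]
    change s⁻¹ * _ = _
    rw [div_eq_inv_mul]
  have hf : f ≠ 0 := by
    intro h0
    have := hTr (Pi.single i₀ 1)
    rw [h0] at this
    simp at this
  refine ⟨f, hf, fun v c hv => ?_, fun v hv => ?_⟩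
  · set s := t - algebraMap ℂ K c with hs
    have hsF : F = ℂ⟮s⟯ := hF.trans (adjoin_sub_const t c)
    have hstr := transcendental_sub_const ht c
    have hs0 : s ≠ 0 := Place.ne_zero_of_ord hv.ne'
    have hcov := isCovering hstr hsF
    have haev' := aeval_mem_of_eq (K := K) hsF
    have hst : ∀ w : Place K, w.Int t → w.Int s := fun w hw => hw.sub (w.int_const c)
    refine hcov.one_sub_le_ord (by simpa using haev' X) hv hf fun h hh => ?_
    obtain ⟨q, hq, hqh⟩ := hcov.exists_denom h
    -- Powers of `s` in the denominator are superfluous, as `h` is already regular at the zeros of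
    -- `s`. The remaining factor `q'` is a unit there, so the trace is regular at `v`.
    obtain ⟨q', hq', hdvd⟩ := q.exists_eq_pow_rootMultiplicity_mul_and_not_dvd hq 0
    set k := q.rootMultiplicity 0
    rw [C_0, sub_zero] at hq' hdvd
    rw [X_dvd_iff] at hdvd
    have hq'0 : q' ≠ 0 := by rintro rfl; simp at hdvd
    obtain ⟨g, hg⟩ := he.2 (aeval s q' * h) fun w hw => by
      have hws : w.Int s := hst w hw
      rcases lt_or_eq_of_le hws with hlt | heq
      · exact (hws.aeval q').mul (hh w hlt)
      · have := hqh w hws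
        rw [hq', map_mul, map_pow, aeval_X] at this
        have e1 : aeval s q' * h = (s ^ k)⁻¹ * (s ^ k * aeval s q' * h) := by
          field_simp
        rw [e1]
        refine Place.Int.mul ?_ this
        unfold Place.Int
        rw [Place.ord_inv, Place.ord_pow, ← heq, mul_zero, neg_zero]
    have hne : aeval s q' ≠ 0 := fun h => hstr ⟨q', hq'0, h⟩
    rw [hTr' (q := q') (haev' q') hne hg]
    have hvt : v.Int t := by
      have e1 : t = s + algebraMap ℂ K c := by rw [hs]; ring
      rw [e1]
      exact Place.Int.add hv.le (v.int_const c)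
    rw [div_eq_mul_inv]
    refine (hvt.aeval _).mul ?_
    unfold Place.Int
    rw [Place.ord_inv, Place.ord_aeval hv hdvd, neg_zero]
  · have hcov := isCovering (transcendental_inv ht) (hF.trans (adjoin_inv t))
    have hv' : 0 < v.ord t⁻¹ := by rw [Place.ord_inv]; omega
    -- In the coordinate `t⁻¹`, `f dt` is `-t² f d(t⁻¹)`, hence the factor `t ^ 2`. Growth at least
    -- `2` of `e i₀` compensates for it: a nonzero coefficient of `q(t) * h` at `e i₀` has degree at
    -- most `deg q - 2`.
    have key := hcov.one_sub_le_ord (inv_mem htF) hv' (f := t ^ 2 * f)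
      (mul_ne_zero (pow_ne_zero _ ht0) hf) fun h hh => ?_
    · rw [v.ord_mul (pow_ne_zero _ ht0) hf, Place.ord_inv, Place.ord_pow] at key
      push_cast at key
      omega
    obtain ⟨q, hq, hqh⟩ := (isCovering ht hF).exists_denom h
    have hne : aeval t q ≠ 0 := fun h => ht ⟨q, hq, h⟩
    obtain ⟨g, hg⟩ := he.2 _ hqh
    have hgr : GrowthLE t q.natDegree (∑ i, aeval t (g i) * e i) := by
      rw [← hg]
      have h1 := growthLE_aeval (t := t) (q := q) (n := q.natDegree + 1)
        (degree_lt_iff_coeff_zero _ _ |>.2 fun m hm => coeff_eq_zero_of_natDegree_lt hm)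
      have h2 : GrowthLE t 0 h := fun w hw => by
        rw [neg_zero, zpow_zero, mul_one]
        exact hh w (by rw [Place.ord_inv]; omega)
      simpa using h1.mul h2
    have e1 : t ^ 2 * f * h = (⟨t, htF⟩ ^ 2 : F) • (f * h) := by
      rw [Algebra.smul_def, map_pow, IntermediateField.algebraMap_apply]
      ring
    rw [e1, map_smul, smul_eq_mul, MulMemClass.coe_mul, hTr' (q := q) (haev q) hne hg]
    change v.Int (t ^ 2 * _)
    by_cases hg0 : g i₀ = 0
    · rw [hg0, map_zero, zero_div, mul_zero]; exact v.int_zero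
    have h3 := hred g _ hgr i₀ hg0
    have hne' : aeval t (g i₀) ≠ 0 := fun h => ht ⟨_, hg0, h⟩
    unfold Place.Int
    rw [v.ord_mul (pow_ne_zero _ ht0) (div_ne_zero hne' hne), v.ord_div hne' hne, Place.ord_pow,
      Place.ord_aeval_of_neg hv hg0, Place.ord_aeval_of_neg hv hq]
    have : (2 : ℤ) ≤ growth t (e i₀) := by exact_mod_cast hi₀
    push_cast
    nlinarith

/-- The functions with order at least `n` at `v`, for `n ≤ 0`. -/
def Place.orderGE (v : Place K) (n : ℕ) : Submodule ℂ K where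
  carrier := {x | -(n : ℤ) ≤ v.ord x}
  zero_mem' := by simp [v.ord_zero]
  add_mem' {x y} hx hy := by
    simp only [Set.mem_ofPred_eq] at hx hy ⊢
    by_cases h : x + y = 0
    · rw [h, v.ord_zero]; omega
    · exact (le_min hx hy).trans (v.ord_add h)
  smul_mem' c x hx := by
    simp only [Set.mem_ofPred_eq] at hx ⊢
    rw [Algebra.smul_def]
    by_cases hc : algebraMap ℂ K c = 0
    · rw [hc, zero_mul, v.ord_zero]; omega
    by_cases hx0 : x = 0
    · rw [hx0, mul_zero, v.ord_zero]; omega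
    rwa [v.ord_mul hc hx0, v.ord_const, zero_add]

lemma Place.mem_orderGE {v : Place K} {n : ℕ} {x : K} : x ∈ v.orderGE n ↔ -(n : ℤ) ≤ v.ord x :=
  Iff.rfl

/-- An effective divisor of degree `m` with at least `m + 1` independent sections: removing points
leads to a function with just one simple pole. -/
lemma exists_simple_pole (s : Multiset (Place K)) (hs : s ≠ 0) [DecidableEq (Place K)] :
    ∀ (W : Submodule ℂ K) [FiniteDimensional ℂ W], s.card + 1 ≤ Module.finrank ℂ W →
    (∀ x ∈ W, ∀ v : Place K, x ∈ v.orderGE (s.count v)) →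
    ∃ (u : K) (v₀ : Place K), v₀.ord u = -1 ∧ ∀ v, v ≠ v₀ → v.Int u := by
  induction s using Multiset.induction with
  | empty => exact absurd rfl hs
  | cons v₁ s ih =>
    intro W _ hcard hW
    rw [Multiset.card_cons] at hcard
    by_cases hs0 : s = 0
    · subst hs0
      have hex : ∃ x ∈ W, x ∉ Submodule.span ℂ {(1 : K)} := by
        by_contra! hle
        have h1 : Module.finrank ℂ W ≤ Module.finrank ℂ (Submodule.span ℂ {(1 : K)}) :=
          Submodule.finrank_mono hle
        have h2 := finrank_span_singleton (K := ℂ) (one_ne_zero (α := K))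
        simp at hcard
        omega
      obtain ⟨x, hx, hx1⟩ := hex
      have hint : ∀ v, v ≠ v₁ → v.Int x := fun v hv => by
        have := hW x hx v
        rw [Place.mem_orderGE] at this
        simpa [Place.Int, Multiset.count_singleton, hv] using this
      refine ⟨x, v₁, ?_, hint⟩
      have h1 := hW x hx v₁
      rw [Place.mem_orderGE] at h1
      simp only [Multiset.cons_zero, Multiset.count_singleton_self, Nat.cast_one] at h1
      by_contra hne
      obtain ⟨c, hc⟩ := Place.exists_eq_const (x := x) fun v => by
        by_cases hv : v = v₁
        · subst hv
          unfold Place.Int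
          omega
        · exact hint v hv
      exact hx1 (Submodule.mem_span_singleton.2 ⟨c, by rw [hc, Algebra.smul_def, mul_one]⟩)
    · have hW' : ∀ x ∈ W ⊓ v₁.orderGE (s.count v₁), ∀ v : Place K, x ∈ v.orderGE (s.count v) := by
        intro x hx v
        by_cases hv : v = v₁
        · subst hv; exact hx.2
        · have := hW x hx.1 v
          rwa [Multiset.count_cons_of_ne hv] at this
      haveI : FiniteDimensional ℂ (W ⊓ v₁.orderGE (s.count v₁) : Submodule ℂ K) :=
        Submodule.finiteDimensional_of_le inf_le_left
      refine ih hs0 (W ⊓ v₁.orderGE (s.count v₁)) ?_ hW'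
      by_cases hle : W ≤ v₁.orderGE (s.count v₁)
      · rw [inf_eq_left.2 hle]; omega
      obtain ⟨x, hx, hx'⟩ := Set.not_subset.1 hle
      have hord : v₁.ord x = -((s.count v₁ : ℤ) + 1) := by
        have h1 := hW x hx v₁
        rw [Place.mem_orderGE, Multiset.count_cons_self] at h1
        rw [SetLike.mem_coe, Place.mem_orderGE] at hx'
        push_cast at h1
        omega
      have hx0 : x ≠ 0 := Place.ne_zero_of_ord (v := v₁) (by omega)
      -- Removing a point costs at most one dimension: the quotient of `y` by an element `x` with
      -- the largest possible pole has a residue in `ℂ`.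
      have hsup : W ≤ (W ⊓ v₁.orderGE (s.count v₁)) ⊔ Submodule.span ℂ {x} := by
        intro y hy
        have hyx : v₁.Int (y / x) := by
          by_cases hy0 : y = 0
          · rw [hy0, zero_div]; exact v₁.int_zero
          rw [Place.int_div_iff hy0 hx0]
          have h1 := hW y hy v₁
          rw [Place.mem_orderGE, Multiset.count_cons_self] at h1
          push_cast at h1
          omega
        obtain ⟨c, hc⟩ := v₁.exists_residue hyx
        rw [Submodule.mem_sup]
        refine ⟨y - c • x, ⟨W.sub_mem hy (W.smul_mem c hx), ?_⟩, c • x,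
          Submodule.smul_mem _ _ (Submodule.mem_span_singleton_self x), sub_add_cancel _ _⟩
        have e : y - c • x = x * (y / x - algebraMap ℂ K c) := by
          rw [Algebra.smul_def]
          field_simp
        rw [SetLike.mem_coe, e, Place.mem_orderGE]
        by_cases h0 : y / x - algebraMap ℂ K c = 0
        · rw [h0, mul_zero, v₁.ord_zero]; omega
        · rw [v₁.ord_mul hx0 h0]
          have := hc.resolve_left h0
          omega
      have h1 := Submodule.finrank_mono hsup
      have h2 := Submodule.finrank_add_le_finrank_add_finrank (W ⊓ v₁.orderGE (s.count v₁))
        (Submodule.span ℂ {x})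
      rw [finrank_span_singleton hx0] at h2
      omega

/-- If all elements of a reduced basis for `t` have growth at most one, there is a function with
just one simple pole. -/
lemma exists_simple_pole_of_growth {t : K} (ht : Transcendental ℂ t) {F : IntermediateField ℂ K}
    (hF : F = ℂ⟮t⟯) {e : Fin (Module.finrank F K) → K} (he : Generates t e)
    (hli : LinearIndependent F e)
    (hred : ∀ (f : Fin (Module.finrank F K) → ℂ[X]) (k : ℤ),
      GrowthLE t k (∑ i, aeval t (f i) * e i) →
        ∀ i, f i ≠ 0 → ((f i).natDegree + growth t (e i) : ℤ) ≤ k)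
    (hle : ∀ i, growth t (e i) ≤ 1) :
    ∃ (u : K) (v₀ : Place K), v₀.ord u = -1 ∧ ∀ v, v ≠ v₀ → v.Int u := by
  classical
  haveI : FiniteDimensional F K := hF ▸ finiteDimensional_adjoin ht
  have haev := aeval_mem_of_eq (K := K) hF
  -- The function `1` has growth `0`, so by orthogonality some basis element does too.
  obtain ⟨j, hj⟩ : ∃ j, growth t (e j) = 0 := by
    obtain ⟨g, hg⟩ := he.2 1 fun v _ => v.int_one
    have h1 : GrowthLE t 0 (∑ i, aeval t (g i) * e i) := by
      rw [← hg]
      simpa using growthLE_const (t := t) 1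
    obtain ⟨j, hj⟩ : ∃ j, g j ≠ 0 := by
      by_contra! hcon
      simp [hcon] at hg
    have := hred g 0 h1 j hj
    exact ⟨j, by omega⟩
  -- With `t * e j` added, the basis becomes `[K : F] + 1` functions, independent over `ℂ`, with
  -- poles bounded by the polar divisor of `t`, which has degree `[K : F]`.
  let w : Option (Fin (Module.finrank F K)) → K := fun o => o.elim (t * e j) e
  have hw : LinearIndependent ℂ w := by
    rw [Fintype.linearIndependent_iff]
    intro g hg
    rw [Fintype.sum_option] at hg
    have h1 := Fintype.linearIndependent_iff.1 hli (fun i =>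
      ⟨aeval t (C (g (some i)) + if i = j then C (g none) * X else 0), haev _⟩) (by
        rw [← hg]
        have : ∀ i, (⟨aeval t (C (g (some i)) + if i = j then C (g none) * X else 0), haev _⟩ : F) •
            e i = g (some i) • e i + if i = j then g none • (t * e j) else 0 := by
          intro i
          rw [Algebra.smul_def, IntermediateField.algebraMap_apply]
          split_ifs with h
          · subst h
            simp [Algebra.smul_def]
            ring
          · simp [Algebra.smul_def]
        rw [Finset.sum_congr rfl fun i _ => this i, Finset.sum_add_distrib]
        simp [w, add_comm])
    have h2 : ∀ i, C (g (some i)) + (if i = j then C (g none) * X else 0) = 0 := fun i => by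
      by_contra h
      exact ht ⟨_, h, congrArg Subtype.val (h1 i)⟩
    rintro (_ | i)
    · have := congrArg (coeff · 1) (h2 j)
      simpa [coeff_C] using this
    · have := congrArg (coeff · 0) (h2 i)
      by_cases hij : i = j <;> simpa [hij] using this
  have hfin := Place.finite_zeros (x := t⁻¹)
  have hsum := (isCovering (transcendental_inv ht) (hF.trans (adjoin_inv t))).sum_zeros
    hfin.toFinset (by simp)
  let s : Multiset (Place K) := ∑ v ∈ hfin.toFinset, Multiset.replicate (v.ord t⁻¹).toNat v
  have hcount : ∀ v, v.ord t < 0 → (s.count v : ℤ) = -v.ord t := by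
    intro v hv
    simp only [s, Multiset.count_sum', Multiset.count_replicate]
    rw [Finset.sum_eq_single v]
    · rw [if_pos rfl, Place.ord_inv]; omega
    · intro w _ hw; rw [if_neg hw]
    · intro h
      exfalso
      simp [Place.ord_inv, hv] at h
  have hcard : s.card = Module.finrank F K := by
    zify
    rw [← hsum]
    simp only [s, Multiset.card_sum, Multiset.card_replicate]
    rw [Nat.cast_sum]
    refine Finset.sum_congr rfl fun v hv => ?_
    have : 0 < v.ord t⁻¹ := by simpa using hv
    omega
  have hs : s ≠ 0 := by
    intro h
    rw [h, Multiset.card_zero] at hcard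
    exact (Module.finrank_pos (R := F) (M := K)).ne hcard
  have hgr : ∀ o, Place.IntAway t (w o) ∧ GrowthLE t 1 (w o) := by
    rintro (_ | i)
    · refine ⟨fun v hv => hv.mul (he.1 j v hv), ?_⟩
      have := (growthLE_pow (t := t) 1).mul (growthLE_growth t (e j))
      rw [hj] at this
      simpa [w] using this
    · exact ⟨he.1 i, (growthLE_growth t (e i)).mono (by exact_mod_cast hle i)⟩
  haveI : FiniteDimensional ℂ (Submodule.span ℂ (Set.range w)) :=
    FiniteDimensional.span_of_finite ℂ (Set.finite_range w)
  refine exists_simple_pole s hs (Submodule.span ℂ (Set.range w)) ?_ fun x hx v => ?_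
  · rw [finrank_span_eq_card hw, hcard]
    simp
  · have : Submodule.span ℂ (Set.range w) ≤ v.orderGE (s.count v) := by
      rw [Submodule.span_le]
      rintro _ ⟨o, rfl⟩
      rw [SetLike.mem_coe, Place.mem_orderGE]
      by_cases hv : v.Int t
      · have := (hgr o).1 v hv
        unfold Place.Int at this
        omega
      · unfold Place.Int at hv
        by_cases h0 : w o = 0
        · rw [h0, v.ord_zero]; omega
        have := (growthLE_iff h0).1 (hgr o).2 v (by omega)
        rw [hcount v (by omega)]
        omega
    exact this hx

variable (K) in
/-- On a complete curve either some nonzero differential form `f dt` is regular everywhere, or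
there is a function with just one simple pole. -/
theorem exists_regular_or_simple_pole :
    (∃ t f : K, Transcendental ℂ t ∧ f ≠ 0 ∧
      (∀ v : Place K, ∀ c : ℂ, 0 < v.ord (t - algebraMap ℂ K c) →
        1 - v.ord (t - algebraMap ℂ K c) ≤ v.ord f) ∧
      ∀ v : Place K, v.ord t < 0 → 1 - v.ord t ≤ v.ord f) ∨
    ∃ (u : K) (v₀ : Place K), v₀.ord u = -1 ∧ ∀ v, v ≠ v₀ → v.Int u := by
  obtain ⟨t, ht⟩ := exists_transcendental K
  obtain ⟨e, he, hli, hred⟩ := exists_reduced ht rfl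
  by_cases h : ∃ i, 2 ≤ growth t (e i)
  · obtain ⟨i, hi⟩ := h
    obtain ⟨f, hf⟩ := exists_dual ht rfl he hli hred hi
    exact Or.inl ⟨t, f, ht, hf⟩
  · push Not at h
    exact Or.inr (exists_simple_pole_of_growth ht rfl he hli hred fun i => by have := h i; omega)

end
end EpsComplement

namespace EpsComplement
noncomputable section

open Polynomial IsDedekindDomain
open scoped IntermediateField TensorProduct

variable {K : Type*} [Field K] [Algebra ℂ K] [IsCurveField K]

/-! ### Differential forms and places -/

/-- The differential forms on a curve form a one-dimensional space, with basis `dt` for any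
nonconstant `t`. -/
theorem exists_form_equiv {t : K} (ht : Transcendental ℂ t) :
    ∃ E : Ω[K⁄ℂ] ≃ₗ[K] K, E (KaehlerDifferential.D ℂ K t) = 1 := by
  haveI := finiteDimensional_adjoin ht
  letI iK : Algebra ℂ[X] K := (aeval t).toAlgebra
  haveI : IsScalarTower ℂ ℂ[X] K := .of_algebraMap_eq fun c => by
    rw [RingHom.algebraMap_toAlgebra]; simp
  letI iF : Algebra ℂ[X] ℂ⟮t⟯ := (aeval (IntermediateField.AdjoinSimple.gen ℂ t)).toAlgebra
  haveI : IsScalarTower ℂ[X] ℂ⟮t⟯ K := .of_algebraMap_eq fun q => by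
    rw [RingHom.algebraMap_toAlgebra, RingHom.algebraMap_toAlgebra]
    change aeval t q = (algebraMap ℂ⟮t⟯ K) (aeval _ q)
    rw [← aeval_algebraMap_apply, IntermediateField.AdjoinSimple.algebraMap_gen]
  have hinj : Function.Injective (algebraMap ℂ[X] K) := transcendental_iff_injective.1 ht
  have hinjF : Function.Injective (algebraMap ℂ[X] ℂ⟮t⟯) := by
    rw [IsScalarTower.algebraMap_eq ℂ[X] ℂ⟮t⟯ K, RingHom.coe_comp] at hinj
    exact hinj.of_comp
  haveI : FaithfulSMul ℂ[X] ℂ⟮t⟯ := (faithfulSMul_iff_algebraMap_injective _ _).2 hinjF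
  haveI : IsFractionRing ℂ[X] ℂ⟮t⟯ := .of_field _ _ fun x => by
    obtain ⟨r, s, hrs⟩ := (IntermediateField.mem_adjoin_simple_iff ℂ (x : K)).1 x.2
    refine ⟨r, s, Subtype.ext ?_⟩
    rw [hrs]
    simp [RingHom.algebraMap_toAlgebra]
  haveI : CharZero ℂ⟮t⟯ := charZero_of_injective_algebraMap (algebraMap ℂ ℂ⟮t⟯).injective
  -- `K` is formally étale over `ℂ[X]`, being separable over a localization of it, so its
  -- differentials are `K ⊗ Ω[ℂ[X]⁄ℂ]`, free on `dX`.
  haveI : Algebra.FormallyEtale ℂ[X] ℂ⟮t⟯ := .of_isLocalization (nonZeroDivisors ℂ[X])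
  haveI : Algebra.FormallyEtale ℂ⟮t⟯ K := .of_isSeparable _ _
  haveI : Algebra.FormallyEtale ℂ[X] K := .comp ℂ[X] ℂ⟮t⟯ K
  let E : Ω[K⁄ℂ] ≃ₗ[K] K :=
    (KaehlerDifferential.tensorKaehlerEquivOfFormallyEtale ℂ ℂ[X] K).symm ≪≫ₗ
      TensorProduct.AlgebraTensorModule.congr (.refl K K)
        (KaehlerDifferential.polynomialEquiv ℂ) ≪≫ₗ
      TensorProduct.AlgebraTensorModule.rid ℂ[X] K K
  refine ⟨E, ?_⟩
  have hX : algebraMap ℂ[X] K X = t := by rw [RingHom.algebraMap_toAlgebra]; simp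
  simp only [E, LinearEquiv.trans_apply]
  rw [← hX, KaehlerDifferential.tensorKaehlerEquivOfFormallyEtale_symm_D_algebraMap]
  simp

lemma D_ne_zero {t : K} (ht : Transcendental ℂ t) : KaehlerDifferential.D ℂ K t ≠ 0 := by
  obtain ⟨E, hE⟩ := exists_form_equiv ht
  intro h
  rw [h, map_zero] at hE
  exact zero_ne_one hE

lemma exists_eq_smul_D {t : K} (ht : Transcendental ℂ t) (ω : Ω[K⁄ℂ]) :
    ∃ g : K, ω = g • KaehlerDifferential.D ℂ K t := by
  obtain ⟨E, hE⟩ := exists_form_equiv ht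
  refine ⟨E ω, E.injective ?_⟩
  rw [map_smul, hE, smul_eq_mul, mul_one]

lemma exists_eq_smul {ω : Ω[K⁄ℂ]} (hω : ω ≠ 0) (η : Ω[K⁄ℂ]) : ∃ g : K, η = g • ω := by
  obtain ⟨t, ht⟩ := exists_transcendental K
  obtain ⟨a, ha⟩ := exists_eq_smul_D ht ω
  obtain ⟨b, hb⟩ := exists_eq_smul_D ht η
  have ha0 : a ≠ 0 := by rintro rfl; simp at ha; exact hω ha
  exact ⟨b / a, by rw [hb, ha, smul_smul, div_mul_cancel₀ _ ha0]⟩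

namespace Place

variable {v : Place K} {τ : K} {δ : Derivation ℂ K K}

/-- The derivation with respect to a function vanishing at `v` has bounded poles at `v`. -/
lemma exists_bound_derivation (hτ : 0 < v.ord τ) (hδ : δ τ = 1) :
    ∃ N : ℕ, ∀ x : K, v.Int x → v.Int (τ ^ N * δ x) := by
  have ht := transcendental_of_ord hτ.ne'
  have hτ0 : τ ≠ 0 := ne_zero_of_ord hτ.ne'
  have hc := isCovering ht rfl
  obtain ⟨e, -, he⟩ := hc.exists_basis
  have hInt : ∀ i, v.Int (e i) := fun i => ((he (e i)).2 ⟨Pi.single i 1, by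
    rw [Finset.sum_eq_single i]
    · simp
    · intro j _ hj; simp [hj]
    · simp⟩) v hτ.le
  have hδq : ∀ q : ℂ[X], δ (aeval τ q) = aeval τ (derivative q) := fun q => by
    rw [Derivation.map_aeval, hδ, smul_eq_mul, mul_one]
  obtain ⟨N, hN⟩ : ∃ N : ℕ, ∀ i, v.Int (τ ^ N * δ (e i)) := by
    refine ⟨∑ i, (v.ord (δ (e i))).natAbs, fun i => ?_⟩
    by_cases h0 : δ (e i) = 0
    · rw [h0, mul_zero]; exact v.int_zero
    have := Finset.single_le_sum (f := fun i => (v.ord (δ (e i))).natAbs)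
      (fun _ _ => Nat.zero_le _) (Finset.mem_univ i)
    unfold Int
    rw [v.ord_mul (pow_ne_zero _ hτ0) h0, ord_pow]
    have h1 : -v.ord (δ (e i)) ≤ (∑ i, (v.ord (δ (e i))).natAbs : ℕ) := by
      omega
    nlinarith
  -- The functions regular wherever `τ` is form a finite `ℂ[τ]`-module, so a bound for the
  -- generators bounds all.
  have hM : ∀ x : K, IntAway τ x → v.Int (τ ^ N * δ x) := by
    intro x hx
    obtain ⟨f, rfl⟩ := (he x).1 hx
    rw [map_sum, Finset.mul_sum]
    refine Int.sum fun i _ => ?_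
    rw [Derivation.leibniz, hδq, smul_eq_mul, smul_eq_mul, mul_add]
    refine Int.add ?_ ?_
    · rw [mul_left_comm]
      exact (Int.aeval hτ.le _).mul (hN i)
    · exact (Int.pow hτ.le N).mul ((hInt i).mul (Int.aeval hτ.le _))
  refine ⟨N, fun x hx => ?_⟩
  obtain ⟨q, hq, hqx⟩ := hc.exists_denom x
  obtain ⟨q', hq', hdvd⟩ := q.exists_eq_pow_rootMultiplicity_mul_and_not_dvd hq 0
  set k := q.rootMultiplicity 0
  rw [C_0, sub_zero] at hq' hdvd
  rw [X_dvd_iff] at hdvd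
  obtain ⟨y, hy, hy1, hy2, -⟩ := hc.approx v hτ (k + 1) k.succ_pos
  have hy0 : v.ord y = 0 := ord_eq_zero_of_int hτ k.succ_pos hy1
  have hyne : y ≠ 0 := by
    rintro rfl
    have h2 : (0 : K) - 1 ≠ 0 := by simp
    rw [int_div_iff h2 (pow_ne_zero _ hτ0), ord_pow, zero_sub, ord_neg, ord_one] at hy1
    push_cast at hy1
    nlinarith
  have hq'ne : aeval τ q' ≠ 0 := fun h => ht ⟨q', by rintro rfl; simp at hdvd, h⟩
  -- `b` is a unit at `v` and cancels the poles of `x` at the other places where `τ` is regular. The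
  -- product rule carries the bounds for `b * x` and `b` over to `x`.
  set b := y * aeval τ q' with hb
  have hbne : b ≠ 0 := mul_ne_zero hyne hq'ne
  have hb0 : v.ord b = 0 := by rw [hb, v.ord_mul hyne hq'ne, hy0, ord_aeval hτ hdvd, add_zero]
  have hbM : IntAway τ b := fun w hw => (hy w hw).mul (hw.aeval _)
  have hbx : IntAway τ (b * x) := by
    intro w hw
    by_cases hwv : w = v
    · subst hwv; exact (hbM w hw).mul hx
    have hqx' := hqx w hw
    rw [hq', map_mul, map_pow, aeval_X] at hqx'
    rcases lt_or_eq_of_le hw with hlt | heq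
    · have e1 : b * x = y / τ ^ (k + 1) * (τ * (τ ^ k * aeval τ q' * x)) := by
        rw [hb]; field_simp; ring
      rw [e1]
      exact (hy2 w hwv hlt).mul (Int.mul hw hqx')
    · have e1 : b * x = y * (τ ^ k)⁻¹ * (τ ^ k * aeval τ q' * x) := by
        rw [hb]; field_simp
      rw [e1]
      refine ((hy w hw).mul ?_).mul hqx'
      unfold Int
      rw [ord_inv, ord_pow, ← heq, mul_zero, neg_zero]
  have e : τ ^ N * δ x = b⁻¹ * (τ ^ N * δ (b * x) - x * (τ ^ N * δ b)) := by
    rw [Derivation.leibniz, smul_eq_mul, smul_eq_mul]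
    field_simp
    ring
  rw [e]
  refine Int.mul ?_ ((hM _ hbx).sub (hx.mul (hM _ hbM)))
  unfold Int
  rw [ord_inv, hb0, neg_zero]

/-- The derivation with respect to a uniformizer preserves the valuation ring. -/
lemma int_derivation (hτ : v.ord τ = 1) (hδ : δ τ = 1) {x : K} (hx : v.Int x) : v.Int (δ x) := by
  obtain ⟨N, hN⟩ := exists_bound_derivation (v := v) (by omega) hδ
  have hτ0 : τ ≠ 0 := ne_zero_of_ord (v := v) (by omega)
  induction N with
  | zero => simpa using hN x hx
  | succ N ih =>
    -- The bound improves by one: for `x = c + τ * g` one has `δ x = g + τ * δ g`, so the bound `N +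
    -- 1` for `g` gives the bound `N` for `x`.
    refine ih fun x hx => ?_
    obtain ⟨c, hc⟩ := v.exists_residue hx
    have hg : v.Int ((x - algebraMap ℂ K c) / τ) := by
      by_cases h0 : x - algebraMap ℂ K c = 0
      · rw [h0, zero_div]; exact v.int_zero
      · have := hc.resolve_left h0
        rw [int_div_iff h0 hτ0]
        omega
    have hτint : v.Int τ := by unfold Int; omega
    have e : τ ^ N * δ x = τ ^ N * ((x - algebraMap ℂ K c) / τ) +
        τ ^ (N + 1) * δ ((x - algebraMap ℂ K c) / τ) := by
      have h1 : x = algebraMap ℂ K c + τ * ((x - algebraMap ℂ K c) / τ) := by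
        field_simp; ring
      conv_lhs => rw [h1]
      rw [map_add, Derivation.map_algebraMap, Derivation.leibniz, hδ, smul_eq_mul, smul_eq_mul]
      ring
    rw [e]
    exact ((hτint.pow N).mul hg).add (hN _ hg)

/-- For `x = τ ^ n * u` with `u` a unit, the term `n * τ ^ (n - 1) * u` of the derivative dominates,
as `n ≠ 0` in `ℂ`. -/
lemma ord_derivation (hτ : v.ord τ = 1) (hδ : δ τ = 1) {x : K} (hx : v.ord x ≠ 0) :
    v.ord (δ x) = v.ord x - 1 := by
  have hτ0 : τ ≠ 0 := ne_zero_of_ord (v := v) (by omega)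
  have hx0 : x ≠ 0 := ne_zero_of_ord hx
  set n := v.ord x with hn
  set u := x / τ ^ n with hu
  have hu0 : v.ord u = 0 := by
    rw [hu, v.ord_div hx0 (zpow_ne_zero _ hτ0), ord_zpow, hτ, ← hn]
    ring
  have hune : u ≠ 0 := div_ne_zero hx0 (zpow_ne_zero _ hτ0)
  have hδu : v.Int (δ u) := int_derivation hτ hδ hu0.ge
  have hpow : δ (τ ^ n) = algebraMap ℂ K n * τ ^ (n - 1) := by
    rw [Derivation.leibniz_zpow, hδ]
    simp
  have e : δ x = algebraMap ℂ K n * τ ^ (n - 1) * u + τ ^ n * δ u := by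
    have h1 : x = τ ^ n * u := by rw [hu]; field_simp
    conv_lhs => rw [h1]
    rw [Derivation.leibniz, hpow, smul_eq_mul, smul_eq_mul]
    ring
  have hnne : algebraMap ℂ K n ≠ 0 := by
    rw [_root_.map_ne_zero]
    exact_mod_cast hx
  have h1 : v.ord (algebraMap ℂ K n * τ ^ (n - 1) * u) = n - 1 := by
    rw [v.ord_mul (mul_ne_zero hnne (zpow_ne_zero _ hτ0)) hune,
      v.ord_mul hnne (zpow_ne_zero _ hτ0), v.ord_const, ord_zpow, hτ, hu0]
    ring
  rw [e, ord_add_eq_left (mul_ne_zero (mul_ne_zero hnne (zpow_ne_zero _ hτ0)) hune), h1]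
  by_cases hz : δ u = 0
  · left; rw [hz, mul_zero]
  right
  unfold Int at hδu
  rw [h1, v.ord_mul (zpow_ne_zero _ hτ0) hz, ord_zpow, hτ]
  omega

/-- The order of a differential form at a place. -/
def formOrd (v : Place K) (ω : Ω[K⁄ℂ]) : ℤ :=
  Classical.epsilon fun m : ℤ => ∃ t g : K,
    v.ord t = 1 ∧ ω = g • KaehlerDifferential.D ℂ K t ∧ v.ord g = m

lemma exists_derivation (hτ : v.ord τ = 1) : ∃ (E : Ω[K⁄ℂ] ≃ₗ[K] K) (δ : Derivation ℂ K K),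
    δ τ = 1 ∧ ∀ x, E (KaehlerDifferential.D ℂ K x) = δ x := by
  obtain ⟨E, hE⟩ := exists_form_equiv (transcendental_of_ord (v := v) (x := τ) (by omega))
  exact ⟨E, E.toLinearMap.compDer (KaehlerDifferential.D ℂ K), hE, fun x => rfl⟩

/-- The uniformizer picked in the definition does not matter: `δ t` has order `0` for every other
uniformizer `t`. -/
lemma formOrd_smul_uniformizer (hτ : v.ord τ = 1) (g : K) :
    v.formOrd (g • KaehlerDifferential.D ℂ K τ) = v.ord g := by
  have hspec : ∃ t g' : K, v.ord t = 1 ∧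
      g • KaehlerDifferential.D ℂ K τ = g' • KaehlerDifferential.D ℂ K t ∧
        v.ord g' = v.formOrd (g • KaehlerDifferential.D ℂ K τ) :=
    Classical.epsilon_spec (p := fun m : ℤ => ∃ t g' : K, v.ord t = 1 ∧
      g • KaehlerDifferential.D ℂ K τ = g' • KaehlerDifferential.D ℂ K t ∧ v.ord g' = m)
      ⟨v.ord g, τ, g, hτ, rfl, rfl⟩
  obtain ⟨t, g', ht, h, h'⟩ := hspec
  rw [← h']
  obtain ⟨E, δ, hδ, hE⟩ := exists_derivation hτ
  have h1 := congrArg E h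
  rw [map_smul, map_smul, hE, hE, hδ, smul_eq_mul, smul_eq_mul, mul_one] at h1
  have h2 : v.ord (δ t) = 0 := by rw [ord_derivation hτ hδ (by omega), ht]; rfl
  rw [h1]
  by_cases hg' : g' = 0
  · rw [hg', zero_mul]
  have h3 : δ t ≠ 0 := by
    intro h0
    have := ht ▸ ord_derivation hτ hδ (x := t) (by omega)
    obtain ⟨E', δ', hδ', hE'⟩ := exists_derivation ht
    rw [← hE, map_eq_zero_iff E E.injective] at h0
    exact D_ne_zero (transcendental_of_ord (v := v) (x := t) (by omega)) h0
  rw [v.ord_mul hg' h3, h2, add_zero]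

lemma formOrd_smul_D (v : Place K) {x : K} (hx : v.ord x ≠ 0) {g : K} (hg : g ≠ 0) :
    v.formOrd (g • KaehlerDifferential.D ℂ K x) = v.ord g + v.ord x - 1 := by
  obtain ⟨τ, hτ⟩ := v.exists_uniformizer
  obtain ⟨E, δ, hδ, hE⟩ := exists_derivation hτ
  have h1 : KaehlerDifferential.D ℂ K x = δ x • KaehlerDifferential.D ℂ K τ := by
    apply E.injective
    rw [map_smul, hE, hE, hδ, smul_eq_mul, mul_one]
  have h2 : δ x ≠ 0 := by
    intro h0
    rw [h0, zero_smul] at h1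
    exact D_ne_zero (transcendental_of_ord hx) h1
  rw [h1, smul_smul, formOrd_smul_uniformizer hτ, v.ord_mul hg h2, ord_derivation hτ hδ hx]
  ring

lemma formOrd_smul (v : Place K) {g : K} (hg : g ≠ 0) {ω : Ω[K⁄ℂ]} (hω : ω ≠ 0) :
    v.formOrd (g • ω) = v.ord g + v.formOrd ω := by
  obtain ⟨τ, hτ⟩ := v.exists_uniformizer
  obtain ⟨f, rfl⟩ := exists_eq_smul_D (transcendental_of_ord (v := v) (x := τ) (by omega)) ω
  have hf : f ≠ 0 := by rintro rfl; simp at hω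
  rw [smul_smul, formOrd_smul_uniformizer hτ, formOrd_smul_uniformizer hτ, v.ord_mul hg hf]

end Place

/-- The functions `t - c` have different zeros for different `c`. Infinitely many places leave room
for the extra points of a complement. -/
instance : Infinite (Place K) := by
  obtain ⟨t, ht⟩ := exists_transcendental K
  choose f hf using fun c : ℂ => (isCovering (transcendental_sub_const ht c) rfl).exists_zero
  refine Infinite.of_injective f fun a b hab => ?_
  by_contra hne
  have ha := hf a
  have hb := hf b
  rw [← hab] at hb
  have h1 := (f a).ord_pos_add (Or.inr ha) (Or.inr ((f a).ord_neg _ ▸ hb))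
  have h2 : t - algebraMap ℂ K a + -(t - algebraMap ℂ K b) = algebraMap ℂ K (b - a) := by
    rw [map_sub]; ring
  rw [h2, (f a).ord_const, map_eq_zero] at h1
  rcases h1 with h1 | h1
  · exact hne (sub_eq_zero.1 h1).symm
  · exact lt_irrefl _ h1

/-- Every divisor of degree zero on a rational curve is principal. -/
lemma exists_ord_eq_of_simple_pole {u : K} {v₀ : Place K} (hu : v₀.ord u = -1)
    (hint : ∀ v, v ≠ v₀ → v.Int u) :
    (∀ v, v ≠ v₀ → ∃ c, v.ord (u - algebraMap ℂ K c) = 1 ∧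
      ∀ w, w ≠ v₀ → w ≠ v → w.ord (u - algebraMap ℂ K c) = 0) ∧
    ∀ (s : Finset (Place K)) (D : Place K → ℤ), (∀ v, v ∉ s → D v = 0) → ∑ v ∈ s, D v = 0 →
      ∃ φ : K, φ ≠ 0 ∧ ∀ v, v.ord φ = D v := by
  classical
  have ht := Place.transcendental_of_ord (v := v₀) (x := u) (by omega)
  have hord0 : ∀ c : ℂ, v₀.ord (u - algebraMap ℂ K c) = -1 := by
    intro c
    rw [sub_eq_add_neg, Place.ord_add_eq_left (Place.ne_zero_of_ord (v := v₀) (by omega)), hu]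
    right
    rw [Place.ord_neg, v₀.ord_const]
    omega
  have key : ∀ v, v ≠ v₀ → ∃ c, v.ord (u - algebraMap ℂ K c) = 1 ∧
      ∀ w, w ≠ v₀ → w ≠ v → w.ord (u - algebraMap ℂ K c) = 0 := by
    intro v hv
    obtain ⟨c, hc⟩ := v.exists_residue (hint v hv)
    have h0 : u - algebraMap ℂ K c ≠ 0 := Place.ne_zero_of_ord (v := v₀) (by rw [hord0]; omega)
    have hpos := hc.resolve_left h0
    set f := u - algebraMap ℂ K c with hf
    have hnn : ∀ w, w ≠ v₀ → 0 ≤ w.ord f := fun w hw => (hint w hw).sub (w.int_const c)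
    -- The divisor of `f` has degree `0` and its only pole is simple, so the zero at `v` is simple
    -- and there is no other.
    have hsum := Place.finsum_ord f
    rw [finsum_eq_sum _ (Place.finite_support f)] at hsum
    set T := (Place.finite_support f).toFinset with hT
    have hv0T : v₀ ∈ T := by
      rw [hT, Set.Finite.mem_toFinset, Function.mem_support, hord0]; omega
    have hvT : v ∈ T.erase v₀ := by
      rw [Finset.mem_erase, hT, Set.Finite.mem_toFinset, Function.mem_support]
      exact ⟨hv, hpos.ne'⟩
    rw [← Finset.add_sum_erase _ _ hv0T, hord0, ← Finset.add_sum_erase _ _ hvT] at hsum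
    have h3 : ∀ w ∈ (T.erase v₀).erase v, 0 ≤ w.ord f := fun w hw =>
      hnn w (Finset.ne_of_mem_erase (Finset.mem_of_mem_erase hw))
    have h4 := Finset.sum_nonneg h3
    have h5 : ∑ w ∈ (T.erase v₀).erase v, w.ord f = 0 := by omega
    refine ⟨c, by rw [← hf]; omega, fun w hw0 hwv => ?_⟩
    by_cases hwT : w ∈ T
    · exact (Finset.sum_eq_zero_iff_of_nonneg h3).1 h5 w
        (Finset.mem_erase.2 ⟨hwv, Finset.mem_erase.2 ⟨hw0, hwT⟩⟩)
    · simpa [hT] using hwT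
  refine ⟨key, fun s D hD hs => ?_⟩
  choose! c hc1 hc2 using key
  have hne : ∀ c : ℂ, u - algebraMap ℂ K c ≠ 0 := fun c =>
    Place.ne_zero_of_ord (v := v₀) (by rw [hord0]; omega)
  -- The function is the product of `(u - c v) ^ D v` over `v ≠ v₀`; its order at `v₀` is right
  -- because `D` has degree `0`.
  have hprod : ∀ (T : Finset (Place K)) (w : Place K),
      (∏ v ∈ T, (u - algebraMap ℂ K (c v)) ^ D v) ≠ 0 ∧
      w.ord (∏ v ∈ T, (u - algebraMap ℂ K (c v)) ^ D v) =
        ∑ v ∈ T, D v * w.ord (u - algebraMap ℂ K (c v)) := by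
    intro T w
    induction T using Finset.induction with
    | empty => simp [w.ord_one]
    | insert a T ha ih =>
      rw [Finset.prod_insert ha, Finset.sum_insert ha]
      have h1 := zpow_ne_zero (D a) (hne (c a))
      exact ⟨mul_ne_zero h1 ih.1, by rw [w.ord_mul h1 ih.1, Place.ord_zpow, ih.2]⟩
  refine ⟨_, (hprod (s.erase v₀) v₀).1, fun w => ?_⟩
  rw [(hprod (s.erase v₀) w).2]
  by_cases hw : w = v₀
  · subst hw
    rw [Finset.sum_congr rfl fun v _ => by rw [hord0]]
    simp only [mul_neg, mul_one, Finset.sum_neg_distrib]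
    by_cases hw : w ∈ s
    · rw [← Finset.add_sum_erase _ _ hw] at hs
      omega
    · rw [Finset.erase_eq_of_notMem hw, hs, hD w hw, neg_zero]
  · by_cases hws : w ∈ s
    · rw [Finset.sum_eq_single w, hc1 w hw, mul_one]
      · intro v hv hvw
        rw [hc2 v (Finset.ne_of_mem_erase hv) w hw hvw.symm, mul_zero]
      · intro h
        exact absurd (Finset.mem_erase.2 ⟨hw, hws⟩) h
    · rw [hD w hws]
      refine Finset.sum_eq_zero fun v hv => ?_
      rw [hc2 v (Finset.ne_of_mem_erase hv) w hw, mul_zero]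
      rintro rfl
      exact hws (Finset.mem_of_mem_erase hv)

variable (K) in
/-- Either the curve carries a regular differential form, or it is rational. -/
theorem exists_regular_form_or_rational :
    (∃ ω : Ω[K⁄ℂ], ω ≠ 0 ∧ ∀ v : Place K, 0 ≤ v.formOrd ω) ∨
    ∃ (ω : Ω[K⁄ℂ]) (v₀ : Place K), ω ≠ 0 ∧ v₀.formOrd ω = -2 ∧ (∀ v, v ≠ v₀ → v.formOrd ω = 0) ∧
      ∀ (s : Finset (Place K)) (D : Place K → ℤ), (∀ v, v ∉ s → D v = 0) → ∑ v ∈ s, D v = 0 →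
        ∃ φ : K, φ ≠ 0 ∧ ∀ v, v.ord φ = D v := by
  have hD : ∀ (u : K) (c : ℂ), KaehlerDifferential.D ℂ K (u - algebraMap ℂ K c) =
      KaehlerDifferential.D ℂ K u := fun u c => by
    rw [map_sub, Derivation.map_algebraMap, sub_zero]
  rcases exists_regular_or_simple_pole K with ⟨t, f, ht, hf, h1, h2⟩ | ⟨u, v₀, hu, hint⟩
  · refine Or.inl ⟨f • KaehlerDifferential.D ℂ K t, smul_ne_zero hf (D_ne_zero ht), fun v => ?_⟩
    by_cases hv : v.Int t
    · obtain ⟨c, hc⟩ := v.exists_residue hv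
      have hne : t - algebraMap ℂ K c ≠ 0 := fun h =>
        transcendental_sub_const ht c (h ▸ isAlgebraic_zero)
      have hc := hc.resolve_left hne
      rw [← hD t c, v.formOrd_smul_D hc.ne' hf]
      have := h1 v c hc
      omega
    · unfold Place.Int at hv
      rw [v.formOrd_smul_D (by omega) hf]
      have := h2 v (by omega)
      omega
  · obtain ⟨h1, h2⟩ := exists_ord_eq_of_simple_pole hu hint
    refine Or.inr ⟨KaehlerDifferential.D ℂ K u, v₀,
      D_ne_zero (Place.transcendental_of_ord (v := v₀) (by omega)), ?_, fun v hv => ?_, h2⟩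
    · have := v₀.formOrd_smul_D (x := u) (by omega) one_ne_zero
      rw [one_smul, v₀.ord_one, hu] at this
      rw [this]; rfl
    · obtain ⟨c, hc, -⟩ := h1 v hv
      have := v.formOrd_smul_D (x := u - algebraMap ℂ K c) (by omega) one_ne_zero
      rw [one_smul, v.ord_one, hc, hD] at this
      rw [this]; rfl

end
end EpsComplement

namespace EpsComplement
noncomputable section

/-! ### The local rings of a normal variety in codimension one -/

namespace Variety

variable {X : Variety}

lemma IsNormal.isDiscreteValuationRing (hN : X.IsNormal) (P : X.PrimeDivisor) :
    IsDiscreteValuationRing (X.toScheme.presheaf.stalk P.1) := by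
  have hdim := ringKrullDim_stalk_eq_coheight P.1
  rw [P.2] at hdim
  have hle : Ring.KrullDimLE 1 (X.toScheme.presheaf.stalk P.1) := krullDimLE_of_coheight_le P.2.le
  have hnf : ¬ IsField (X.toScheme.presheaf.stalk P.1) := by
    intro h
    rw [ringKrullDim_eq_zero_of_isField h] at hdim
    exact absurd hdim (by decide)
  haveI := hN P.1
  have htfae : IsDiscreteValuationRing (X.toScheme.presheaf.stalk P.1) ↔
      IsIntegrallyClosed (X.toScheme.presheaf.stalk P.1) ∧
        ∃! P : Ideal (X.toScheme.presheaf.stalk P.1), P ≠ ⊥ ∧ P.IsPrime :=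
    (IsDiscreteValuationRing.TFAE _ hnf).out 0 3
  refine htfae.2 ⟨inferInstance, IsLocalRing.maximalIdeal _, ⟨fun h => hnf ?_, inferInstance⟩,
    fun I hI => ?_⟩
  · rwa [IsLocalRing.isField_iff_maximalIdeal_eq]
  · haveI := hI.2
    exact IsLocalRing.eq_maximalIdeal (Ideal.isMaximal_of_isPrime_of_ne_bot I hI.1)

lemma ord_const (c : ℂ) (x : X.toScheme) : X.toScheme.ord (algebraMap ℂ X.K c) x = 0 := by
  by_cases hc : c = 0
  · rw [hc, map_zero, Scheme.ord_zero]; rfl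
  have hu : IsUnit (((Scheme.ΓSpecIso (CommRingCat.of ℂ)).inv ≫ X.str.appTop).hom c) :=
    (isUnit_iff_ne_zero.2 hc).map _
  haveI : Nonempty (⊤ : X.toScheme.Opens) := ⟨⟨genericPoint X.toScheme, trivial⟩⟩
  exact Scheme.ord_of_isUnit (X := X.toScheme) (U := ⊤) hu (x := x) trivial

lemma ord_algebraMap_nonneg (P : X.PrimeDivisor) (r : X.toScheme.presheaf.stalk P.1) :
    0 ≤ X.toScheme.ord (algebraMap _ X.K r) P.1 := by
  by_cases hr : r = 0
  · rw [hr, map_zero, Scheme.ord_zero]; rfl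
  haveI : Ring.KrullDimLE 1 (X.toScheme.presheaf.stalk P.1) := krullDimLE_of_coheight_le P.2.le
  rw [Scheme.le_ord_iff P.2 (by simpa using hr)]
  exact Ring.ordFrac_ge_one_of_ne_zero hr

lemma IsNormal.ord_irreducible (hN : X.IsNormal) (P : X.PrimeDivisor)
    {ϖ : X.toScheme.presheaf.stalk P.1} (hϖ : Irreducible ϖ) :
    X.toScheme.ord (algebraMap _ X.K ϖ) P.1 = 1 := by
  haveI := hN.isDiscreteValuationRing P
  rw [Scheme.ord_eq_iff P.2 (by simpa using hϖ.ne_zero)]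
  exact Ring.ordFrac_irreducible hϖ

/-- The place defined by a prime divisor. -/
def place (hN : X.IsNormal) (P : X.PrimeDivisor) : Place X.K where
  ord f := X.toScheme.ord f P.1
  ord_zero := by rw [Scheme.ord_zero]; rfl
  ord_mul := Scheme.ord_mul
  ord_add h := by
    haveI := hN.isDiscreteValuationRing P
    exact Scheme.ord_add h
  ord_const c := ord_const c P.1
  exists_uniformizer := by
    haveI := hN.isDiscreteValuationRing P
    obtain ⟨ϖ, hϖ⟩ := IsDiscreteValuationRing.exists_irreducible (X.toScheme.presheaf.stalk P.1)
    exact ⟨_, hN.ord_irreducible P hϖ⟩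

lemma place_ord (hN : X.IsNormal) (P : X.PrimeDivisor) (f : X.K) :
    (place hN P).ord f = X.toScheme.ord f P.1 := rfl

/-- If `f` is not in the discrete valuation ring, then `f⁻¹` is divisible by a uniformizer, so `f`
has a pole. -/
lemma int_place_iff (hN : X.IsNormal) (P : X.PrimeDivisor) (f : X.K) :
    (place hN P).Int f ↔ f ∈ (algebraMap (X.toScheme.presheaf.stalk P.1) X.K).range := by
  refine ⟨fun h => ?_, ?_⟩
  · haveI := hN.isDiscreteValuationRing P
    by_cases hf : f = 0
    · exact ⟨0, by rw [hf, map_zero]⟩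
    rcases ValuationRing.isInteger_or_isInteger (X.toScheme.presheaf.stalk P.1) f with h' | ⟨r, hr⟩
    · exact h'
    by_cases hu : IsUnit r
    · obtain ⟨u, rfl⟩ := hu
      refine ⟨(u⁻¹ : (X.toScheme.presheaf.stalk P.1)ˣ), ?_⟩
      rw [← inv_inv f, ← hr]
      simp
    · exfalso
      obtain ⟨ϖ, hϖ⟩ := IsDiscreteValuationRing.exists_irreducible
        (X.toScheme.presheaf.stalk P.1)
      have hr' : r ∈ IsLocalRing.maximalIdeal (X.toScheme.presheaf.stalk P.1) := hu
      rw [hϖ.maximalIdeal_eq, Ideal.mem_span_singleton] at hr'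
      obtain ⟨s, rfl⟩ := hr'
      have hs : s ≠ 0 := by
        rintro rfl
        rw [mul_zero, map_zero, eq_comm, inv_eq_zero] at hr
        exact hf hr
      have h1 := hN.ord_irreducible P hϖ
      have h2 := ord_algebraMap_nonneg P s
      have h3 : X.toScheme.ord f⁻¹ P.1 =
          X.toScheme.ord (algebraMap _ X.K ϖ) P.1 + X.toScheme.ord (algebraMap _ X.K s) P.1 := by
        rw [← hr, map_mul, Scheme.ord_mul (by simpa using hϖ.ne_zero) (by simpa using hs)]
      have h4 := (place hN P).ord_inv f
      rw [place_ord, place_ord] at h4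
      unfold Place.Int at h
      rw [place_ord] at h
      omega
  · rintro ⟨r, rfl⟩
    exact ord_algebraMap_nonneg P r

end Variety

section Pullback

variable {X Y : Variety} (f : Y.toScheme ⟶ X.toScheme) [IsDominant f]

lemma pullbackHom_algebraMap (y : Y.toScheme) (r : X.toScheme.presheaf.stalk (f y)) :
    (pullbackHom f).hom (algebraMap _ X.K r) = algebraMap _ Y.K ((f.stalkMap y).hom r) := by
  have h : X.toScheme.presheaf.stalkSpecializes
      ((genericPoint_spec X.toScheme).specializes trivial) ≫ pullbackHom f =
      f.stalkMap y ≫ Y.toScheme.presheaf.stalkSpecializes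
        ((genericPoint_spec Y.toScheme).specializes trivial) := by
    rw [pullbackHom, TopCat.Presheaf.stalkSpecializes_comp_assoc,
      Scheme.Hom.stalkSpecializes_stalkMap]
  exact congrArg (fun h => h.hom r) h

end Pullback

namespace Place

variable {K L : Type*} [Field K] [Field L] [Algebra ℂ K] [Algebra ℂ L]

/-- Restriction of a place along an isomorphism of fields. -/
def comap (σ : K →ₐ[ℂ] L) (hσ : Function.Bijective σ) (w : Place L) : Place K where
  ord x := w.ord (σ x)
  ord_zero := by rw [map_zero, w.ord_zero]
  ord_mul hx hy := by
    rw [map_mul, w.ord_mul (by simpa using hx) (by simpa using hy)]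
  ord_add h := by
    rw [map_add]
    exact w.ord_add (by rwa [← map_add, ne_eq, map_eq_zero])
  ord_const c := by rw [σ.commutes, w.ord_const]
  exists_uniformizer := by
    obtain ⟨τ, hτ⟩ := w.exists_uniformizer
    obtain ⟨x, rfl⟩ := hσ.2 τ
    exact ⟨x, hτ⟩

end Place

lemma formMap_smul_D {K L : Type} [Field K] [Field L] [Algebra ℂ K] [Algebra ℂ L] (σ : K →ₐ[ℂ] L)
    (g t : K) : formMap σ (g • KaehlerDifferential.D ℂ K t) =
      σ g • KaehlerDifferential.D ℂ L (σ t) := by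
  letI : Algebra K L := σ.toRingHom.toAlgebra
  haveI : IsScalarTower ℂ K L := IsScalarTower.of_algebraMap_eq fun c => (σ.commutes c).symm
  change KaehlerDifferential.map ℂ ℂ K L _ = _
  rw [map_smul, KaehlerDifferential.map_D, ← algebraMap_smul L g]
  rfl

end
end EpsComplement

namespace EpsComplement
noncomputable section

open scoped nonZeroDivisors

/-! ### The function field of a curve -/

/-- Noether normalization: `A` is finite over a polynomial ring in `s` variables. For `s = 0` it
would be a field; for `s ≥ 2` a prime over `(X i)` would be nonzero and not maximal. -/
lemma trdeg_eq_one {A K : Type} [CommRing A] [IsDomain A] [Algebra ℂ A] [Algebra.FiniteType ℂ A]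
    [Ring.KrullDimLE 1 A] (hA : ¬ IsField A) [Field K] [Algebra A K] [IsFractionRing A K]
    [Algebra ℂ K] [IsScalarTower ℂ A K] : Algebra.trdeg ℂ K = 1 := by
  obtain ⟨s, g, hg, hfin⟩ := exists_finite_inj_algHom_of_fg ℂ A
  letI : Algebra (MvPolynomial (Fin s) ℂ) A := g.toRingHom.toAlgebra
  haveI : IsScalarTower ℂ (MvPolynomial (Fin s) ℂ) A := .of_algebraMap_eq fun c =>
    (g.commutes c).symm
  haveI : Module.Finite (MvPolynomial (Fin s) ℂ) A := hfin
  haveI : FaithfulSMul (MvPolynomial (Fin s) ℂ) A := (faithfulSMul_iff_algebraMap_injective _ _).2 hg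
  have hs : s = 1 := by
    by_contra hs1
    rcases Nat.lt_or_gt_of_ne hs1 with h | h
    · obtain rfl : s = 0 := by omega
      refine hA (isField_of_isIntegral_of_isField' (R := MvPolynomial (Fin 0) ℂ) ?_)
      exact (MvPolynomial.isEmptyRingEquiv ℂ (Fin 0)).toMulEquiv.isField (Field.toIsField ℂ)
    · let i : Fin s := ⟨0, by omega⟩
      let j : Fin s := ⟨1, by omega⟩
      have hij : i ≠ j := by simp [i, j]
      let P : Ideal (MvPolynomial (Fin s) ℂ) := Ideal.span {MvPolynomial.X i}
      haveI hP : P.IsPrime := (Ideal.span_singleton_prime (MvPolynomial.X_ne_zero i)).2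
        MvPolynomial.X_prime
      obtain ⟨Q, -, hQ, hQP⟩ := Ideal.exists_ideal_over_prime_of_isIntegral P (⊥ : Ideal A) (by
        rw [Ideal.comap_bot_of_injective _ (FaithfulSMul.algebraMap_injective _ A)]
        exact bot_le)
      have hQ0 : Q ≠ ⊥ := by
        rintro rfl
        rw [Ideal.comap_bot_of_injective _ (FaithfulSMul.algebraMap_injective _ A), eq_comm,
          Ideal.span_singleton_eq_bot] at hQP
        exact MvPolynomial.X_ne_zero i hQP
      haveI := Ideal.isMaximal_of_isPrime_of_ne_bot Q hQ0
      have hPmax : P.IsMaximal := hQP ▸ Ideal.isMaximal_comap_of_isIntegral_of_isMaximal Q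
      let f : MvPolynomial (Fin s) ℂ →+* ℂ := MvPolynomial.constantCoeff
      have hle : P ≤ RingHom.ker f := by
        rw [Ideal.span_singleton_le_iff_mem, RingHom.mem_ker]
        simp [f]
      have heq := hPmax.eq_of_le (RingHom.ker_ne_top f) hle
      have hj : MvPolynomial.X j ∈ P := by
        rw [heq, RingHom.mem_ker]
        simp [f]
      rw [Ideal.mem_span_singleton, MvPolynomial.X_dvd_X] at hj
      simp [i, j] at hj
  subst hs
  letI : Algebra (MvPolynomial (Fin 1) ℂ) K :=
    ((algebraMap A K).comp (algebraMap (MvPolynomial (Fin 1) ℂ) A)).toAlgebra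
  haveI : IsScalarTower (MvPolynomial (Fin 1) ℂ) A K := .of_algebraMap_eq fun _ => rfl
  haveI : IsScalarTower ℂ (MvPolynomial (Fin 1) ℂ) K := .of_algebraMap_eq fun c => by
    rw [IsScalarTower.algebraMap_apply ℂ A K,
      IsScalarTower.algebraMap_apply ℂ (MvPolynomial (Fin 1) ℂ) A]
    rfl
  haveI : Algebra.IsAlgebraic A K := IsLocalization.isAlgebraic K A⁰
  haveI : Algebra.IsAlgebraic (MvPolynomial (Fin 1) ℂ) K := .trans _ A _
  haveI : FaithfulSMul (MvPolynomial (Fin 1) ℂ) K := (faithfulSMul_iff_algebraMap_injective _ _).2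
    ((IsFractionRing.injective A K).comp hg)
  rw [← _root_.trdeg_add_eq ℂ (MvPolynomial (Fin 1) ℂ) (A := K),
    _root_.trdeg_eq_zero (R := MvPolynomial (Fin 1) ℂ) (A := K), add_zero,
    MvPolynomial.trdeg_of_isDomain]
  simp

namespace Variety

variable {X : Variety}

lemma finiteType_algebraMap {U : X.toScheme.Opens} (hU : IsAffineOpen U) :
    ((Scheme.ΓSpecIso (CommRingCat.of ℂ)).inv ≫ X.str.appLE ⊤ U le_top).hom.FiniteType := by
  haveI := X.locallyOfFiniteType
  have h := X.str.finiteType_appLE (isAffineOpen_top _) hU le_top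
  rw [CommRingCat.hom_comp]
  refine h.comp (RingHom.FiniteType.of_surjective _ ?_)
  exact (ConcreteCategory.bijective_of_isIso (Scheme.ΓSpecIso (CommRingCat.of ℂ)).inv).2

lemma exists_ne_genericPoint (hX : topologicalKrullDim X.toScheme = 1) :
    ∃ x : X.toScheme, x ≠ genericPoint X.toScheme := by
  by_contra! h
  haveI : Subsingleton X.toScheme := ⟨fun a b => (h a).trans (h b).symm⟩
  have := topologicalKrullDim_zero_of_discreteTopology X.toScheme
  rw [hX] at this
  exact absurd this (by decide)

lemma krullDimLE_of_affine (hX : topologicalKrullDim X.toScheme = 1) {U : X.toScheme.Opens}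
    (hU : IsAffineOpen U) : Ring.KrullDimLE 1 Γ(X.toScheme, U) := by
  rw [Ring.KrullDimLE, Order.krullDimLE_iff, ← ringKrullDim,
    ← PrimeSpectrum.topologicalKrullDim_eq_ringKrullDim Γ(X.toScheme, U)]
  change topologicalKrullDim (Spec Γ(X.toScheme, U)) ≤ 1
  rw [← IsHomeomorph.topologicalKrullDim_eq _ hU.isoSpec.hom.homeomorph.isHomeomorph]
  exact (topologicalKrullDim_subspace_le X.toScheme U).trans hX.le

lemma not_isField_of_affine {U : X.toScheme.Opens} (hU : IsAffineOpen U) {x : X.toScheme}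
    (hx : x ∈ U) (hne : x ≠ genericPoint X.toScheme) : ¬ IsField Γ(X.toScheme, U) := by
  intro h
  letI := h.toField
  haveI : Subsingleton (Spec Γ(X.toScheme, U)) :=
    inferInstanceAs (Subsingleton (PrimeSpectrum Γ(X.toScheme, U)))
  have hη : genericPoint X.toScheme ∈ U :=
    ((genericPoint_spec X.toScheme).mem_open_set_iff U.isOpen).2 ⟨x, trivial, hx⟩
  have h1 := hU.isoSpec.hom.homeomorph.injective
    (Subsingleton.elim (hU.isoSpec.hom.homeomorph ⟨x, hx⟩) (hU.isoSpec.hom.homeomorph ⟨_, hη⟩))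
  exact hne (congrArg Subtype.val h1)

theorem isCurveField (hX : topologicalKrullDim X.toScheme = 1) : IsCurveField X.K := by
  obtain ⟨x, hx⟩ := exists_ne_genericPoint hX
  obtain ⟨U, hU, hxU, -⟩ := exists_isAffineOpen_mem_and_subset (U := ⊤) (x := x) trivial
  haveI : Nonempty U := ⟨⟨x, hxU⟩⟩
  haveI : Nonempty (U : Scheme) := ⟨⟨x, hxU⟩⟩
  letI : Algebra ℂ Γ(X.toScheme, U) :=
    ((Scheme.ΓSpecIso (CommRingCat.of ℂ)).inv ≫ X.str.appLE ⊤ U le_top).hom.toAlgebra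
  haveI : Algebra.FiniteType ℂ Γ(X.toScheme, U) := finiteType_algebraMap hU
  haveI := functionField_isFractionRing_of_isAffineOpen X.toScheme U hU
  haveI : IsScalarTower ℂ Γ(X.toScheme, U) X.K := .of_algebraMap_eq fun c => by
    have h : X.constHom = ((Scheme.ΓSpecIso (CommRingCat.of ℂ)).inv ≫ X.str.appLE ⊤ U le_top) ≫
        X.toScheme.germToFunctionField U := by
      have hη : genericPoint X.toScheme ∈ U :=
        ((genericPoint_spec X.toScheme).mem_open_set_iff U.isOpen).2 ⟨x, trivial, hxU⟩
      have h1 : X.str.appTop ≫ X.toScheme.presheaf.map (homOfLE le_top : U ⟶ ⊤).op =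
          X.str.appLE ⊤ U le_top := by
        rw [Scheme.Hom.appTop, Scheme.Hom.app_eq_appLE]
        exact Scheme.Hom.appLE_map _ _ _
      rw [constHom, ← X.toScheme.presheaf.germ_res (homOfLE le_top : U ⟶ ⊤) _ hη, ← h1]
      simp only [Category.assoc]
    exact congrArg (fun h => h.hom c) h
  haveI := krullDimLE_of_affine hX hU
  haveI : Algebra.EssFiniteType Γ(X.toScheme, U) X.K :=
    Algebra.EssFiniteType.of_isLocalization _ (Γ(X.toScheme, U))⁰
  exact ⟨Algebra.EssFiniteType.comp ℂ Γ(X.toScheme, U) X.K,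
    trdeg_eq_one (not_isField_of_affine hU hxU hx)⟩

lemma coheight_eq_one (hX : topologicalKrullDim X.toScheme = 1) {x : X.toScheme}
    (hx : x ≠ genericPoint X.toScheme) : Order.coheight x = 1 := by
  apply le_antisymm
  · have h1 := Order.coheight_le_krullDim x
    have h2 : Order.krullDim X.toScheme ≤ topologicalKrullDim X.toScheme := by
      refine Order.krullDim_le_of_strictMono (fun x => ⟨closure {x},
        isIrreducible_singleton.closure, isClosed_closure⟩) fun a b hab => ?_
      rw [lt_iff_le_not_ge, Scheme.le_iff_specializes, Scheme.le_iff_specializes,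
        specializes_iff_closure_subset, specializes_iff_closure_subset] at hab
      exact ⟨hab.1, hab.2⟩
    have h3 := h1.trans (h2.trans hX.le)
    exact_mod_cast h3
  · rw [Order.one_le_iff_pos, Order.coheight_pos, isMax_iff_forall_not_lt]
    intro h
    refine h (genericPoint X.toScheme) (lt_iff_le_not_ge.2 ⟨genericPoint_specializes x, fun h' => ?_⟩)
    exact hx (Specializes.antisymm (Scheme.le_iff_specializes.1 h') (genericPoint_specializes x)).eq

end Variety

end
end EpsComplement

namespace EpsComplement
noncomputable section

/-! ### Places and prime divisors -/

namespace Variety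

variable {X : Variety}

lemma fromSpecStalk_str :
    X.toScheme.fromSpecStalk (genericPoint X.toScheme) ≫ X.str = Spec.map X.constHom := by
  refine ext_of_isAffine ?_
  have h := Scheme.ΓSpecIso_naturality X.constHom
  rw [Scheme.Hom.comp_appTop, Scheme.fromSpecStalk_appTop,
    ← cancel_mono (Scheme.ΓSpecIso X.toScheme.functionField).hom, h, constHom,
    Iso.hom_inv_id_assoc]
  simp only [Category.assoc]
  have h1 : (Scheme.ΓSpecIso X.toScheme.functionField).inv ≫
      (Spec X.toScheme.functionField).presheaf.map (𝟙 (Opposite.op ⊤)) ≫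
        (Scheme.ΓSpecIso X.toScheme.functionField).hom = 𝟙 _ := by
    rw [CategoryTheory.Functor.map_id, Category.id_comp, Iso.inv_hom_id]
  exact congrArg (fun g => X.str.appTop ≫ X.toScheme.presheaf.germ ⊤ (genericPoint X.toScheme)
    trivial ≫ g) h1 |>.trans (by rw [Category.comp_id])

lemma algebraMap_surjective {x : X.toScheme} (hx : x = genericPoint X.toScheme) :
    Function.Surjective (algebraMap (X.toScheme.presheaf.stalk x) X.K) := by
  subst hx
  intro f
  refine ⟨f, ?_⟩
  change (X.toScheme.presheaf.stalkSpecializes _).hom f = f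
  rw [TopCat.Presheaf.stalkSpecializes_refl]
  rfl

/-- The homomorphism from a local ring to the valuation ring of a place containing it. -/
def toValuationSubring (v : Place X.K) (x : X.toScheme)
    (h : ∀ r : X.toScheme.presheaf.stalk x, v.Int (algebraMap _ X.K r)) :
    X.toScheme.presheaf.stalk x →+* v.valuationSubring :=
  (algebraMap (X.toScheme.presheaf.stalk x) X.K).codRestrict v.valuationSubring
    fun r => Place.mem_valuationSubring.2 (h r)

/-- The constants as elements of the valuation ring of a place. -/
def constToValuationSubring (v : Place X.K) : ℂ →+* v.valuationSubring :=
  (algebraMap ℂ X.K).codRestrict v.valuationSubring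
    fun r => Place.mem_valuationSubring.2 (v.int_const r)

/-- The morphism from the spectrum of the valuation ring of a place, given that it contains the
local ring at `x`. -/
def specPlace (v : Place X.K) (x : X.toScheme)
    (h : ∀ r : X.toScheme.presheaf.stalk x, v.Int (algebraMap _ X.K r)) :
    Spec (.of v.valuationSubring) ⟶ X.toScheme :=
  Spec.map (CommRingCat.ofHom (toValuationSubring v x h)) ≫ X.toScheme.fromSpecStalk x

lemma SpecMap_specPlace (v : Place X.K) (x : X.toScheme)
    (h : ∀ r : X.toScheme.presheaf.stalk x, v.Int (algebraMap _ X.K r)) :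
    Spec.map (CommRingCat.ofHom (algebraMap v.valuationSubring X.K)) ≫ specPlace v x h =
      X.toScheme.fromSpecStalk (genericPoint X.toScheme) := by
  rw [specPlace, ← Spec.map_comp_assoc, ← Scheme.SpecMap_stalkSpecializes_fromSpecStalk
    ((genericPoint_spec X.toScheme).specializes (trivial : x ∈ (⊤ : Set X.toScheme)))]
  rfl

lemma specPlace_str (v : Place X.K) (x : X.toScheme)
    (h : ∀ r : X.toScheme.presheaf.stalk x, v.Int (algebraMap _ X.K r)) :
    specPlace v x h ≫ X.str = Spec.map (CommRingCat.ofHom (constToValuationSubring v)) := by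
  obtain ⟨φ, hφ⟩ := Spec.map_surjective (specPlace v x h ≫ X.str)
  have h1 := congrArg (· ≫ X.str) (SpecMap_specPlace v x h)
  simp only [Category.assoc] at h1
  rw [fromSpecStalk_str, ← hφ, ← Spec.map_comp] at h1
  have h2 := Spec.map_injective h1
  rw [← hφ]
  congr 1
  ext c
  exact congrArg (fun h => h.hom c) h2

/-- Separatedness. A point with place `v` is the image of the closed point under a morphism from the
spectrum of the ring of `v` that extends the generic point, and the valuative criterion makes this
morphism unique. -/
lemma place_injective (hN : X.IsNormal) : Function.Injective (place (X := X) hN) := by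
  intro P Q hPQ
  set v := place hN P with hv
  have key : ∀ R : X.PrimeDivisor, place hN R = v →
      ∃ l : Spec (.of v.valuationSubring) ⟶ X.toScheme,
        Spec.map (CommRingCat.ofHom (algebraMap v.valuationSubring X.K)) ≫ l =
          X.toScheme.fromSpecStalk (genericPoint X.toScheme) ∧
        l ≫ X.str = Spec.map (CommRingCat.ofHom (constToValuationSubring v)) ∧
        l (IsLocalRing.closedPoint v.valuationSubring) = R.1 := by
    intro R hR
    have h : ∀ r : X.toScheme.presheaf.stalk R.1, v.Int (algebraMap _ X.K r) := fun r =>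
      hR ▸ (int_place_iff hN R _).2 ⟨r, rfl⟩
    refine ⟨specPlace v R.1 h, SpecMap_specPlace v R.1 h, specPlace_str v R.1 h, ?_⟩
    have hbij : Function.Bijective (toValuationSubring v R.1 h) := by
      refine ⟨fun a b hab => IsFractionRing.injective _ X.K (congrArg Subtype.val hab), ?_⟩
      rintro ⟨f, hf⟩
      obtain ⟨r, hr⟩ := (int_place_iff hN R f).1 (hR ▸ hf)
      exact ⟨r, Subtype.ext hr⟩
    haveI hloc : IsLocalHom (toValuationSubring v R.1 h) :=
      ⟨fun r hr => (MulEquiv.isUnit_map (RingEquiv.ofBijective _ hbij)).1 hr⟩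
    change X.toScheme.fromSpecStalk R.1 (Spec.map (CommRingCat.ofHom (toValuationSubring v R.1 h))
      (IsLocalRing.closedPoint v.valuationSubring)) = R.1
    have h1 : Spec.map (CommRingCat.ofHom (toValuationSubring v R.1 h))
        (IsLocalRing.closedPoint v.valuationSubring) =
        IsLocalRing.closedPoint _ := IsLocalRing.comap_closedPoint _
    rw [h1, Scheme.fromSpecStalk_closedPoint]
  obtain ⟨l₁, h₁, h₁', h₁''⟩ := key P rfl
  obtain ⟨l₂, h₂, h₂', h₂''⟩ := key Q hPQ.symm
  haveI := X.isSeparated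
  let S : ValuativeCommSq X.str :=
    { R := v.valuationSubring
      K := X.K
      i₁ := X.toScheme.fromSpecStalk (genericPoint X.toScheme)
      i₂ := Spec.map (CommRingCat.ofHom (constToValuationSubring v))
      commSq := ⟨by rw [← h₁, Category.assoc, h₁']⟩ }
  have hS := IsSeparated.valuativeCriterion X.str S
  have := congrArg CommSq.LiftStruct.l (Subsingleton.elim (⟨l₁, h₁, h₁'⟩ : S.commSq.LiftStruct)
    ⟨l₂, h₂, h₂'⟩)
  apply Subtype.ext
  rw [← h₁'', ← h₂'']
  exact congrArg (fun l : Spec (.of v.valuationSubring) ⟶ X.toScheme =>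
    l (IsLocalRing.closedPoint v.valuationSubring)) this

/-- On a proper curve, every place comes from a point. -/
lemma place_surjective (hX : topologicalKrullDim X.toScheme = 1) (hN : X.IsNormal)
    (hproper : IsProper X.str) : Function.Surjective (place (X := X) hN) := by
  intro v
  let S : ValuativeCommSq X.str :=
    { R := v.valuationSubring
      K := X.K
      i₁ := X.toScheme.fromSpecStalk (genericPoint X.toScheme)
      i₂ := Spec.map (CommRingCat.ofHom (constToValuationSubring v))
      commSq := ⟨by
        rw [fromSpecStalk_str, ← Spec.map_comp]
        rfl⟩ }
  have hS := (IsProper.eq_valuativeCriterion ▸ hproper :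
    (ValuativeCriterion ⊓ @QuasiCompact ⊓ @QuasiSeparated ⊓ @LocallyOfFiniteType) X.str)
  -- The wanted point is the image of the closed point under the lift.
  obtain ⟨⟨l, hl, -⟩⟩ := (hS.1.1.1.existence S).exists_lift
  let l' : Spec (.of v.valuationSubring) ⟶ X.toScheme := l
  have hl' : Spec.map (CommRingCat.ofHom (algebraMap v.valuationSubring X.K)) ≫ l' =
      X.toScheme.fromSpecStalk (genericPoint X.toScheme) := hl
  set x := l' (IsLocalRing.closedPoint v.valuationSubring) with hx
  let φ : X.toScheme.presheaf.stalk x ⟶ .of v.valuationSubring := Scheme.stalkClosedPointTo l'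
  have hφ : Spec.map φ ≫ X.toScheme.fromSpecStalk x = l' :=
    Scheme.Spec_stalkClosedPointTo_fromSpecStalk l'
  have hcomp : φ ≫ CommRingCat.ofHom (algebraMap v.valuationSubring X.K) =
      X.toScheme.presheaf.stalkSpecializes ((genericPoint_spec X.toScheme).specializes
        (trivial : x ∈ (⊤ : Set X.toScheme))) := by
    apply Spec.map_injective
    rw [← cancel_mono (X.toScheme.fromSpecStalk x), Spec.map_comp, Category.assoc, hφ, hl']
    exact (Scheme.SpecMap_stalkSpecializes_fromSpecStalk _).symm
  have hint : ∀ r : X.toScheme.presheaf.stalk x, v.Int (algebraMap _ X.K r) := by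
    intro r
    have h1 : algebraMap v.valuationSubring X.K (φ.hom r) = algebraMap _ X.K r :=
      congrArg (fun h => h.hom r) hcomp
    rw [← h1]
    exact (φ.hom r).2
  -- The local ring at the generic point is the whole field, which is too large for the ring of a
  -- place.
  have hne : x ≠ genericPoint X.toScheme := by
    intro hgen
    have hall : ∀ f : X.K, v.Int f := by
      intro f
      obtain ⟨r, rfl⟩ := algebraMap_surjective hgen f
      exact hint r
    obtain ⟨τ, hτ⟩ := v.exists_uniformizer
    have h1 := hall τ⁻¹
    unfold Place.Int at h1
    rw [v.ord_inv] at h1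
    omega
  refine ⟨⟨x, coheight_eq_one hX hne⟩, Place.ext_of_int fun f hf => ?_⟩
  obtain ⟨r, rfl⟩ := (int_place_iff hN _ f).1 hf
  exact hint r

end Variety

end
end EpsComplement

namespace EpsComplement
noncomputable section

/-! ### Log discrepancies on curves -/

lemma IsCurveField.of_bijective {K L : Type} [Field K] [Field L] [Algebra ℂ K] [Algebra ℂ L]
    [IsCurveField K] (σ : K →ₐ[ℂ] L) (hσ : Function.Bijective σ) : IsCurveField L := by
  refine ⟨?_, ?_⟩
  · haveI := IsCurveField.essFiniteType (K := K)
    exact Algebra.EssFiniteType.of_surjective σ hσ.2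
  · rw [← (AlgEquiv.ofBijective σ hσ).trdeg_eq]
    exact IsCurveField.trdeg

instance isIso_stalkSpecializes {X : Scheme.{0}} {x y : X} (h : x = y) :
    IsIso (X.presheaf.stalkSpecializes (specializes_of_eq h)) := by
  subst h
  rw [TopCat.Presheaf.stalkSpecializes_refl]
  infer_instance

/-- A prime divisor of `X` as a prime divisor over `X`. -/
def DivisorOver.self {X : Variety} (hN : X.IsNormal) (P : X.PrimeDivisor) : DivisorOver X where
  Y := X
  normal := hN
  f := 𝟙 _
  map_str := Category.id_comp _
  proper := inferInstance
  dominant := inferInstance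
  birational := by
    haveI := isIso_stalkSpecializes (map_genericPoint (X := X) (Y := X) (𝟙 X.toScheme))
    have : IsIso (pullbackHom (X := X) (Y := X) (𝟙 X.toScheme)) := IsIso.comp_isIso
    exact ConcreteCategory.bijective_of_isIso (pullbackHom (𝟙 X.toScheme))
  E := P

section

variable {X : Variety}

lemma DivisorOver.comap_int (E : DivisorOver X) (r : X.toScheme.presheaf.stalk E.center) :
    ((Variety.place E.normal E.E).comap (pullbackFun E.f E.map_str) E.birational).Int
      (algebraMap _ X.K r) := by
  change (Variety.place E.normal E.E).Int ((pullbackHom E.f).hom (algebraMap _ X.K r))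
  have h := pullbackHom_algebraMap E.f E.E.1 r
  rw [Variety.int_place_iff]
  exact ⟨_, h.symm⟩

lemma DivisorOver.center_ne (E : DivisorOver X) : E.center ≠ genericPoint X.toScheme := by
  intro hgen
  obtain ⟨τ, hτ⟩ := ((Variety.place E.normal E.E).comap (pullbackFun E.f E.map_str)
    E.birational).exists_uniformizer
  obtain ⟨r, hr⟩ := Variety.algebraMap_surjective hgen τ⁻¹
  have h1 := E.comap_int r
  rw [hr] at h1
  unfold Place.Int at h1
  rw [Place.ord_inv] at h1
  omega

/-- The center of a prime divisor over a curve, as a prime divisor. -/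
def DivisorOver.centerDivisor (hX : topologicalKrullDim X.toScheme = 1)
    (E : DivisorOver X) : X.PrimeDivisor :=
  ⟨E.center, Variety.coheight_eq_one hX E.center_ne⟩

/-- A proper birational modification of a normal curve yields no new valuation: the ring of the
place of `E` contains the local ring at the center, and `ext_of_int` applies. This is why log
discrepancies are `1 - B P`. -/
lemma DivisorOver.place_eq (hX : topologicalKrullDim X.toScheme = 1) (hN : X.IsNormal)
    (E : DivisorOver X) : Variety.place hN (E.centerDivisor hX) =
    (Variety.place E.normal E.E).comap (pullbackFun E.f E.map_str) E.birational := by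
  refine Place.ext_of_int fun f hf => ?_
  obtain ⟨r, rfl⟩ := (Variety.int_place_iff hN _ f).1 hf
  exact E.comap_int r

lemma formOrd_eq (hN : X.IsNormal) (ω : Ω[X.K⁄ℂ]) (P : X.PrimeDivisor) [IsCurveField X.K] :
    formOrd ω P = (Variety.place hN P).formOrd ω := rfl

lemma DivisorOver.formOrd_eq (hX : topologicalKrullDim X.toScheme = 1) (hN : X.IsNormal)
    (E : DivisorOver X) (ω : Ω[X.K⁄ℂ]) :
    formOrd (formMap (pullbackFun E.f E.map_str) ω) E.E = formOrd ω (E.centerDivisor hX) := by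
  haveI := Variety.isCurveField hX
  haveI := IsCurveField.of_bijective _ E.birational
  rw [EpsComplement.formOrd_eq hN, EpsComplement.formOrd_eq E.normal]
  obtain ⟨τ, hτ⟩ := (Variety.place hN (E.centerDivisor hX)).exists_uniformizer
  obtain ⟨g, rfl⟩ := exists_eq_smul_D (Place.transcendental_of_ord
    (v := Variety.place hN (E.centerDivisor hX)) (x := τ) (by omega)) ω
  rw [formMap_smul_D, Place.formOrd_smul_uniformizer hτ, Place.formOrd_smul_uniformizer,
    DivisorOver.place_eq hX hN E]
  · rfl
  · rw [DivisorOver.place_eq hX hN E] at hτ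
    exact hτ

lemma DivisorOver.isMultPullback_eq (hX : topologicalKrullDim X.toScheme = 1)
    (hN : X.IsNormal) (E : DivisorOver X) {D : X.PrimeDivisor → ℝ} {m : ℝ}
    (h : E.IsMultPullback D m) : m = D (E.centerDivisor hX) := by
  obtain ⟨U, g, hU, hg, rfl⟩ := h
  rw [hg (E.centerDivisor hX) hU, rdiv]
  refine Finsupp.sum_congr fun φ _ => ?_
  have h := congrArg (fun v : Place X.K => v.ord (φ : X.K)) (E.place_eq hX (by
    exact hN))
  rw [show X.toScheme.ord (φ : X.K) (E.centerDivisor hX).1 = _ from h]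
  rfl

lemma DivisorOver.isLogDiscrepancy_eq (hX : topologicalKrullDim X.toScheme = 1)
    (hN : X.IsNormal) (E : DivisorOver X) {B : X.RDivisor} {a : ℝ}
    (h : E.IsLogDiscrepancy B a) : a = 1 - B (E.centerDivisor hX) := by
  obtain ⟨ω, m, hω, hm, rfl⟩ := h
  rw [E.isMultPullback_eq hX hN hm, DivisorOver.formOrd_eq hX hN E, logCanonical]
  ring

lemma exists_form_ne_zero (hX : topologicalKrullDim X.toScheme = 1) : ∃ ω : Ω[X.K⁄ℂ], ω ≠ 0 := by
  haveI := Variety.isCurveField hX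
  obtain ⟨t, ht⟩ := exists_transcendental X.K
  exact ⟨_, D_ne_zero ht⟩

/-- `IsLogDiscrepancy` asks for a local equation; the `ℝ`-Cartier hypothesis supplies it, so that
`P` really contributes to the infimum `mld`. -/
lemma isLogDiscrepancy_self (hX : topologicalKrullDim X.toScheme = 1)
    (hN : X.IsNormal) (P : X.PrimeDivisor) {B : X.RDivisor} {ω : Ω[X.K⁄ℂ]} (hω : ω ≠ 0)
    (hB : IsRCartier (logCanonical ω B)) :
    (DivisorOver.self hN P).IsLogDiscrepancy B (1 - B P) := by
  obtain ⟨U, hU, g, hg⟩ := hB P.1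
  have hm : (DivisorOver.self hN P).IsMultPullback (logCanonical ω B)
    (g.sum fun φ r => r * ((DivisorOver.self hN P).Y.toScheme.ord (pullbackFun
      (DivisorOver.self hN P).f (DivisorOver.self hN P).map_str (φ : X.K))
        (DivisorOver.self hN P).E.1 : ℝ)) := ⟨U, g, hU, hg, rfl⟩
  have hc : (DivisorOver.self hN P).centerDivisor hX = P := rfl
  refine ⟨ω, _, hω, hm, ?_⟩
  rw [DivisorOver.isMultPullback_eq hX hN _ hm, DivisorOver.formOrd_eq hX hN, logCanonical, hc]
  ring

variable {Z : Variety} {π : X.toScheme ⟶ Z.toScheme} {z : Z.toScheme}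

lemma isEpsLC_of_le (hX : topologicalKrullDim X.toScheme = 1) (hN : X.IsNormal) {ε : ℝ} {B : X.RDivisor} (h : ∀ P : X.PrimeDivisor, π P.1 = z → B P ≤ 1 - ε) :
    IsEpsLC π z ε B := by
  refine le_sInf ?_
  rintro _ ⟨E, hE, a, ha, rfl⟩
  rw [DivisorOver.isLogDiscrepancy_eq hX hN E ha]
  have := h (E.centerDivisor hX) hE
  exact_mod_cast (by linarith : ε ≤ 1 - B (E.centerDivisor hX))

lemma IsEpsLC.le (hX : topologicalKrullDim X.toScheme = 1) (hN : X.IsNormal) {ε : ℝ} {B : X.RDivisor} (h : IsEpsLC π z ε B) {ω : Ω[X.K⁄ℂ]} (hω : ω ≠ 0)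
    (hB : IsRCartier (logCanonical ω B)) (P : X.PrimeDivisor) (hP : π P.1 = z) : B P ≤ 1 - ε := by
  have h1 : (ε : EReal) ≤ ((1 - B P : ℝ) : EReal) :=
    le_trans h (sInf_le ⟨DivisorOver.self hN P, hP, _, isLogDiscrepancy_self hX hN P hω hB, rfl⟩)
  have h2 : ε ≤ 1 - B P := by exact_mod_cast h1
  linarith

end

end
end EpsComplement

namespace EpsComplement
noncomputable section

/-! ### Divisors on curves -/

section

variable {X : Variety}

lemma isClosed_primeDivisor (hX : topologicalKrullDim X.toScheme = 1) (hN : X.IsNormal)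
    (P : X.PrimeDivisor) : IsClosed ({P.1} : Set X.toScheme) := by
  rw [← closure_eq_iff_isClosed]
  refine subset_antisymm (fun x hx => ?_) subset_closure
  have hspec : P.1 ⤳ x := specializes_iff_mem_closure.2 hx
  have hPne : P.1 ≠ genericPoint X.toScheme := by
    intro h
    have h1 := P.2
    rw [h] at h1
    have h2 : Order.coheight (genericPoint X.toScheme) = 0 :=
      Order.coheight_eq_zero.2 fun y hy => genericPoint_specializes y
    rw [h2] at h1
    exact zero_ne_one h1
  have hxne : x ≠ genericPoint X.toScheme := by
    rintro rfl
    exact hPne (Specializes.antisymm hspec (genericPoint_specializes _)).eq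
  let Q : X.PrimeDivisor := ⟨x, Variety.coheight_eq_one hX hxne⟩
  -- The local ring at a specialization `x` of `P` lies in the one at `P`. Both are rings of places,
  -- so the places agree, and with them the points.
  have h : Variety.place hN Q = Variety.place hN P := by
    refine Place.ext_of_int fun f hf => ?_
    obtain ⟨r, rfl⟩ := (Variety.int_place_iff hN Q f).1 hf
    refine (Variety.int_place_iff hN P _).2 ⟨(X.toScheme.presheaf.stalkSpecializes hspec).hom r, ?_⟩
    have h1 := X.toScheme.presheaf.stalkSpecializes_comp
      ((genericPoint_spec X.toScheme).specializes (trivial : P.1 ∈ (⊤ : Set X.toScheme))) hspec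
    exact congrArg (fun h => h.hom r) h1
  exact congrArg Subtype.val (Variety.place_injective hN h)

lemma finite_ord_ne_zero (hX : topologicalKrullDim X.toScheme = 1) (hN : X.IsNormal) (φ : X.K) :
    {P : X.PrimeDivisor | X.toScheme.ord φ P.1 ≠ 0}.Finite := by
  haveI := Variety.isCurveField hX
  exact (Place.finite_support φ).preimage (Variety.place_injective hN).injOn

lemma exists_open_avoiding (hX : topologicalKrullDim X.toScheme = 1) (hN : X.IsNormal)
    {S : Set X.PrimeDivisor} (hS : S.Finite) (x : X.toScheme) :
    ∃ U : X.toScheme.Opens, x ∈ U ∧ ∀ P ∈ S, P.1 ∈ U → P.1 = x := by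
  have hc : IsClosed (Subtype.val '' (S \ {P : X.PrimeDivisor | P.1 = x})) := by
    rw [← Set.biUnion_of_singleton (Subtype.val '' _), Set.biUnion_image]
    exact (hS.subset Set.sdiff_subset).isClosed_biUnion fun P _ => isClosed_primeDivisor hX hN P
  refine ⟨⟨_, hc.isOpen_compl⟩, ?_, fun P hP hPU => ?_⟩
  · rintro ⟨P, ⟨-, hP⟩, h⟩
    exact hP h
  · by_contra hne
    exact hPU ⟨P, ⟨hP, hne⟩, rfl⟩

lemma rdiv_single (φ : X.Kˣ) (r : ℝ) (P : X.PrimeDivisor) :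
    rdiv (Finsupp.single φ r) P = r * X.toScheme.ord (φ : X.K) P.1 := by
  rw [rdiv, Finsupp.sum_single_index]
  rw [zero_mul]

lemma rdiv_add (g h : X.Kˣ →₀ ℝ) (P : X.PrimeDivisor) : rdiv (g + h) P = rdiv g P + rdiv h P := by
  rw [rdiv, Finsupp.sum_add_index']
  · rfl
  · intro; rw [zero_mul]
  · intros; rw [add_mul]

lemma finite_rdiv_ne_zero (hX : topologicalKrullDim X.toScheme = 1) (hN : X.IsNormal)
    (g : X.Kˣ →₀ ℝ) : {P : X.PrimeDivisor | rdiv g P ≠ 0}.Finite := by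
  refine (g.support.finite_toSet.biUnion fun φ _ => finite_ord_ne_zero hX hN (φ : X.K)).subset
    fun P hP => ?_
  by_contra hcon
  simp only [Set.mem_iUnion, not_exists, Set.mem_ofPred_eq, not_not] at hcon
  refine hP (Finset.sum_eq_zero fun φ hφ => ?_)
  beta_reduce
  rw [hcon φ hφ, Int.cast_zero, mul_zero]

lemma IsRCartier.add {D D' : X.PrimeDivisor → ℝ} (h : IsRCartier D) (h' : IsRCartier D') :
    IsRCartier (fun P => D P + D' P) := by
  intro x
  obtain ⟨U, hU, g, hg⟩ := h x
  obtain ⟨U', hU', g', hg'⟩ := h' x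
  refine ⟨U ⊓ U', ⟨hU, hU'⟩, g + g', fun P hP => ?_⟩
  beta_reduce
  rw [rdiv_add, hg P hP.1, hg' P hP.2]

/-- Near `P` a uniformizer with real exponent `D P` is an equation, once the other points of `D` and
the other zeros and poles of the uniformizer are removed. -/
lemma isRCartier_divisor (hX : topologicalKrullDim X.toScheme = 1) (hN : X.IsNormal)
    (D : X.RDivisor) : IsRCartier D := by
  intro x
  by_cases hx : ∃ P : X.PrimeDivisor, P.1 = x
  · obtain ⟨P, rfl⟩ := hx
    obtain ⟨τ, hτ⟩ := (Variety.place hN P).exists_uniformizer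
    have hτ0 : τ ≠ 0 := Place.ne_zero_of_ord (v := Variety.place hN P) (by omega)
    obtain ⟨U, hU, hS⟩ := exists_open_avoiding hX hN
      (D.support.finite_toSet.union (finite_ord_ne_zero hX hN τ)) P.1
    refine ⟨U, hU, Finsupp.single (Units.mk0 τ hτ0) (D P), fun Q hQ => ?_⟩
    rw [rdiv_single, Units.val_mk0]
    by_cases hQP : Q = P
    · subst hQP
      rw [show X.toScheme.ord τ Q.1 = 1 from hτ, Int.cast_one, mul_one]
    · have hmem : Q ∉ (D.support : Set X.PrimeDivisor) ∪ {P | X.toScheme.ord τ P.1 ≠ 0} :=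
        fun h => hQP (Subtype.ext (hS Q h hQ))
      simp only [Set.mem_union, Finset.mem_coe, Finsupp.mem_support_iff, Set.mem_ofPred_eq, not_or,
        not_not] at hmem
      rw [hmem.1, hmem.2, Int.cast_zero, mul_zero]
  · obtain ⟨U, hU, hS⟩ := exists_open_avoiding hX hN D.support.finite_toSet x
    refine ⟨U, hU, 0, fun Q hQ => ?_⟩
    have hQ0 : D Q = 0 := by
      by_contra h
      exact hx ⟨Q, hS Q (by simpa using h) hQ⟩
    rw [hQ0]
    simp [rdiv]

/-- Every `ℝ`-divisor on a normal curve is `ℝ`-Cartier, so the boundary can be exchanged freely. -/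
lemma isRCartier_logCanonical (hX : topologicalKrullDim X.toScheme = 1) (hN : X.IsNormal)
    {ω : Ω[X.K⁄ℂ]} {B : X.RDivisor} (h : IsRCartier (logCanonical ω B)) (B' : X.RDivisor) :
    IsRCartier (logCanonical ω B') := by
  have h1 := h.add (isRCartier_divisor hX hN (B' - B))
  convert h1 using 2 with P
  simp [logCanonical]

variable {Z : Variety} {π : X.toScheme ⟶ Z.toScheme} {z : Z.toScheme}

lemma IsPair.of_le_one (hX : topologicalKrullDim X.toScheme = 1) {B : X.RDivisor}
    (h : IsPair π z B) {B' : X.RDivisor} (h0 : ∀ P, 0 ≤ B' P) (h1 : ∀ P, B' P ≤ 1) :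
    IsPair π z B' where
  contraction := h.contraction
  nonneg := h0
  le_one := h1
  rCartier ω hω := isRCartier_logCanonical hX h.contraction.normal_source (h.rCartier ω hω) B'
  dim_lt := h.dim_lt

/-- Near any point, a rational differential form has finitely many zeros and poles. -/
lemma exists_open_finite_formOrd (hX : topologicalKrullDim X.toScheme = 1) (hN : X.IsNormal)
    {ω : Ω[X.K⁄ℂ]} {B : X.RDivisor} (h : IsRCartier (logCanonical ω B)) (x : X.toScheme) :
    ∃ U : X.toScheme.Opens, x ∈ U ∧
      {P : X.PrimeDivisor | P.1 ∈ U ∧ formOrd ω P ≠ 0}.Finite := by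
  obtain ⟨U, hU, g, hg⟩ := h x
  refine ⟨U, hU, (B.support.finite_toSet.union (finite_rdiv_ne_zero hX hN g)).subset
    fun P ⟨hP, hP'⟩ => ?_⟩
  by_contra hcon
  simp only [Set.mem_union, Finset.mem_coe, Finsupp.mem_support_iff, Set.mem_ofPred_eq, not_or,
    not_not] at hcon
  have h1 := hg P hP
  rw [logCanonical, hcon.1, hcon.2, add_zero] at h1
  exact hP' (by exact_mod_cast h1)

end

end
end EpsComplement

namespace EpsComplement
noncomputable section

/-! ### Contractions -/

attribute [local instance] MvPolynomial.gradedAlgebra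

lemma isProper_projSpaceStr (n : ℕ) : IsProper (projSpaceStr n) := by
  haveI : IsScalarTower ℂ (MvPolynomial.homogeneousSubmodule (Fin (n + 1)) ℂ 0)
      (MvPolynomial (Fin (n + 1)) ℂ) :=
    ⟨fun x y w => smul_assoc x (y : MvPolynomial (Fin (n + 1)) ℂ) w⟩
  haveI : Algebra.FiniteType (MvPolynomial.homogeneousSubmodule (Fin (n + 1)) ℂ 0)
      (MvPolynomial (Fin (n + 1)) ℂ) :=
    Algebra.FiniteType.of_restrictScalars_finiteType ℂ _ _
  have hbij : Function.Bijective
      (algebraMap ℂ (MvPolynomial.homogeneousSubmodule (Fin (n + 1)) ℂ 0)) := by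
    refine ⟨fun a b hab => MvPolynomial.C_injective (Fin (n + 1)) ℂ
      (congrArg Subtype.val hab), ?_⟩
    rintro ⟨q, hq⟩
    refine ⟨q.coeff 0, Subtype.ext ?_⟩
    have hq' : q.IsHomogeneous 0 := hq
    exact ((MvPolynomial.totalDegree_eq_zero_iff_eq_C).1 (Nat.le_zero.1 hq'.totalDegree_le)).symm
  haveI : IsIso (CommRingCat.ofHom
      (algebraMap ℂ (MvPolynomial.homogeneousSubmodule (Fin (n + 1)) ℂ 0))) :=
    (ConcreteCategory.isIso_iff_bijective _).2 hbij
  unfold projSpaceStr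
  infer_instance

lemma IsProjective.isProper {X Z : Variety} {π : X.toScheme ⟶ Z.toScheme} (h : IsProjective π) :
    IsProper π := by
  obtain ⟨n, i, hi, rfl⟩ := h
  haveI := isProper_projSpaceStr n
  infer_instance

lemma isIso_of_isAffineHom {X Y : Scheme.{0}} (f : X ⟶ Y) [IsAffineHom f]
    (h : ∀ U : Y.Opens, IsIso (f.app U)) : IsIso f := by
  refine (IsZariskiLocalAtTarget.iff_of_iSup_eq_top (P := MorphismProperty.isomorphisms Scheme)
    (fun U : Y.affineOpens => U.1) (iSup_affineOpens_eq_top Y)).2 fun U => ?_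
  exact (isIso_morphismRestrict_iff_isIso_app f U.2).2 (h U.1)

namespace IsContraction

variable {X Z : Variety} {π : X.toScheme ⟶ Z.toScheme}

/-- A nonempty open set missing the image would have the zero ring as sections upstairs, hence
downstairs. -/
lemma isDominant (h : IsContraction π) : IsDominant π := by
  refine ⟨?_⟩
  by_contra hd
  let U : Z.toScheme.Opens := ⟨(closure (Set.range π))ᶜ, isClosed_closure.isOpen_compl⟩
  have hU : Nonempty U := by
    rw [denseRange_iff_closure_range, Set.eq_univ_iff_forall] at hd
    push Not at hd
    obtain ⟨x, hx⟩ := hd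
    exact ⟨⟨x, hx⟩⟩
  have hbot : π ⁻¹ᵁ U = ⊥ := by
    ext x
    simp only [Scheme.Hom.coe_preimage, Set.mem_preimage]
    constructor
    · intro hx
      exact absurd (subset_closure (Set.mem_range_self x)) hx
    · intro hx
      exact absurd hx (Set.notMem_empty x)
  haveI := h.pushforward U
  have h1 := (ConcreteCategory.bijective_of_isIso (π.app U)).1
  haveI : Subsingleton Γ(X.toScheme, π ⁻¹ᵁ U) := by
    rw [hbot]
    infer_instance
  exact not_subsingleton Γ(Z.toScheme, U) h1.subsingleton

lemma map_genericPoint (h : IsContraction π) :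
    π (genericPoint X.toScheme) = genericPoint Z.toScheme := by
  haveI := h.isDominant
  exact EpsComplement.map_genericPoint π

lemma ne_genericPoint (h : IsContraction π) {z : Z.toScheme} (hz : z ≠ genericPoint Z.toScheme)
    {x : X.toScheme} (hx : π x = z) : x ≠ genericPoint X.toScheme := by
  rintro rfl
  exact hz (hx.symm.trans h.map_genericPoint)

/-- A contraction of a curve has finite fibres over the points that are not generic. -/
lemma finite_fiber (h : IsContraction π) (hX : topologicalKrullDim X.toScheme = 1)
    {z : Z.toScheme} (hz : z ≠ genericPoint Z.toScheme) : (π ⁻¹' {z}).Finite := by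
  haveI := h.isDominant
  have hN := h.normal_source
  have hnf : ¬ IsField (Z.toScheme.presheaf.stalk z) := by
    intro hf
    have h1 := ringKrullDim_stalk_eq_coheight z
    rw [ringKrullDim_eq_zero_of_isField hf] at h1
    have h2 : Order.coheight z = 0 := by exact_mod_cast h1.symm
    rw [Order.coheight_eq_zero] at h2
    have h3 := h2 (b := genericPoint Z.toScheme) (genericPoint_specializes z)
    exact hz (Specializes.antisymm (Scheme.le_iff_specializes.1 h3) (genericPoint_specializes z)).eq
  -- The pull-back of a nonzero nonunit at `z` vanishes on the whole fibre, and a nonzero function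
  -- has finitely many zeros.
  obtain ⟨t, ht0, htu⟩ := Ring.exists_not_isUnit_of_not_isField hnf
  set s : X.K := (pullbackHom π).hom (algebraMap _ Z.K t) with hs
  have hs0 : s ≠ 0 := by
    have : (algebraMap (Z.toScheme.presheaf.stalk z) Z.K) t ≠ 0 := by simpa using ht0
    rw [hs]
    exact (map_ne_zero_iff _ (pullbackHom π).hom.injective).2 this
  refine ((finite_ord_ne_zero hX hN s).image Subtype.val).subset fun x hx => ?_
  have hxz : π x = z := hx
  subst hxz
  refine ⟨⟨x, Variety.coheight_eq_one hX (h.ne_genericPoint hz rfl)⟩, ?_, rfl⟩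
  set P : X.PrimeDivisor := ⟨x, Variety.coheight_eq_one hX (h.ne_genericPoint hz rfl)⟩ with hP
  intro hord
  have h1 : s = algebraMap _ X.K ((π.stalkMap x).hom t) := pullbackHom_algebraMap π x t
  have h2 : (Variety.place hN P).Int s⁻¹ := by
    unfold Place.Int
    rw [Place.ord_inv]
    have : (Variety.place hN P).ord s = 0 := hord
    rw [this, neg_zero]
  obtain ⟨r, hr⟩ := (Variety.int_place_iff hN P _).1 h2
  refine htu (isUnit_of_map_unit (π.stalkMap x).hom t (IsUnit.of_mul_eq_one r ?_))
  apply IsFractionRing.injective (X.toScheme.presheaf.stalk x) X.K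
  rw [map_mul, map_one, ← h1]
  exact (congrArg (s * ·) hr).trans (mul_inv_cancel₀ hs0)

/-- A contraction of a curve is an isomorphism near any point that is not generic. -/
lemma exists_isIso (h : IsContraction π) (hX : topologicalKrullDim X.toScheme = 1)
    {z : Z.toScheme} (hz : z ≠ genericPoint Z.toScheme) :
    ∃ V : Z.toScheme.Opens, z ∈ V ∧ IsIso (π ∣_ V) := by
  haveI := h.projective.isProper
  -- A proper morphism with a finite fibre is finite over a neighbourhood. A finite morphism is
  -- affine, and with `π_* 𝒪_X = 𝒪_Z` it is an isomorphism.
  obtain ⟨V, hV, hfin⟩ := exists_isFinite_morphismRestrict_of_finite_preimage_singleton π z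
    (h.finite_fiber hX hz)
  refine ⟨V, hV, isIso_of_isAffineHom _ fun U => ?_⟩
  rw [morphismRestrict_app]
  exact @IsIso.comp_isIso _ _ _ _ _ _ _ (h.pushforward (V.ι ''ᵁ U))
    (@Functor.map_isIso _ _ _ _ _ _ X.toScheme.presheaf _ (by infer_instance))

/-- The fibre is one point because `π` is an isomorphism near `z`; the statement on neighbourhoods
holds because `π` is closed. -/
lemma exists_unique_point (h : IsContraction π) (hX : topologicalKrullDim X.toScheme = 1)
    {z : Z.toScheme} (hz : z ≠ genericPoint Z.toScheme) :
    ∃ P : X.PrimeDivisor, π P.1 = z ∧ (∀ x, π x = z → x = P.1) ∧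
      ∀ U : X.toScheme.Opens, P.1 ∈ U → ∃ V : Z.toScheme.Opens, z ∈ V ∧ π ⁻¹ᵁ V ≤ U := by
  obtain ⟨V, hV, hiso⟩ := h.exists_isIso hX hz
  haveI := h.projective.isProper
  have hbij := (π ∣_ V).homeomorph.bijective
  obtain ⟨⟨x, hxV⟩, hx⟩ := hbij.2 ⟨z, hV⟩
  have hval : ∀ y : (π ⁻¹ᵁ V : X.toScheme.Opens), ((π ∣_ V) y).1 = π y.1 := fun y => by
    have := congrArg (fun f : (π ⁻¹ᵁ V).toScheme ⟶ Z.toScheme => f y) (morphismRestrict_ι π V)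
    exact this
  have hxz : π x = z := by
    rw [← hval ⟨x, hxV⟩]
    exact congrArg Subtype.val hx
  have huniq : ∀ y, π y = z → y = x := by
    intro y hy
    have hyV : y ∈ π ⁻¹ᵁ V := by
      change π y ∈ V
      rwa [hy]
    refine congrArg Subtype.val (hbij.1 (a₁ := ⟨y, hyV⟩) (a₂ := ⟨x, hxV⟩) (Subtype.ext ?_))
    exact ((hval ⟨y, hyV⟩).trans hy).trans (hxz.symm.trans (hval ⟨x, hxV⟩).symm)
  refine ⟨⟨x, Variety.coheight_eq_one hX (h.ne_genericPoint hz hxz)⟩, hxz, huniq, fun U hU => ?_⟩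
  refine ⟨⟨(π '' (U : Set X.toScheme)ᶜ)ᶜ,
    (π.isClosedMap _ U.isOpen.isClosed_compl).isOpen_compl⟩, ?_, ?_⟩
  · rintro ⟨y, hyU, hy⟩
    exact hyU (huniq y hy ▸ hU)
  · intro y hy
    by_contra hyU
    exact hy ⟨y, hyU, rfl⟩

end IsContraction

end
end EpsComplement

namespace EpsComplement
noncomputable section

/-! ### Complements over a point that is not generic -/

section Local

variable {X Z : Variety} {π : X.toScheme ⟶ Z.toScheme} {z : Z.toScheme} {ε : ℝ} {n : ℕ}
  {B B' : X.RDivisor}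

/-- On a curve the lc conditions are bounds on coefficients, so a complement amounts to inequalities
and one equation for `n (K_X + B')`. -/
lemma IsNComplement.of_principal (hX : topologicalKrullDim X.toScheme = 1) (hB : IsPair π z B)
    (h0 : ∀ P, 0 ≤ B' P) (h1 : ∀ P, B' P ≤ 1) (hε : ∀ P : X.PrimeDivisor, π P.1 = z → B' P ≤ 1 - ε)
    {V : Z.toScheme.Opens} (hV : z ∈ V) {ω : Ω[X.K⁄ℂ]} (hω : ω ≠ 0) {φ : X.K} (hφ : φ ≠ 0)
    (heq : ∀ P : X.PrimeDivisor, P.1 ∈ π ⁻¹ᵁ V →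
      (n : ℝ) * logCanonical ω B' P = (X.toScheme.ord φ P.1 : ℝ))
    (hround : ∀ P : X.PrimeDivisor, P.1 ∈ π ⁻¹ᵁ V → (roundUp n (B P) : ℝ) ≤ n * B' P) :
    IsNComplement π z ε n B B' where
  pair := hB.of_le_one hX h0 h1
  nhd := by
    refine ⟨V, hV, fun E _ a ha => ?_, ⟨ω, φ, hω, hφ, heq⟩, fun P hP => ?_⟩
    · rw [E.isLogDiscrepancy_eq hX hB.contraction.normal_source ha, sub_nonneg]
      exact h1 _
    · have h := floor_formula (n := n) (hB.nonneg P) (hB.le_one P)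
      have h' : (n : ℝ) * (⌊B P⌋ : ℝ) + (⌊((n : ℝ) + 1) * Int.fract (B P)⌋ : ℝ) =
          (roundUp n (B P) : ℝ) := by exact_mod_cast h
      rw [h']
      exact hround P hP
  epsLC := isEpsLC_of_le hX hB.contraction.normal_source hε

/-- Near the only point `P` over `z` all divisors are principal. So `(r / n) P` with `r = roundUp n
(B P)` is a complement as soon as `r ≤ n (1 - ε)`, and `n` times the log canonical divisor is that
of a power of a uniformizer. -/
lemma isNComplementary_of_ne_genericPoint (hX : topologicalKrullDim X.toScheme = 1)
    (hB : IsPair π z B) (hz : z ≠ genericPoint Z.toScheme) (hn : 0 < n)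
    (hround : ∀ P : X.PrimeDivisor, π P.1 = z → (roundUp n (B P) : ℝ) ≤ n * (1 - ε)) :
    IsNComplementary π z ε n B := by
  classical
  have hN := hB.contraction.normal_source
  haveI := Variety.isCurveField hX
  obtain ⟨P, hPz, -, hPV⟩ := hB.contraction.exists_unique_point hX hz
  obtain ⟨ω, hω⟩ := exists_form_ne_zero hX
  obtain ⟨τ, hτ⟩ := (Variety.place hN P).exists_uniformizer
  obtain ⟨U₁, hPU₁, hU₁⟩ := exists_open_finite_formOrd hX hN (hB.rCartier ω hω) P.1
  have hS : ({Q | B Q ≠ 0} ∪ {Q | X.toScheme.ord τ Q.1 ≠ 0} ∪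
      {Q | Q.1 ∈ U₁ ∧ formOrd ω Q ≠ 0} : Set X.PrimeDivisor).Finite := by
    refine (Set.Finite.union ?_ (finite_ord_ne_zero hX hN τ)).union hU₁
    exact B.support.finite_toSet.subset fun Q hQ => Finsupp.mem_support_iff.2 hQ
  obtain ⟨U₂, hPU₂, hU₂⟩ := exists_open_avoiding hX hN hS P.1
  obtain ⟨V, hzV, hV⟩ := hPV (U₁ ⊓ U₂) ⟨hPU₁, hPU₂⟩
  have hbad : ∀ Q : X.PrimeDivisor, Q.1 ∈ π ⁻¹ᵁ V → Q ≠ P →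
      B Q = 0 ∧ X.toScheme.ord τ Q.1 = 0 ∧ formOrd ω Q = 0 := by
    intro Q hQ hne
    have hQ' := hV hQ
    have key : Q ∉ ({Q | B Q ≠ 0} ∪ {Q | X.toScheme.ord τ Q.1 ≠ 0} ∪
        {Q | Q.1 ∈ U₁ ∧ formOrd ω Q ≠ 0} : Set X.PrimeDivisor) := fun h =>
      hne (Subtype.ext (hU₂ Q h hQ'.2))
    simp only [Set.mem_union, Set.mem_ofPred_eq, not_or, not_and, not_not] at key
    exact ⟨key.1.1, key.1.2, key.2 hQ'.1⟩
  have hn' : (0 : ℝ) < n := by exact_mod_cast hn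
  set r : ℤ := roundUp n (B P) with hr
  have hr0 : (0 : ℝ) ≤ r := by exact_mod_cast roundUp_nonneg (hB.nonneg P)
  have hr1 : (r : ℝ) ≤ n := by exact_mod_cast roundUp_le_self (n := n) (hB.le_one P)
  have hτ0 : τ ≠ 0 := (Variety.place hN P).ne_zero_of_ord (by rw [hτ]; exact one_ne_zero)
  refine ⟨Finsupp.single P ((r : ℝ) / n), IsNComplement.of_principal hX hB ?_ ?_ ?_ hzV hω
    (φ := τ ^ ((n : ℤ) * formOrd ω P + r)) (zpow_ne_zero _ hτ0) ?_ ?_⟩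
  · intro Q
    rw [Finsupp.single_apply]
    split_ifs
    · positivity
    · exact le_rfl
  · intro Q
    rw [Finsupp.single_apply]
    split_ifs
    · exact (div_le_one hn').2 hr1
    · exact zero_le_one
  · intro Q hQ
    rw [Finsupp.single_apply]
    split_ifs with h
    · exact (div_le_iff₀' hn').2 (hround P hPz)
    · have := (hr0.trans (hround P hPz))
      exact nonneg_of_mul_nonneg_right this hn'
  · intro Q hQ
    have hord : X.toScheme.ord (τ ^ ((n : ℤ) * formOrd ω P + r)) Q.1 =
        ((n : ℤ) * formOrd ω P + r) * X.toScheme.ord τ Q.1 :=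
      (Variety.place hN Q).ord_zpow τ _
    rw [hord]
    unfold logCanonical
    rw [Finsupp.single_apply]
    by_cases hQP : P = Q
    · subst hQP
      have : X.toScheme.ord τ P.1 = 1 := hτ
      rw [if_pos rfl, this]
      push_cast
      field_simp
    · obtain ⟨-, h1, h2⟩ := hbad Q hQ (Ne.symm hQP)
      rw [if_neg hQP, h1, h2]
      simp
  · intro Q hQ
    rw [Finsupp.single_apply]
    by_cases hQP : P = Q
    · subst hQP
      rw [if_pos rfl, mul_div_cancel₀ _ hn'.ne']
    · obtain ⟨h1, -, -⟩ := hbad Q hQ (Ne.symm hQP)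
      rw [if_neg hQP, h1]
      simp [roundUp]

end Local

end
end EpsComplement

namespace EpsComplement
noncomputable section

/-! ### Contractions to a point -/

lemma Variety.subsingleton_of_topologicalKrullDim_lt {Z : Variety}
    (h : topologicalKrullDim Z.toScheme < 1) : Subsingleton Z.toScheme := by
  have h0 : topologicalKrullDim Z.toScheme ≤ 0 := by
    have := (ENat.WithBot.lt_add_one_iff (n := topologicalKrullDim Z.toScheme) (m := 0)).1
      (by simpa using h)
    simpa using this
  haveI := IsLocallyArtinian.of_topologicalKrullDim_le_zero h0
  refine ⟨fun a b => ?_⟩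
  have key : ∀ a : Z.toScheme, genericPoint Z.toScheme = a := fun a => by
    have := (genericPoint_spec Z.toScheme).specializes (Set.mem_univ a)
    exact (specializes_iff_eq.1 this)
  rw [← key a, ← key b]

lemma Variety.isFinite_str {Z : Variety} [Subsingleton Z.toScheme] : IsFinite Z.str := by
  haveI := Z.locallyOfFiniteType
  exact isFinite_iff_locallyOfFiniteType_of_jacobsonSpace.2 inferInstance

/-- The closure of the generic point is `Z`, so `dim_lt` reads `dim Z < 1`. This is what makes `X`
complete. -/
lemma IsPair.subsingleton {X Z : Variety} {π : X.toScheme ⟶ Z.toScheme} {B : X.RDivisor}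
    (hX : topologicalKrullDim X.toScheme = 1) (h : IsPair π (genericPoint Z.toScheme) B) :
    Subsingleton Z.toScheme := by
  have h1 := h.dim_lt
  rw [hX, (genericPoint_spec Z.toScheme : closure _ = _),
    (Homeomorph.Set.univ _).isHomeomorph.topologicalKrullDim_eq] at h1
  exact Variety.subsingleton_of_topologicalKrullDim_lt h1

lemma IsContraction.isProper_str {X Z : Variety} {π : X.toScheme ⟶ Z.toScheme}
    (h : IsContraction π) [Subsingleton Z.toScheme] : IsProper X.str := by
  haveI := h.projective.isProper
  haveI := Z.isFinite_str
  rw [← h.map_str]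
  infer_instance

end
end EpsComplement

namespace EpsComplement
noncomputable section

/-! ### Complements on complete curves -/

section Field

variable {K : Type*} [Field K] [Algebra ℂ K] [IsCurveField K]

lemma Place.sum_ord_eq_zero (x : K) {s : Finset (Place K)}
    (hs : (Function.support fun v : Place K => v.ord x) ⊆ s) : ∑ v ∈ s, v.ord x = 0 := by
  rw [← finsum_eq_sum_of_support_subset _ hs, Place.finsum_ord]

/-- If `div ω + b` is the `ℝ`-divisor of some element of `Kˣ ⊗ ℝ`, then `div η + b` has degree
zero for every `η ≠ 0`. -/
lemma exists_sum_formOrd_add_eq_zero {ω η : Ω[K⁄ℂ]} (hω : ω ≠ 0) (hη : η ≠ 0) {b : Place K → ℝ}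
    {g : Kˣ →₀ ℝ}
    (h : ∀ v : Place K, (v.formOrd ω : ℝ) + b v = g.sum fun φ r => r * (v.ord (φ : K) : ℝ)) :
    ∃ s₀ : Finset (Place K), (∀ v ∉ s₀, (v.formOrd η : ℝ) + b v = 0) ∧
      ∀ s, s₀ ⊆ s → ∑ v ∈ s, ((v.formOrd η : ℝ) + b v) = 0 := by
  classical
  obtain ⟨u, rfl⟩ := exists_eq_smul hω η
  have hu : u ≠ 0 := fun h0 => hη (by rw [h0, zero_smul])
  have key : ∀ v : Place K, (v.formOrd (u • ω) : ℝ) + b v =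
      (v.ord u : ℝ) + ∑ φ ∈ g.support, g φ * (v.ord (φ : K) : ℝ) := by
    intro v
    rw [v.formOrd_smul hu hω]
    push_cast
    rw [add_assoc, h v, Finsupp.sum]
  refine ⟨(Place.finite_support u).toFinset ∪
    g.support.biUnion fun φ => (Place.finite_support (φ : K)).toFinset, fun v hv => ?_,
    fun s hs => ?_⟩
  · simp only [Finset.mem_union, Set.Finite.mem_toFinset, Function.mem_support, ne_eq, not_or,
      not_not, Finset.mem_biUnion, not_exists, not_and] at hv
    rw [key, hv.1, Finset.sum_eq_zero fun φ hφ => by rw [hv.2 φ hφ, Int.cast_zero, mul_zero]]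
    simp
  · rw [Finset.sum_congr rfl fun v _ => key v, Finset.sum_add_distrib, Finset.sum_comm]
    have h1 : ∑ v ∈ s, (v.ord u : ℝ) = 0 := by
      rw [← Int.cast_sum, Place.sum_ord_eq_zero u, Int.cast_zero]
      intro v hv
      exact hs (Finset.mem_union_left _ ((Set.Finite.mem_toFinset _).2 hv))
    rw [h1, zero_add]
    refine Finset.sum_eq_zero fun φ hφ => ?_
    rw [← Finset.mul_sum, ← Int.cast_sum, Place.sum_ord_eq_zero (φ : K), Int.cast_zero, mul_zero]
    intro v hv
    exact hs (Finset.mem_union_right _ (Finset.mem_biUnion.2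
      ⟨φ, hφ, (Set.Finite.mem_toFinset _).2 hv⟩))

/-- Here `b` is an `ℝ`-complement on a complete curve. If `η` is regular, `div η + b` is effective
of degree `0`, so both summands vanish and `D = 0`, `n = p` work. On a rational curve `b` has degree
`2` and its rounded coefficients add up to at most `2 * n`; `k` new points with coefficient `1 / n`
fill the gap, and `n div η + D`, of degree `0`, is principal. -/
lemma exists_integral_complement {c : ℝ} {p N : ℕ} (hp : 0 < p) (hpN : p ≤ N) (hc : c ≤ 1)
    (hbound : 0 < c → ∀ m : Multiset ℝ, (∀ x ∈ m, 0 ≤ x ∧ x ≤ 1) → m.sum = 2 →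
      ∃ n, 0 < n ∧ n ≤ N ∧ p ∣ n ∧ IsAdapted c n ∧ (m.map (roundUp n)).sum ≤ 2 * n)
    {ω : Ω[K⁄ℂ]} (hω : ω ≠ 0) {b : Place K → ℝ} (hb0 : ∀ v, 0 ≤ b v) (hbc : ∀ v, b v ≤ c)
    (hfin : (Function.support b).Finite) {g : Kˣ →₀ ℝ}
    (h : ∀ v : Place K, (v.formOrd ω : ℝ) + b v = g.sum fun φ r => r * (v.ord (φ : K) : ℝ)) :
    ∃ n, 0 < n ∧ n ≤ N ∧ p ∣ n ∧ ∃ (D : Place K → ℤ) (η : Ω[K⁄ℂ]) (φ : K),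
      (Function.support D).Finite ∧ η ≠ 0 ∧ φ ≠ 0 ∧ (∀ v, n * v.formOrd η + D v = v.ord φ) ∧
      ∀ v, roundUp n (b v) ≤ D v ∧ (D v : ℝ) ≤ n * c := by
  classical
  have hround0 : ∀ n, roundUp n 0 = 0 := fun n => by simp [roundUp]
  rcases exists_regular_form_or_rational K with ⟨η, hη, hreg⟩ | ⟨η, v₀, hη, hv₀, hv, hprin⟩
  · obtain ⟨s₀, hs₀, hsum⟩ := exists_sum_formOrd_add_eq_zero hω hη h
    have hnn : ∀ v : Place K, 0 ≤ (v.formOrd η : ℝ) + b v := fun v =>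
      add_nonneg (by exact_mod_cast hreg v) (hb0 v)
    have hz : ∀ v : Place K, (v.formOrd η : ℝ) + b v = 0 := by
      intro v
      by_cases hvs : v ∈ s₀
      · exact (Finset.sum_eq_zero_iff_of_nonneg fun w _ => hnn w).1 (hsum s₀ subset_rfl) v hvs
      · exact hs₀ v hvs
    have hform : ∀ v : Place K, v.formOrd η = 0 := fun v => by
      have h1 : (v.formOrd η : ℝ) ≤ 0 := by linarith [hz v, hb0 v]
      exact le_antisymm (by exact_mod_cast h1) (hreg v)
    have hb : ∀ v, b v = 0 := fun v => by simpa [hform v] using hz v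
    refine ⟨p, hp, hpN, dvd_rfl, 0, η, 1, by simp, hη, one_ne_zero, fun v => ?_, fun v => ?_⟩
    · rw [hform v, Place.ord_one]
      simp
    · rw [hb v, hround0]
      have : 0 ≤ c := (hb0 v).trans (hbc v)
      refine ⟨le_rfl, ?_⟩
      simp only [Pi.zero_apply, Int.cast_zero]
      positivity
  · obtain ⟨s₀, -, hsum⟩ := exists_sum_formOrd_add_eq_zero hω hη h
    set s : Finset (Place K) := insert v₀ (s₀ ∪ hfin.toFinset) with hs
    have hv₀s : v₀ ∈ s := Finset.mem_insert_self _ _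
    have hbs : ∀ v ∉ s, b v = 0 := fun v hvs => by
      by_contra hne
      exact hvs (Finset.mem_insert_of_mem (Finset.mem_union_right _ (hfin.mem_toFinset.2 hne)))
    have hformsum : ∀ t : Finset (Place K), v₀ ∈ t → ∑ v ∈ t, v.formOrd η = -2 := by
      intro t ht
      rw [Finset.sum_eq_single v₀ (fun v _ hne => hv v hne) (fun h' => absurd ht h'), hv₀]
    have hbsum : ∑ v ∈ s, b v = 2 := by
      have h1 := hsum s fun v hvs => Finset.mem_insert_of_mem (Finset.mem_union_left _ hvs)
      rw [Finset.sum_add_distrib, ← Int.cast_sum, hformsum s hv₀s] at h1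
      push_cast at h1
      linarith
    have hc0 : 0 < c := by
      by_contra hc0
      have : ∑ v ∈ s, b v ≤ 0 := Finset.sum_nonpos fun v _ => (hbc v).trans (not_lt.1 hc0)
      linarith
    obtain ⟨n, hn, hnN, hpn, had, hle⟩ := hbound hc0 (s.val.map b)
      (fun x hx => by
        obtain ⟨v, -, rfl⟩ := Multiset.mem_map.1 hx
        exact ⟨hb0 v, (hbc v).trans hc⟩) hbsum
    have hle' : ∑ v ∈ s, roundUp n (b v) ≤ 2 * n := by
      rw [Multiset.map_map] at hle
      exact hle
    obtain ⟨k, hk⟩ := Int.eq_ofNat_of_zero_le (sub_nonneg.2 hle')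
    -- Weight `1` in `D` at the new places is allowed because `IsAdapted` includes `1 ≤ n * c`.
    obtain ⟨T, hTs, hTk⟩ := (s.finite_toSet.infinite_compl).exists_subset_card_eq k
    have hdisj : Disjoint s T := Finset.disjoint_left.2 fun v hvs hvT => hTs hvT hvs
    set D : Place K → ℤ := fun v => if v ∈ T then 1 else roundUp n (b v) with hD
    have hD0 : ∀ v ∉ s ∪ T, D v = 0 := by
      intro v hvs
      rw [Finset.mem_union, not_or] at hvs
      simp only [hD, if_neg hvs.2, hbs v hvs.1, hround0]
    have hDs : ∑ v ∈ s, D v = ∑ v ∈ s, roundUp n (b v) := Finset.sum_congr rfl fun v hvs => by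
      simp only [hD, if_neg (Finset.disjoint_left.1 hdisj hvs)]
    have hDT : ∑ v ∈ T, D v = k := by
      rw [Finset.sum_congr rfl fun v hvT => (if_pos hvT : D v = 1), Finset.sum_const, hTk]
      simp
    obtain ⟨φ, hφ, hφD⟩ := hprin (s ∪ T) (fun v => n * v.formOrd η + D v)
      (fun v hvs => by
        have hne : v ≠ v₀ := fun h' => hvs (Finset.mem_union_left _ (h' ▸ hv₀s))
        simp only [hv v hne, hD0 v hvs, mul_zero, add_zero])
      (by
        rw [Finset.sum_add_distrib, ← Finset.mul_sum,
          hformsum _ (Finset.mem_union_left _ hv₀s), Finset.sum_union hdisj, hDs, hDT]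
        linarith)
    refine ⟨n, hn, hnN, hpn, D, η, φ, ?_, hη, hφ, fun v => (hφD v).symm, fun v => ?_⟩
    · refine (s ∪ T).finite_toSet.subset fun v hvD => ?_
      by_contra hvs
      exact hvD (hD0 v hvs)
    · by_cases hvT : v ∈ T
      · have hvs : v ∉ s := Finset.disjoint_right.1 hdisj hvT
        simp only [hD, if_pos hvT, hbs v hvs, hround0]
        exact ⟨zero_le_one, by simpa using had.1⟩
      · simp only [hD, if_neg hvT]
        exact ⟨le_rfl, had.2 _ (hb0 v) (hbc v)⟩

end Field

/-- Since `Z` is a point, the prime divisors of `X` are all the places of its function field. The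
`ℝ`-complement `B'` is rounded instead of `B`, which suffices because `roundUp` is monotone. -/
lemma exists_isNComplementary_of_genericPoint {X Z : Variety} {π : X.toScheme ⟶ Z.toScheme}
    {ε : ℝ} {p N : ℕ} {B : X.RDivisor} (hX : topologicalKrullDim X.toScheme = 1)
    (hp : 0 < p) (hpN : p ≤ N) (hε : 0 ≤ ε)
    (hbound : 0 < 1 - ε → ∀ m : Multiset ℝ, (∀ x ∈ m, 0 ≤ x ∧ x ≤ 1) → m.sum = 2 →
      ∃ n, 0 < n ∧ n ≤ N ∧ p ∣ n ∧ IsAdapted (1 - ε) n ∧ (m.map (roundUp n)).sum ≤ 2 * n)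
    (hB : IsPair π (genericPoint Z.toScheme) B)
    (hcomp : IsRComplementary π (genericPoint Z.toScheme) ε B) :
    ∃ n, 0 < n ∧ n ≤ N ∧ p ∣ n ∧ IsNComplementary π (genericPoint Z.toScheme) ε n B := by
  have hN := hB.contraction.normal_source
  haveI := Variety.isCurveField hX
  haveI := hB.subsingleton hX
  have hplace : Function.Bijective (Variety.place hN) :=
    ⟨Variety.place_injective hN, Variety.place_surjective hX hN hB.contraction.isProper_str⟩
  let e : X.PrimeDivisor ≃ Place X.K := Equiv.ofBijective _ hplace
  obtain ⟨B', hB'⟩ := hcomp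
  obtain ⟨V, hV, ω, g, hω, heq⟩ := hB'.rLinEquiv
  have hmem : ∀ P : X.PrimeDivisor, P.1 ∈ π ⁻¹ᵁ V := fun P => by
    change π P.1 ∈ V
    rwa [Subsingleton.elim (π P.1) (genericPoint Z.toScheme)]
  have hle : ∀ P, B' P ≤ 1 - ε := fun P =>
    hB'.epsLC.le hX hN hω (hB'.pair.rCartier ω hω) P (Subsingleton.elim _ _)
  have hfin : (Function.support fun v => B' (e.symm v)).Finite := by
    refine (B'.support.finite_toSet.preimage e.symm.injective.injOn).subset fun v hv => ?_
    exact Finsupp.mem_support_iff.2 hv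
  obtain ⟨n, hn, hnN, hpn, D, η, φ, hDfin, hη, hφ, hprin, hround⟩ :=
    exists_integral_complement (c := 1 - ε) hp hpN (by linarith) hbound hω
      (b := fun v => B' (e.symm v)) (fun v => hB'.pair.nonneg _) (fun v => hle _) hfin (g := g)
      (fun v => by
        obtain ⟨P, rfl⟩ := e.surjective v
        have h1 := heq P (hmem P)
        unfold logCanonical at h1
        rw [formOrd_eq hN] at h1
        rw [e.symm_apply_apply]
        exact h1)
  have hn' : (0 : ℝ) < n := by exact_mod_cast hn
  have hfinD : (Function.support fun P => (D (e P) : ℝ) / n).Finite := by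
    refine (hDfin.preimage e.injective.injOn).subset fun P hP => ?_
    intro h0
    exact hP (by simp [h0])
  have hround' : ∀ P, (roundUp n (B P) : ℝ) ≤ D (e P) := fun P => by
    have h1 := (hround (e P)).1
    rw [e.symm_apply_apply] at h1
    exact_mod_cast (roundUp_mono (hB'.le P) (hB'.pair.le_one P)).trans h1
  have hc : ∀ P, (D (e P) : ℝ) / n ≤ 1 - ε := fun P => (div_le_iff₀' hn').2 (hround (e P)).2
  refine ⟨n, hn, hnN, hpn, Finsupp.ofSupportFinite _ hfinD,
    IsNComplement.of_principal hX hB (fun P => ?_) (fun P => ?_) (fun P _ => hc P) (V := V) hV hη hφ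
      (fun P _ => ?_) (fun P _ => ?_)⟩
  · refine div_nonneg (le_trans ?_ (hround' P)) hn'.le
    exact_mod_cast roundUp_nonneg (hB.nonneg P)
  · exact (hc P).trans (by linarith)
  · have h1 : ((n * (e P).formOrd η + D (e P) : ℤ) : ℝ) = (e P).ord φ := by rw [hprin]
    unfold logCanonical
    rw [formOrd_eq hN]
    refine Eq.trans ?_ h1
    change (n : ℝ) * (((e P).formOrd η : ℝ) + (D (e P) : ℝ) / n) = _
    push_cast
    field_simp
  · change (roundUp n (B P) : ℝ) ≤ n * ((D (e P) : ℝ) / n)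
    rw [mul_div_cancel₀ _ hn'.ne']
    exact hround' P

end
end EpsComplement

/-! ### The theorem: `z` generic or not. -/

theorem theorem1p7 (ε : ℝ) (hε : 0 ≤ ε) (p : ℕ) (hp : 0 < p) :
    ∃ N : ℕ, 0 < N ∧
      ∀ (X Z : EpsComplement.Variety) (π : X.toScheme ⟶ Z.toScheme) (z : Z.toScheme)
        (B : X.RDivisor),
        topologicalKrullDim X.toScheme = 1 →
        EpsComplement.IsPair π z B →
        EpsComplement.IsRComplementary π z ε B →
        ∃ n : ℕ, 0 < n ∧ n ≤ N ∧ p ∣ n ∧ EpsComplement.IsNComplementary π z ε n B := by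
  obtain ⟨N, hpN, hN⟩ : ∃ N, p ≤ N ∧ (0 < 1 - ε → ∀ m : Multiset ℝ,
      (∀ x ∈ m, 0 ≤ x ∧ x ≤ 1) → m.sum = 2 → ∃ n, 0 < n ∧ n ≤ N ∧ p ∣ n ∧
        EpsComplement.IsAdapted (1 - ε) n ∧ (m.map (EpsComplement.roundUp n)).sum ≤ 2 * n) := by
    by_cases hc : 0 < 1 - ε
    · obtain ⟨N, hN⟩ := EpsComplement.exists_bound hc (by linarith) hp
      refine ⟨max p N, le_max_left _ _, fun _ m hm hs => ?_⟩
      obtain ⟨n, hn, hnN, h⟩ := hN m hm hs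
      exact ⟨n, hn, hnN.trans (le_max_right _ _), h⟩
    -- For `ε ≥ 1` the arithmetic is vacuous and `n = p` will serve.
    · exact ⟨p, le_rfl, fun h => absurd h hc⟩
  refine ⟨N, hp.trans_le hpN, fun X Z π z B hX hB hcomp => ?_⟩
  by_cases hz : z = genericPoint Z.toScheme
  · subst hz
    exact EpsComplement.exists_isNComplementary_of_genericPoint hX hp hpN hε hN hB hcomp
  have hle : ∀ P : X.PrimeDivisor, π P.1 = z → B P ≤ 1 - ε := by
    obtain ⟨B', hB'⟩ := hcomp
    obtain ⟨ω, hω⟩ := EpsComplement.exists_form_ne_zero hX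
    exact fun P hP => (hB'.le P).trans (hB'.epsLC.le hX hB.contraction.normal_source hω
      (hB'.pair.rCartier ω hω) P hP)
  by_cases hc : 0 < 1 - ε
  -- Only an adapted `n` is wanted; `{1, 1}` is just some multiset of sum `2`.
  · obtain ⟨n, hn, hnN, hpn, had, -⟩ := hN hc {1, 1} (by simp) (by norm_num)
    exact ⟨n, hn, hnN, hpn, EpsComplement.isNComplementary_of_ne_genericPoint hX hB hz hn
      fun P hP => had.2 _ (hB.nonneg P) (hle P hP)⟩
  · refine ⟨p, hp, hpN, dvd_rfl, EpsComplement.isNComplementary_of_ne_genericPoint hX hB hz hp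
      fun P hP => ?_⟩
    -- From `0 ≤ B P ≤ 1 - ε ≤ 0` it follows that `B P = 0` and `ε = 1`.
    have h0 : B P = 0 := le_antisymm ((hle P hP).trans (not_lt.1 hc)) (hB.nonneg P)
    have h1 : 1 - ε = 0 := le_antisymm (not_lt.1 hc) (h0 ▸ hle P hP)
    rw [h0, h1]
    simp [EpsComplement.roundUp]
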